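/- **Setting.** Let $\mathcal M=(\mathcal S,\mathcal A,r,c,P,\rho)$ be a CMDP with finite $\mathcal S,\mathcal A$, reward $r\in[0,1]$, constraint cost $c\in[-1,1]$, transition kernel $P$ and initial law $\rho$. For a policy $\pi:\mathcal S\to\Delta(\mathcal A)$ and $g\in\{r,c\}$ let $J_g^\pi=\lim_{N\to\infty}\frac1N\mathbb E_\pi[\sum_{t<N}g(s_t,a_t)\mid s_0\sim\rho]$, let $Q_g^\pi(s,a)=\sum_{t\ge0}(\mathbb E_\pi[g(s_t,a_t)\mid s_0=s,a_0=a]-J_g^\pi)$, $V_g^\pi(s)=\sum_a\pi(a|s)Q_g^\pi(s,a)$, $A_g^\pi=Q_g^\pi-V_g^\pi$, let $d^\pi$ be the stationary law of the induced chain $P^\pi$, and $\nu^\pi(s,a)=d^\pi(s)\pi(a|s)$. Let $\pi^*$ maximize $J_r^\pi$ over all policies with $J_c^\pi\ge0$. Let $\{\pi_\theta\}_{\theta\in\mathbb R^d}$ be a policy class, $J_g(\theta)=J_g^{\pi_\theta}$, $F(\theta)=\mathbb E_{\nu^{\pi_\theta}}[\nabla_\theta\log\pi_\theta(a|s)\nabla_\theta\log\pi_\theta(a|s)^\top]$,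 and let $\tau_{\rm mix}=\sup_\theta\min\{t\ge1:\ \|(P^{\pi_\theta})^t(s,\cdot)-d^{\pi_\theta}\|_{TV}\le\frac14\ \forall s\}$. Let $\phi_g:\mathcal S\to\mathbb R^m$ be features with $\|\phi_g\|\le1$. For a transition $z=(s,a,s')$ put $$\mathbf A_g(z)=\begin{pmatrix}c_\gamma&0\\ \phi_g(s)&\phi_g(s)(\phi_g(s)-\phi_g(s'))^\top\end{pmatrix},\qquad \mathbf b_g(z)=\begin{pmatrix}c_\gamma g(s,a)\\ g(s,a)\phi_g(s)\end{pmatrix};$$ let $\mathbb E_\theta$ be the expectation for $(s,a)\sim\nu^{\pi_\theta}$, $s'\sim P(\cdot|s,a)$, and $[\eta_g^*(\theta),\zeta_g^*(\theta)]=(\mathbb E_\theta\mathbf A_g)^{-1}\mathbb E_\theta\mathbf b_g$. **Assumptions.** (1) $J_c(\bar\theta)\ge\delta$ for some $\bar\theta$, where $\delta\in(0,1)$. (2) Under every policy the state chain is irreducible and aperiodic. (3) $\epsilon_{\rm app}=\max_{g}\sup_\theta\mathbb E_{s\sim d^{\pi_\theta}}[(\zeta_g^*(\theta)^\top\phi_g(s)-V_g^{\pi_\theta}(s))^2]<\infty$.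 (4) For some $\lambda>0$, $x^\top\mathbb E_\theta[\phi_g(s)(\phi_g(s)-\phi_g(s'))^\top]x\ge\lambda\|x\|^2$ for all $x,\theta,g$; and $c_\gamma\ge\lambda+\sqrt{\max(\lambda^{-2}-1,0)}$. (5) With $L_\nu(\omega,\theta,l)=\mathbb E_\nu[(\nabla_\theta\log\pi_\theta(a|s)\cdot\omega-A_r^{\pi_\theta}(s,a)-l\,A_c^{\pi_\theta}(s,a))^2]$ and $\omega^*_{\theta,l}=\arg\min_\omega L_{\nu^{\pi_\theta}}(\omega,\theta,l)$, one has $L_{\nu^{\pi^*}}(\omega^*_{\theta,l},\theta,l)\le\epsilon_{\rm bias}$ for all $\theta$ and $l\in[0,2/\delta]$. (6) $\pi_\theta(a|s)>0$, $\log\pi_\theta(a|s)$ is differentiable in $\theta$, and its gradient is bounded by $G_1>0$ and $G_2$-Lipschitz, $G_2>0$. (7) $F(\theta)-\mu I$ is positive semidefinite for all $\theta$, where $\mu>0$. **Algorithm (PDNAC).** Start from $\theta_0$, $\lambda_0=0$ and a state $s_0\sim\rho$; all samples come from one trajectory that is continued throughout. A multi-level estimate of a function $v(z)$ of a transition under $\pi_\theta$: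 draw $q$ with $\Pr(q=j)=2^{-j}$, $j\ge1$; run $\pi_\theta$ from the current state for $2^q$ steps if $2^q\le T_{\max}$ and for one step otherwise, giving transitions $z_0,z_1,\dots$; with $v^j=2^{-j}\sum_{t<2^j}v(z_t)$ return $v^0+2^q(v^q-v^{q-1})\mathbf 1(2^q\le T_{\max})$. In epoch $k=0,\dots,K-1$: (critic) from $\xi_g=[\eta_g,\zeta_g]=0$ do $H$ times $\xi_g\leftarrow\xi_g-\gamma_\xi\hat v_g$, with $\hat v_g$ the multi-level estimate of $\mathbf A_g(z)\xi_g-\mathbf b_g(z)$ under $\pi_{\theta_k}$; (actor) from $\omega_g=0$ do $H$ times $\omega_g\leftarrow\omega_g-\gamma_\omega\hat u_g$, with $\hat u_g$ the multi-level estimate of $\psi\psi^\top\omega_g-[g(s,a)-\eta_g+\zeta_g^\top(\phi_g(s')-\phi_g(s))]\psi$, $\psi=\nabla_\theta\log\pi_{\theta_k}(a|s)$ (both $g$ use the same samples); then $\theta_{k+1}=\theta_k+\alpha(\omega_r+\lambda_k\omega_c)$ and $\lambda_{k+1}=\mathcal P_{[0,2/\delta]}[\lambda_k-\beta\eta_c]$.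 **Theorem.** For a horizon $T\ge2$ take $\alpha=\beta=T^{-1/2}$, $T_{\max}=T$, $\gamma_\xi=\frac{2\log T}{\lambda H}$, $\gamma_\omega=\frac{2\log T}{\mu H}$, $K=\lfloor T/H\rfloor$ and $H=\tilde\Theta(\tau_{\rm mix}^2)$, that is $c_0\tau_{\rm mix}^2\log^2T\le H\le c_1\tau_{\rm mix}^2\log^{q}T$. For every $q$ there is an exponent $p$ depending only on $q$, there is a constant $c_0>0$ depending only on $q,G_1,G_2,\mu,\lambda,c_\gamma,\delta$, and for all $c_1$, $D$ and every value of $\tau_{\rm mix}$ there is a constant $C$ depending only on these quantities, $c_1$, $D$ and $\tau_{\rm mix}$, such that, whenever $\mathbb E_{s\sim d^{\pi^*}}[KL(\pi^*(\cdot|s)\|\pi_{\theta_0}(\cdot|s))]\le D$, the step sizes satisfy $$\gamma_\xi\le\frac{\lambda}{24c_\gamma^2\tau_{\rm mix}\log T_{\max}},\qquad \gamma_\omega\le\frac{\mu}{4(6G_1^4\tau_{\rm mix}\log T_{\max}+2G_1^2\tau_{\rm mix}^2\log T_{\max})},$$ and $$\frac1K\sum_{k=0}^{K-1}\mathbb E[J_r^{\pi^*}-J_r(\theta_k)]\le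 C(\log T)^p\Big(\sqrt{\epsilon_{\rm bias}}+\sqrt{\epsilon_{\rm app}}+\frac1{\sqrt T}\Big),$$ $$\frac1K\sum_{k=0}^{K-1}\mathbb E[-J_c(\theta_k)]\le C(\log T)^p\Big(\sqrt{\epsilon_{\rm bias}}+\sqrt{\epsilon_{\rm app}}+\frac1{\sqrt T}\Big)$$ (for $K=0$ the averages are read as $0$). -/

import Mathlib

open scoped BigOperators

noncomputable section

namespace PDNAC

/-- The probability that `p` gives to `x`, as a real number. -/
def prob {X : Type*} (p : PMF X) (x : X) : ℝ := (p x).toReal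

/-- The expectation of a real function under a discrete law. -/
def expect {X : Type*} (p : PMF X) (f : X → ℝ) : ℝ := ∑' x, prob p x * f x

/-- The two signals `r` (reward) and `c` (constraint cost). -/
inductive Sig where
  | r
  | c

/-- A finite constrained Markov decision process. -/
structure CMDP (S A : Type*) where
  r : S → A → ℝ
  c : S → A → ℝ
  r_mem : ∀ s a, r s a ∈ Set.Icc (0 : ℝ) 1
  c_mem : ∀ s a, c s a ∈ Set.Icc (-1 : ℝ) 1
  P : S → A → PMF S
  ρ : PMF S

/-- A (stationary, randomized) policy. -/
abbrev Policy (S A : Type*) := S → PMF A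

/-- The parameter space `ℝ^n` with its Euclidean norm. -/
abbrev E (n : ℕ) := EuclideanSpace ℝ (Fin n)

section Model

variable {S A : Type*} [Fintype S] [DecidableEq S] [Fintype A]

def CMDP.sig (M : CMDP S A) : Sig → S → A → ℝ
  | .r => M.r
  | .c => M.c

/-- The state transition matrix `P^π(s,s') = ∑ₐ π(a|s) P(s'|s,a)`. -/
def CMDP.trans (M : CMDP S A) (π : Policy S A) : Matrix S S ℝ :=
  Matrix.of fun s s' => ∑ a, prob (π s) a * prob (M.P s a) s'

/-- No common period: for every state `s` the gcd of the possible return times is one. -/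
def Aperiodic (Q : Matrix S S ℝ) : Prop :=
  ∀ s, ∀ k : ℕ, (∀ n : ℕ, 1 ≤ n → 0 < (Q ^ n) s s → k ∣ n) → k = 1

/-- Under every policy the induced state chain is irreducible and aperiodic. -/
def CMDP.Ergodic (M : CMDP S A) : Prop :=
  ∀ π : Policy S A, (M.trans π).IsIrreducible ∧ Aperiodic (M.trans π)

/-- `𝔼_π[g(s_t,a_t) | s_0 = s]`. -/
def CMDP.meanAt (M : CMDP S A) (π : Policy S A) (g : Sig) (t : ℕ) (s : S) : ℝ :=
  ∑ s', (M.trans π ^ t) s s' * ∑ a, prob (π s') a * M.sig g s' a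

/-- The long-run average `J_g^π = lim_T (1/T) 𝔼_π[∑_{t<T} g(s_t,a_t) | s_0 ∼ ρ]`. -/
def CMDP.J (M : CMDP S A) (g : Sig) (π : Policy S A) : ℝ :=
  Filter.limUnder Filter.atTop fun T : ℕ =>
    (1 / (T : ℝ)) * ∑ t ∈ Finset.range T, ∑ s, prob M.ρ s * M.meanAt π g t s

/-- `D` is a stationary probability vector of the chain induced by `π`. -/
def CMDP.IsStationary (M : CMDP S A) (π : Policy S A) (D : S → ℝ) : Prop :=
  (∀ s, 0 ≤ D s) ∧ ∑ s, D s = 1 ∧ ∀ s', ∑ s, D s * M.trans π s s' = D s'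

/-- The stationary distribution `d^π` (unique for an ergodic CMDP). -/
def CMDP.statDist (M : CMDP S A) (π : Policy S A) : S → ℝ :=
  Classical.epsilon (M.IsStationary π)

/-- The occupancy measure `ν^π(s,a) = d^π(s) π(a|s)`. -/
def CMDP.occ (M : CMDP S A) (π : Policy S A) (s : S) (a : A) : ℝ :=
  M.statDist π s * prob (π s) a

/-- The mixing time of one policy: the first `t ≥ 1` at which the total variation distance
to `d^π` is at most `1/4` from every starting state. -/
def CMDP.mixTime (M : CMDP S A) (π : Policy S A) : ℕ :=
  sInf {t : ℕ | 1 ≤ t ∧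
    ∀ s, (1 / 2 : ℝ) * ∑ s', |(M.trans π ^ t) s s' - M.statDist π s'| ≤ 1 / 4}

/-- `𝔼_π[g(s_t,a_t) | s_0 = s, a_0 = a]`. -/
def CMDP.meanAtSA (M : CMDP S A) (π : Policy S A) (g : Sig) : ℕ → S → A → ℝ
  | 0, s, a => M.sig g s a
  | t + 1, s, a => ∑ s', prob (M.P s a) s' * M.meanAt π g t s'

def CMDP.Q (M : CMDP S A) (g : Sig) (π : Policy S A) (s : S) (a : A) : ℝ :=
  ∑' t : ℕ, (M.meanAtSA π g t s a - M.J g π)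

def CMDP.V (M : CMDP S A) (g : Sig) (π : Policy S A) (s : S) : ℝ :=
  ∑ a, prob (π s) a * M.Q g π s a

def CMDP.Adv (M : CMDP S A) (g : Sig) (π : Policy S A) (s : S) (a : A) : ℝ :=
  M.Q g π s a - M.V g π s

/-- `πs` solves `max_π J_r^π` subject to `J_c^π ≥ 0` over all policies. -/
def CMDP.IsOptimal (M : CMDP S A) (πs : Policy S A) : Prop :=
  0 ≤ M.J .c πs ∧ ∀ π : Policy S A, 0 ≤ M.J .c π → M.J .r π ≤ M.J .r πs

/-- `𝔼_{s ∼ d^{πs}} KL(πs(·|s) ‖ π(·|s))`. -/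
def CMDP.klFrom (M : CMDP S A) (πs π : Policy S A) : ℝ :=
  ∑ s, M.statDist πs s *
    ∑ a, prob (πs s) a * Real.log (prob (πs s) a / prob (π s) a)

end Model

section Parametrized

variable {S A : Type*} [Fintype S] [DecidableEq S] [Fintype A] {d m : ℕ}

/-- The overall mixing time of the parametrized class. -/
def tauMix (M : CMDP S A) (π : E d → Policy S A) : ℕ := ⨆ θ, M.mixTime (π θ)

/-- The score `∇_θ log π_θ(a|s)`. -/
def score (π : E d → Policy S A) (θ : E d) (s : S) (a : A) : E d :=
  gradient (fun θ' => Real.log (prob (π θ' s) a)) θ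

/-- The Fisher information matrix. -/
def fisher (M : CMDP S A) (π : E d → Policy S A) (θ : E d) : Matrix (Fin d) (Fin d) ℝ :=
  ∑ s, ∑ a, M.occ (π θ) s a • Matrix.vecMulVec (score π θ s a) (score π θ s a)

/-- The compatible function approximation error `L_ν(ω,θ,l)`. -/
def compErr (M : CMDP S A) (π : E d → Policy S A) (ν : S → A → ℝ) (ω θ : E d) (l : ℝ) : ℝ :=
  ∑ s, ∑ a, ν s a *
    (inner ℝ (score π θ s a) ω - M.Adv .r (π θ) s a - l * M.Adv .c (π θ) s a) ^ 2

/-- Critic vectors `ξ = [η, ζ]`: the coordinate `inl ()` is `η`, the coordinates `inr i`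
form `ζ`. -/
abbrev Critic (m : ℕ) := Unit ⊕ Fin m → ℝ

/-- `𝐀_g(θ; z)` at a transition `z = (s, a, s')`. -/
def critA (φ : Sig → S → E m) (cγ : ℝ) (g : Sig) (z : S × A × S) :
    Matrix (Unit ⊕ Fin m) (Unit ⊕ Fin m) ℝ :=
  Matrix.fromBlocks
    (Matrix.of fun _ _ => cγ) 0
    (Matrix.of fun i _ => φ g z.1 i)
    (Matrix.of fun i j => φ g z.1 i * (φ g z.1 j - φ g z.2.2 j))

/-- `𝐛_g(θ; z)` at a transition `z = (s, a, s')`. -/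
def critb (M : CMDP S A) (φ : Sig → S → E m) (cγ : ℝ) (g : Sig) (z : S × A × S) : Critic m :=
  Sum.elim (fun _ => cγ * M.sig g z.1 z.2.1) (fun i => M.sig g z.1 z.2.1 * φ g z.1 i)

/-- `𝔼_θ[f(z)]` for `z = (s,a,s')` with `(s,a) ∼ ν^{π_θ}` and `s' ∼ P(s,a)`. -/
def meanZ {X : Type*} [AddCommMonoid X] [Module ℝ X] (M : CMDP S A) (π : E d → Policy S A)
    (θ : E d) (f : S × A × S → X) : X :=
  ∑ s, ∑ a, ∑ s', (M.occ (π θ) s a * prob (M.P s a) s') • f (s, a, s')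

/-- `ξ_g^*(θ) = 𝐀_g(θ)⁻¹ 𝐛_g(θ)`. -/
def xiStar (M : CMDP S A) (π : E d → Policy S A) (φ : Sig → S → E m) (cγ : ℝ) (g : Sig)
    (θ : E d) : Critic m :=
  Matrix.mulVec (meanZ M π θ (critA φ cγ g))⁻¹ (meanZ M π θ (critb M φ cγ g))

/-- `𝔼_{s ∼ d^{π_θ}} [ζ_g^*(θ)ᵀ φ_g(s) - V_g^{π_θ}(s)]²`. -/
def critErr (M : CMDP S A) (π : E d → Policy S A) (φ : Sig → S → E m) (cγ : ℝ) (g : Sig)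
    (θ : E d) : ℝ :=
  ∑ s, M.statDist (π θ) s *
    (∑ i, xiStar M π φ cγ g θ (Sum.inr i) * φ g s i - M.V g (π θ) s) ^ 2

/-- The worst-case critic approximation error `ε_app`. -/
def epsApp (M : CMDP S A) (π : E d → Policy S A) (φ : Sig → S → E m) (cγ : ℝ) : ℝ :=
  max (⨆ θ, critErr M π φ cγ .r θ) (⨆ θ, critErr M π φ cγ .c θ)

/-- Slater condition with parameter `δ`. -/
def Slater (M : CMDP S A) (π : E d → Policy S A) (δ : ℝ) : Prop :=
  ∃ θ, δ ≤ M.J .c (π θ)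

/-- The worst-case critic approximation error is finite. -/
def CriticErrFinite (M : CMDP S A) (π : E d → Policy S A) (φ : Sig → S → E m) (cγ : ℝ) : Prop :=
  ∀ g, BddAbove (Set.range (critErr M π φ cγ g))

/-- `𝔼_θ[φ_g(s)(φ_g(s)-φ_g(s'))ᵀ] - lam I` is positive semi-definite, in the sense of the
quadratic form (the matrix need not be symmetric). -/
def CriticPosDef (M : CMDP S A) (π : E d → Policy S A) (φ : Sig → S → E m) (lam : ℝ) : Prop :=
  ∀ (g : Sig) (θ : E d) (x : E m), lam * ‖x‖ ^ 2 ≤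
    meanZ M π θ fun z => inner ℝ x (φ g z.1) * inner ℝ (φ g z.1 - φ g z.2.2) x

/-- The transferred compatible function approximation error is at most `εbias`. -/
def BiasBound (M : CMDP S A) (π : E d → Policy S A) (πs : Policy S A) (δ εbias : ℝ) : Prop :=
  ∀ (θ : E d) (l : ℝ), l ∈ Set.Icc 0 (2 / δ) → ∀ ω : E d,
    (∀ ω', compErr M π (M.occ (π θ)) ω θ l ≤ compErr M π (M.occ (π θ)) ω' θ l) →
      compErr M π (M.occ πs) ω θ l ≤ εbias

/-- The score exists everywhere, is bounded by `G₁` and `G₂`-Lipschitz. -/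
structure ScoreBounds (π : E d → Policy S A) (G₁ G₂ : ℝ) : Prop where
  pos : ∀ θ s a, 0 < prob (π θ s) a
  diff : ∀ s a, Differentiable ℝ fun θ => Real.log (prob (π θ s) a)
  bound : ∀ θ s a, ‖score π θ s a‖ ≤ G₁
  lip : ∀ θ₁ θ₂ s a, ‖score π θ₁ s a - score π θ₂ s a‖ ≤ G₂ * ‖θ₁ - θ₂‖

/-- Fisher non-degeneracy. -/
def FisherNonDeg (M : CMDP S A) (π : E d → Policy S A) (μ : ℝ) : Prop :=
  ∀ θ, (fisher M π θ - μ • (1 : Matrix (Fin d) (Fin d) ℝ)).PosSemidef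

end Parametrized

section Algorithm

/-- The geometric law with parameter `1/2` on `{1, 2, 3, …}`: `j` has probability `2^{-j}`. -/
def geomHalf : PMF ℕ :=
  ⟨fun j => if j = 0 then 0 else (2⁻¹ : ENNReal) ^ j, by
    have h : ∑' j : ℕ, (if j = 0 then 0 else (2⁻¹ : ENNReal) ^ j) = 1 := by
      rw [tsum_eq_zero_add' ENNReal.summable]
      simp [ENNReal.tsum_geometric_add_one, ENNReal.one_sub_inv_two, ENNReal.inv_mul_cancel]
    exact h ▸ ENNReal.summable.hasSum⟩

/-- `n` successive draws of a Markov kernel. -/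
def iterLaw {X : Type*} (step : X → PMF X) : ℕ → X → PMF X
  | 0, x => PMF.pure x
  | n + 1, x => (iterLaw step n x).bind step

variable {S A : Type*} {d m : ℕ}

/-- The list of the first `n` transitions `(s_t, a_t, s_{t+1})` of a `π`-induced trajectory
that starts at a given state. -/
def rollout (M : CMDP S A) (π : Policy S A) : ℕ → S → PMF (List (S × A × S))
  | 0, _ => PMF.pure []
  | n + 1, s => (π s).bind fun a => (M.P s a).bind fun s' =>
      (rollout M π n s').map fun zs => (s, a, s') :: zs

/-- The state in which a trajectory from `s` ends. -/
def finalState (s : S) (zs : List (S × A × S)) : S :=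
  (zs.getLast?.map fun z => z.2.2).getD s

/-- `2^{-j} ∑_{t < 2^j} v(z_t)`. -/
def levelAvg {X : Type*} [AddCommGroup X] [Module ℝ X] (v : S × A × S → X)
    (zs : List (S × A × S)) (j : ℕ) : X :=
  ((2 : ℝ) ^ j)⁻¹ • ((zs.take (2 ^ j)).map v).sum

/-- The multi-level Monte Carlo estimate with level `q`. -/
def mlmc {X : Type*} [AddCommGroup X] [Module ℝ X] (Tmax : ℕ) (v : S × A × S → X)
    (zs : List (S × A × S)) (q : ℕ) : X :=
  levelAvg v zs 0 +
    if 2 ^ q ≤ Tmax then (2 : ℝ) ^ q • (levelAvg v zs q - levelAvg v zs (q - 1)) else 0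

/-- The trajectory length `(2^q - 1) 𝟏(2^q ≤ Tmax) + 1`. -/
def trajLen (Tmax q : ℕ) : ℕ := (if 2 ^ q ≤ Tmax then 2 ^ q - 1 else 0) + 1

/-- The parameters of the algorithm. -/
structure Params where
  α : ℝ
  β : ℝ
  γω : ℝ
  γξ : ℝ
  cγ : ℝ
  δ : ℝ
  H : ℕ
  Tmax : ℕ

/-- One step of the critic subroutine, on pairs (current state, `(ξ_r, ξ_c)`). -/
def criticStep (M : CMDP S A) (π : E d → Policy S A) (φ : Sig → S → E m) (p : Params)
    (θ : E d) (x : S × (Sig → Critic m)) : PMF (S × (Sig → Critic m)) :=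
  geomHalf.bind fun q => (rollout M (π θ) (trajLen p.Tmax q) x.1).map fun zs =>
    (finalState x.1 zs, fun g => x.2 g - p.γξ •
      mlmc p.Tmax (fun z => Matrix.mulVec (critA φ p.cγ g z) (x.2 g) - critb M φ p.cγ g z) zs q)

/-- The advantage estimate (temporal difference error) `Â_g(ξ; z)`. -/
def advEst (M : CMDP S A) (φ : Sig → S → E m) (g : Sig) (ξ : Critic m) (z : S × A × S) : ℝ :=
  M.sig g z.1 z.2.1 - ξ (Sum.inl ()) + ∑ i, ξ (Sum.inr i) * (φ g z.2.2 i - φ g z.1 i)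

/-- The one-sample estimate of the gradient of `f_g(θ, ·)` at `ω`. -/
def npgGrad (M : CMDP S A) (π : E d → Policy S A) (φ : Sig → S → E m) (θ : E d) (g : Sig)
    (ξ : Critic m) (ω : E d) (z : S × A × S) : E d :=
  inner ℝ (score π θ z.1 z.2.1) ω • score π θ z.1 z.2.1
    - advEst M φ g ξ z • score π θ z.1 z.2.1

/-- One step of the actor subroutine, on pairs (current state, `(ω_r, ω_c)`). -/
def actorStep (M : CMDP S A) (π : E d → Policy S A) (φ : Sig → S → E m) (p : Params)
    (θ : E d) (ξ : Sig → Critic m) (x : S × (Sig → E d)) : PMF (S × (Sig → E d)) :=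
  geomHalf.bind fun q => (rollout M (π θ) (trajLen p.Tmax q) x.1).map fun zs =>
    (finalState x.1 zs, fun g => x.2 g - p.γω •
      mlmc p.Tmax (npgGrad M π φ θ g (ξ g) (x.2 g)) zs q)

/-- What the algorithm carries from one epoch to the next. -/
structure AlgState (S : Type*) (d : ℕ) where
  state : S
  θ : E d
  lam : ℝ

/-- One epoch: critic subroutine, actor subroutine, then the primal and dual updates. -/
def epoch (M : CMDP S A) (π : E d → Policy S A) (φ : Sig → S → E m) (p : Params)
    (x : AlgState S d) : PMF (AlgState S d) :=
  (iterLaw (criticStep M π φ p x.θ) p.H (x.state, 0)).bind fun y =>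
    (iterLaw (actorStep M π φ p x.θ y.2) p.H (y.1, 0)).map fun w =>
      { state := w.1
        θ := x.θ + p.α • (w.2 .r + x.lam • w.2 .c)
        lam := max 0 (min (2 / p.δ) (x.lam - p.β * y.2 .c (Sum.inl ()))) }

/-- The joint law of the environment state and of `(θ_k, λ_k)` at the start of epoch `k`, from
`s_0 ∼ ρ`, the initial parameter `θ₀`, and `λ_0 = 0`. -/
def algLaw (M : CMDP S A) (π : E d → Policy S A) (φ : Sig → S → E m) (p : Params) (θ₀ : E d)
    (k : ℕ) : PMF (AlgState S d) :=
  M.ρ.bind fun s => iterLaw (epoch M π φ p) k ⟨s, θ₀, 0⟩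

/-- The parameters for horizon `T` and inner loop size `H`:
`α = β = T^{-1/2}`, `γ_ω = 2 log T / (μ H)`, `γ_ξ = 2 log T / (lam H)`, `T_max = T`. -/
def horizonParams (μ lam cγ δ : ℝ) (T H : ℕ) : Params where
  α := (T : ℝ) ^ (-(1 / 2) : ℝ)
  β := (T : ℝ) ^ (-(1 / 2) : ℝ)
  γω := 2 * Real.log T / (μ * H)
  γξ := 2 * Real.log T / (lam * H)
  cγ := cγ
  δ := δ
  H := H
  Tmax := T

end Algorithm

end PDNAC

end

open PDNAC

/-! Natural policy gradient is mirror descent for the divergence `KL(π* ‖ π_θ)`. One epoch changes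
it by `-α ⟪𝔼_{ν^{π*}} ψ_θ, ω_r + λ ω_c⟫` up to `α² G₂ ‖ω_r + λ ω_c‖² / 2`; by the performance
difference lemma and compatible function approximation, with `ω` the exact natural gradient, this is
`-α (J_r(π*) - J_r(θ) + λ (J_c(π*) - J_c(θ)))` up to `α √ε_bias`. The projected step of the dual
variable decreases `(λ - l₀)² / 2` in the same way, so that adding the two drifts and summing over
the epochs bounds the average of the Lagrangian gap `J_r(π*) - J_r(θ_k) - l₀ J_c(θ_k)`, for every
`l₀ ∈ [0, 2/δ]`.

The drifts see the random outputs of the inner loops only through their conditional mean and second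
moment. A multi-level estimate has the bias of an average over about `T_max` steps of the chain,
which is `O(τ_mix / T_max)` by geometric mixing, while its second moment grows only like
`τ_mix log T_max`. Linear stochastic approximation with a coercive mean field therefore reaches its
zero with bias `O(1 / √T_max)` and bounded second moment after `H ~ τ_mix² log² T_max` steps. The
actor inherits the error of the critic through the policy gradient, where the best critic
contributes `√ε_app`.

Finally, Slater's condition and strong duality, which holds because occupancy measures form a convex
set, give a multiplier `l ≤ 1/δ` whose Lagrangian gap is nonnegative. The choice `l₀ = 0` bounds the
optimality gap, and comparing `l₀ = 2/δ` with `l` bounds the violation. -/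

noncomputable section

namespace PDNAC

section FiniteSupport

variable {X Y : Type*} {V W : Type*} [NormedAddCommGroup V] [NormedSpace ℝ V]
  [NormedAddCommGroup W] [NormedSpace ℝ W]

/-- A discrete law with finite support. All laws met by the algorithm are of this kind, or images
of such laws, so that expectations are finite sums and need no summability bookkeeping. -/
def FinSupp (p : PMF X) : Prop := p.support.Finite

/-- The support of a finitely supported law as a `Finset`, to index the sums that expectations
reduce to. -/
def FinSupp.finset {p : PMF X} (h : FinSupp p) : Finset X := Set.Finite.toFinset h

theorem FinSupp.mem_finset {p : PMF X} (h : FinSupp p) {x : X} :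
    x ∈ h.finset ↔ x ∈ p.support :=
  Set.Finite.mem_toFinset h

theorem FinSupp.support_subset {p : PMF X} (h : FinSupp p) : p.support ⊆ h.finset :=
  fun _ hx => h.mem_finset.2 hx

/-- The expectation of a vector-valued function under a discrete law; for real functions it is
`expect`. -/
def ev (p : PMF X) (f : X → V) : V := ∑' x, prob p x • f x

theorem prob_nonneg (p : PMF X) (x : X) : 0 ≤ prob p x := ENNReal.toReal_nonneg

theorem prob_eq_zero {p : PMF X} {x : X} (h : x ∉ p.support) : prob p x = 0 := by
  have : p x = 0 := by simpa [PMF.mem_support_iff] using h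
  simp [prob, this]

theorem ev_eq_sum {p : PMF X} {t : Finset X} (ht : p.support ⊆ t) (f : X → V) :
    ev p f = ∑ x ∈ t, prob p x • f x :=
  tsum_eq_sum fun x hx => by rw [prob_eq_zero fun h => hx (ht h), zero_smul]

theorem ev_eq_sum_univ [Fintype X] (p : PMF X) (f : X → V) :
    ev p f = ∑ x, prob p x • f x :=
  ev_eq_sum (by simp) f

theorem FinSupp.ev_eq {p : PMF X} (h : FinSupp p) (f : X → V) :
    ev p f = ∑ x ∈ h.finset, prob p x • f x :=
  ev_eq_sum h.support_subset f

theorem sum_prob_of_subset {p : PMF X} {t : Finset X} (ht : p.support ⊆ t) :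
    ∑ x ∈ t, prob p x = 1 := by
  unfold prob
  rw [← ENNReal.toReal_sum fun x _ => p.apply_ne_top x,
    ← tsum_eq_sum (L := .unconditional X) fun x hx => ?_, p.tsum_coe, ENNReal.toReal_one]
  by_contra h
  exact hx (ht ((p.mem_support_iff x).2 h))

theorem sum_prob [Fintype X] (p : PMF X) : ∑ x, prob p x = 1 :=
  sum_prob_of_subset (by simp)

theorem exists_prob_eq [Fintype X] (w : X → ℝ) (h0 : ∀ x, 0 ≤ w x) (h1 : ∑ x, w x = 1) :
    ∃ p : PMF X, ∀ x, prob p x = w x := by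
  refine ⟨PMF.ofFintype (fun x => ENNReal.ofReal (w x)) ?_, fun x => ?_⟩
  · rw [← ENNReal.ofReal_sum_of_nonneg fun x _ => h0 x, h1, ENNReal.ofReal_one]
  · simp [prob, ENNReal.toReal_ofReal (h0 x)]

theorem exists_sum_mul_prob_eq [Fintype X] [Nonempty X] (w : X → ℝ) (h0 : ∀ x, 0 ≤ w x) :
    ∃ p : PMF X, ∀ x, (∑ y, w y) * prob p x = w x := by
  have hsum : 0 ≤ ∑ y, w y := Finset.sum_nonneg fun y _ => h0 y
  rcases hsum.eq_or_lt with h | h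
  · have hw := (Finset.sum_eq_zero_iff_of_nonneg fun y _ => h0 y).1 h.symm
    exact ⟨PMF.pure (Classical.arbitrary X), fun x => by
      rw [← h, zero_mul, hw x (Finset.mem_univ x)]⟩
  · obtain ⟨p, hp⟩ := exists_prob_eq (fun x => w x / ∑ y, w y)
      (fun x => div_nonneg (h0 x) hsum) (by rw [← Finset.sum_div, div_self h.ne'])
    exact ⟨p, fun x => by rw [hp, mul_div_cancel₀ _ h.ne']⟩

theorem norm_sum_smul_le_of_weights [Fintype X] {w : X → ℝ} (h0 : ∀ x, 0 ≤ w x)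
    (h1 : ∑ x, w x = 1) {f : X → V} {B : ℝ} (hf : ∀ x, ‖f x‖ ≤ B) : ‖∑ x, w x • f x‖ ≤ B := by
  simpa using (convex_closedBall (0 : V) B).sum_mem (fun x _ => h0 x) h1
    fun x _ => mem_closedBall_zero_iff.2 (hf x)

theorem abs_sum_mul_le_of_weights [Fintype X] {w : X → ℝ} (h0 : ∀ x, 0 ≤ w x)
    (h1 : ∑ x, w x = 1) {f : X → ℝ} {B : ℝ} (hf : ∀ x, |f x| ≤ B) : |∑ x, w x * f x| ≤ B := by
  simpa using norm_sum_smul_le_of_weights (V := ℝ) h0 h1 hf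

theorem finSupp_of_finite [Finite X] (p : PMF X) : FinSupp p := Set.toFinite _

theorem finSupp_pure (x : X) : FinSupp (PMF.pure x) := by
  simp [FinSupp, PMF.support_pure]

theorem FinSupp.bind {p : PMF X} (hp : FinSupp p) {k : X → PMF Y} (hk : ∀ x, FinSupp (k x)) :
    FinSupp (p.bind k) := by
  rw [FinSupp, PMF.support_bind]
  exact hp.biUnion fun x _ => hk x

theorem FinSupp.map {p : PMF X} (hp : FinSupp p) (f : X → Y) : FinSupp (p.map f) := by
  rw [FinSupp, PMF.support_map]
  exact hp.image f

theorem finSupp_iterLaw {step : X → PMF X} (h : ∀ x, FinSupp (step x)) (n : ℕ) (x : X) :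
    FinSupp (iterLaw step n x) := by
  induction n with
  | zero => exact finSupp_pure x
  | succ n ih => exact ih.bind h

theorem prob_pure [DecidableEq X] (x y : X) :
    prob (PMF.pure x) y = if y = x then 1 else 0 := by
  unfold prob; rw [PMF.pure_apply]; split_ifs <;> simp

theorem ev_pure (x : X) (f : X → V) : ev (PMF.pure x) f = f x := by
  classical
  rw [ev_eq_sum (t := {x}) (by simp [PMF.support_pure])]
  simp [prob_pure]

theorem prob_bind {p : PMF X} {t : Finset X} (ht : p.support ⊆ t) (k : X → PMF Y) (y : Y) :
    prob (p.bind k) y = ∑ x ∈ t, prob p x * prob (k x) y := by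
  unfold prob
  rw [PMF.bind_apply, tsum_eq_sum (s := t), ENNReal.toReal_sum]
  · simp [ENNReal.toReal_mul]
  · exact fun x _ => ENNReal.mul_ne_top (p.apply_ne_top x) ((k x).apply_ne_top y)
  · intro x hx
    have : p x = 0 := by
      by_contra h
      exact hx (ht ((p.mem_support_iff x).2 h))
    simp [this]

theorem FinSupp.ev_bind {p : PMF X} (hp : FinSupp p) {k : X → PMF Y} (hk : ∀ x, FinSupp (k x))
    (f : Y → V) : ev (p.bind k) f = ev p fun x => ev (k x) f := by
  classical
  set t := hp.finset.biUnion fun x => (hk x).finset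
  have hb : (p.bind k).support ⊆ t := by
    rw [PMF.support_bind]; intro y; simp [t, FinSupp.mem_finset]
  rw [ev_eq_sum hb, hp.ev_eq]
  have hpt := hp.support_subset
  simp_rw [prob_bind hpt, Finset.sum_smul, mul_smul]
  rw [Finset.sum_comm]
  refine Finset.sum_congr rfl fun x hx => ?_
  rw [← Finset.smul_sum, ev_eq_sum (t := t)]
  intro y hy
  simp only [t, Finset.coe_biUnion, Set.mem_iUnion]
  exact ⟨x, hx, (hk x).support_subset hy⟩

theorem FinSupp.ev_map {p : PMF X} (hp : FinSupp p) (g : X → Y) (f : Y → V) :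
    ev (p.map g) f = ev p fun x => f (g x) := by
  rw [← PMF.bind_pure_comp, hp.ev_bind (k := PMF.pure ∘ g) fun x => finSupp_pure _]
  simp [ev_pure]

theorem ev_congr {p : PMF X} {f g : X → V} (h : ∀ x ∈ p.support, f x = g x) :
    ev p f = ev p g := by
  refine tsum_congr fun x => ?_
  by_cases hx : x ∈ p.support
  · rw [h x hx]
  · simp [prob_eq_zero hx]

theorem FinSupp.ev_const {p : PMF X} (hp : FinSupp p) (v : V) : ev p (fun _ => v) = v := by
  rw [hp.ev_eq, ← Finset.sum_smul, sum_prob_of_subset hp.support_subset, one_smul]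

theorem FinSupp.ev_add {p : PMF X} (hp : FinSupp p) (f g : X → V) :
    ev p (fun x => f x + g x) = ev p f + ev p g := by
  simp [hp.ev_eq, smul_add, Finset.sum_add_distrib]

theorem FinSupp.ev_sub {p : PMF X} (hp : FinSupp p) (f g : X → V) :
    ev p (fun x => f x - g x) = ev p f - ev p g := by
  simp [hp.ev_eq, smul_sub, Finset.sum_sub_distrib]

theorem FinSupp.map_ev {p : PMF X} (hp : FinSupp p) (L : V →ₗ[ℝ] W) (f : X → V) :
    L (ev p f) = ev p fun x => L (f x) := by
  simp [hp.ev_eq, map_sum]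

theorem FinSupp.ev_smul {p : PMF X} (hp : FinSupp p) (c : ℝ) (f : X → V) :
    ev p (fun x => c • f x) = c • ev p f :=
  (hp.map_ev (LinearMap.lsmul ℝ V c) f).symm

theorem FinSupp.ev_mul {p : PMF X} (hp : FinSupp p) (c : ℝ) (f : X → ℝ) :
    ev p (fun x => c * f x) = c * ev p f :=
  hp.ev_smul c f

theorem FinSupp.ev_mono {p : PMF X} (hp : FinSupp p) {f g : X → ℝ}
    (h : ∀ x ∈ p.support, f x ≤ g x) : ev p f ≤ ev p g := by
  rw [hp.ev_eq, hp.ev_eq]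
  exact Finset.sum_le_sum fun x hx =>
    mul_le_mul_of_nonneg_left (h x (hp.mem_finset.1 hx)) (prob_nonneg p x)

theorem FinSupp.ev_le {p : PMF X} (hp : FinSupp p) {f : X → ℝ} {c : ℝ}
    (h : ∀ x ∈ p.support, f x ≤ c) : ev p f ≤ c :=
  (hp.ev_mono (g := fun _ => c) h).trans_eq (hp.ev_const c)

theorem FinSupp.ev_nonneg {p : PMF X} (hp : FinSupp p) {f : X → ℝ}
    (h : ∀ x, 0 ≤ f x) : 0 ≤ ev p f :=
  (hp.ev_const (0 : ℝ)).symm.trans_le (hp.ev_mono fun x _ => h x)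

theorem FinSupp.norm_ev_le {p : PMF X} (hp : FinSupp p) (f : X → V) :
    ‖ev p f‖ ≤ ev p fun x => ‖f x‖ := by
  rw [hp.ev_eq, hp.ev_eq]
  refine (norm_sum_le _ _).trans (Finset.sum_le_sum fun x _ => ?_)
  rw [norm_smul, Real.norm_of_nonneg (prob_nonneg p x), smul_eq_mul]

theorem FinSupp.norm_ev_le_of_le {p : PMF X} (hp : FinSupp p) {f : X → V} {B : ℝ}
    (hf : ∀ x, ‖f x‖ ≤ B) : ‖ev p f‖ ≤ B :=
  (hp.norm_ev_le f).trans (hp.ev_le fun x _ => hf x)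

theorem FinSupp.sq_ev_le {p : PMF X} (hp : FinSupp p) (f : X → ℝ) :
    (ev p f) ^ 2 ≤ ev p fun x => f x ^ 2 := by
  have h : 0 ≤ ev p fun x => (f x - ev p f) ^ 2 := hp.ev_nonneg fun x => sq_nonneg _
  have e : (fun x => (f x - ev p f) ^ 2) =
      fun x => (f x ^ 2 - (2 * ev p f) * f x) + (ev p f) ^ 2 := by
    funext x; ring
  rw [e, hp.ev_add, hp.ev_sub, hp.ev_mul, hp.ev_const] at h
  nlinarith

theorem FinSupp.ev_le_sqrt {p : PMF X} (hp : FinSupp p) (f : X → ℝ) :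
    ev p f ≤ √(ev p fun x => f x ^ 2) :=
  Real.le_sqrt_of_sq_le (hp.sq_ev_le f)

theorem ev_iterLaw_succ {step : X → PMF X} (h : ∀ x, FinSupp (step x)) (n : ℕ) (x : X)
    (f : X → V) :
    ev (iterLaw step (n + 1) x) f = ev (iterLaw step n x) fun y => ev (step y) f :=
  (finSupp_iterLaw h n x).ev_bind h f

theorem iterLaw_map {step : X → PMF X} {step' : Y → PMF Y} {f : X → Y}
    (h : ∀ x, (step x).map f = step' (f x)) (n : ℕ) (x : X) :
    (iterLaw step n x).map f = iterLaw step' n (f x) := by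
  induction n with
  | zero => simp [iterLaw, PMF.pure_map]
  | succ n ih =>
    simp only [iterLaw, PMF.map_bind, h]
    rw [← ih, PMF.bind_map]
    rfl

end FiniteSupport

section MarkovChain

variable {S : Type*} [Fintype S] {V : Type*} [NormedAddCommGroup V] [NormedSpace ℝ V]
  {Q R : Matrix S S ℝ} {D : S → ℝ}

/-- The action of a matrix on vector-valued functions: `Matrix.mulVec` for functions whose values
need not be scalars. For a transition matrix this is the conditional expectation after one step. -/
def act (Q : Matrix S S ℝ) (f : S → V) (s : S) : V := ∑ s', Q s s' • f s'

/-- `D` is a stationary probability vector of the matrix `Q`; `CMDP.IsStationary` is the case of an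
induced chain. -/
def IsStationaryLaw (Q : Matrix S S ℝ) (D : S → ℝ) : Prop :=
  (∀ s, 0 ≤ D s) ∧ ∑ s, D s = 1 ∧ ∀ s', ∑ s, D s * Q s s' = D s'

theorem act_mul (Q R : Matrix S S ℝ) (f : S → V) : act (Q * R) f = act Q (act R f) := by
  funext s
  simp only [act, Matrix.mul_apply, Finset.sum_smul, Finset.smul_sum, mul_smul]
  rw [Finset.sum_comm]

theorem act_sub (Q : Matrix S S ℝ) (f g : S → V) (s : S) :
    act Q (fun x => f x - g x) s = act Q f s - act Q g s := by
  simp [act, smul_sub]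

theorem act_sum {ι : Type*} (Q : Matrix S S ℝ) (t : Finset ι) (f : ι → S → V) (s : S) :
    act Q (fun x => ∑ i ∈ t, f i x) s = ∑ i ∈ t, act Q (f i) s := by
  simp only [act, Finset.smul_sum]
  rw [Finset.sum_comm]

theorem IsStationaryLaw.sum_act (hD : IsStationaryLaw Q D) (f : S → V) :
    ∑ s, D s • act Q f s = ∑ s, D s • f s := by
  simp only [act, Finset.smul_sum, smul_smul]
  rw [Finset.sum_comm]
  refine Finset.sum_congr rfl fun s' _ => ?_
  rw [← Finset.sum_smul, hD.2.2]

/-- On functions centred under `D` the matrix `R` acts as `R - e D`, which is small if `R ≥ e D`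
entrywise (Doeblin's condition) or if the rows of `R` are close to `D` (`e = 1`). -/
theorem norm_act_le_of_centred {f : S → V} {B c e : ℝ}
    (hB : 0 ≤ B) (hf : ∀ s, ‖f s‖ ≤ B) (h0 : ∑ s, D s • f s = 0) {s : S}
    (hc : ∑ s', |R s s' - e * D s'| ≤ c) : ‖act R f s‖ ≤ c * B := by
  have h : act R f s = ∑ s', (R s s' - e * D s') • f s' := by
    simp only [sub_smul, Finset.sum_sub_distrib, mul_smul, ← Finset.smul_sum, h0, smul_zero,
      sub_zero, act]
  rw [h]
  calc ‖∑ s', (R s s' - e * D s') • f s'‖ ≤ ∑ s', |R s s' - e * D s'| * B := by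
        refine (norm_sum_le _ _).trans (Finset.sum_le_sum fun s' _ => ?_)
        rw [norm_smul, Real.norm_eq_abs]
        exact mul_le_mul_of_nonneg_left (hf s') (abs_nonneg _)
    _ ≤ c * B := by rw [← Finset.sum_mul]; exact mul_le_mul_of_nonneg_right hc hB

theorem IsStationaryLaw.le_one (hD : IsStationaryLaw Q D) (s : S) : D s ≤ 1 :=
  (Finset.single_le_sum (fun s _ => hD.1 s) (Finset.mem_univ s)).trans_eq hD.2.1

variable [DecidableEq S]

theorem act_one (f : S → V) : act (1 : Matrix S S ℝ) f = f := by
  funext s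
  simp [act, Matrix.one_apply]

theorem act_const (hQ : Q ∈ Matrix.rowStochastic ℝ S) (v : V) (s : S) :
    act Q (fun _ => v) s = v := by
  rw [act, ← Finset.sum_smul, Matrix.sum_row_of_mem_rowStochastic hQ, one_smul]

theorem norm_act_le (hQ : Q ∈ Matrix.rowStochastic ℝ S) {f : S → V} {B : ℝ}
    (hf : ∀ s, ‖f s‖ ≤ B) (s : S) : ‖act Q f s‖ ≤ B :=
  norm_sum_smul_le_of_weights (fun _ => Matrix.nonneg_of_mem_rowStochastic hQ)
    (Matrix.sum_row_of_mem_rowStochastic hQ s) hf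

theorem IsStationaryLaw.pow (hD : IsStationaryLaw Q D) (n : ℕ) :
    IsStationaryLaw (Q ^ n) D := by
  refine ⟨hD.1, hD.2.1, ?_⟩
  induction n with
  | zero => intro s'; simp [Matrix.one_apply]
  | succ n ih =>
    intro s'
    simp only [pow_succ, Matrix.mul_apply, Finset.mul_sum, ← mul_assoc]
    rw [Finset.sum_comm]
    simp_rw [← Finset.sum_mul, ih]
    exact hD.2.2 s'

theorem norm_act_pow_le (hD : IsStationaryLaw R D) {f : S → V} {B c e : ℝ}
    (hB : 0 ≤ B) (hc0 : 0 ≤ c) (hf : ∀ s, ‖f s‖ ≤ B) (h0 : ∑ s, D s • f s = 0)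
    (hc : ∀ s, ∑ s', |R s s' - e * D s'| ≤ c) (k : ℕ) (s : S) :
    ‖act (R ^ k) f s‖ ≤ c ^ k * B := by
  induction k generalizing f B with
  | zero => simpa [act_one] using hf s
  | succ k ih =>
    rw [pow_succ, act_mul, pow_succ, mul_assoc]
    exact ih (mul_nonneg hc0 hB) (fun s => norm_act_le_of_centred hB hf h0 (hc s))
      (by rw [hD.sum_act, h0])

theorem norm_act_pow_le_half (hQ : Q ∈ Matrix.rowStochastic ℝ S)
    (hD : IsStationaryLaw Q D) {t : ℕ} (ht : ∀ s, ∑ s', |(Q ^ t) s s' - D s'| ≤ 1 / 2)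
    {f : S → V} {B : ℝ} (hB : 0 ≤ B) (hf : ∀ s, ‖f s‖ ≤ B) (h0 : ∑ s, D s • f s = 0)
    (n : ℕ) (s : S) : ‖act (Q ^ n) f s‖ ≤ (1 / 2 : ℝ) ^ (n / t) * B := by
  conv_lhs => rw [← Nat.mod_add_div n t, pow_add, pow_mul, act_mul]
  refine norm_act_le (pow_mem hQ _) (fun s => ?_) s
  exact norm_act_pow_le (e := 1) (hD.pow t) hB (by norm_num) hf h0 (by simpa using ht) _ s

theorem sum_half_pow_div_le (t n : ℕ) (ht : 1 ≤ t) :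
    ∑ i ∈ Finset.range n, (1 / 2 : ℝ) ^ (i / t) ≤ 2 * t := by
  have key : ∀ k, ∑ i ∈ Finset.range (t * k), (1 / 2 : ℝ) ^ (i / t)
      ≤ 2 * t * (1 - (1 / 2) ^ k) := by
    intro k
    induction k with
    | zero => simp
    | succ k ih =>
      rw [mul_add, mul_one, Finset.sum_range_add]
      have : ∑ x ∈ Finset.range t, (1 / 2 : ℝ) ^ ((t * k + x) / t) = t * (1 / 2) ^ k := by
        rw [Finset.sum_congr rfl (g := fun _ => (1 / 2 : ℝ) ^ k)]
        · simp
        · intro x hx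
          rw [Nat.mul_add_div (by lia), Nat.div_eq_of_lt (Finset.mem_range.1 hx), add_zero]
      rw [this, pow_succ]
      linarith
  calc ∑ i ∈ Finset.range n, (1 / 2 : ℝ) ^ (i / t)
      ≤ ∑ i ∈ Finset.range (t * n), (1 / 2 : ℝ) ^ (i / t) := by
        refine Finset.sum_le_sum_of_subset_of_nonneg ?_ fun _ _ _ => by positivity
        exact Finset.range_mono (Nat.le_mul_of_pos_left n ht)
    _ ≤ 2 * t * (1 - (1 / 2) ^ n) := key n
    _ ≤ 2 * t := by
        have : (0 : ℝ) ≤ (1 / 2) ^ n := by positivity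
        have : (0 : ℝ) ≤ t := by positivity
        nlinarith

theorem sum_norm_act_pow_le (hQ : Q ∈ Matrix.rowStochastic ℝ S)
    (hD : IsStationaryLaw Q D) {t : ℕ} (ht1 : 1 ≤ t) (ht : ∀ s, ∑ s', |(Q ^ t) s s' - D s'| ≤ 1 / 2)
    {f : S → V} {B : ℝ} (hB : 0 ≤ B) (hf : ∀ s, ‖f s‖ ≤ B) (h0 : ∑ s, D s • f s = 0)
    (n : ℕ) (s : S) : ∑ i ∈ Finset.range n, ‖act (Q ^ i) f s‖ ≤ 2 * t * B := by
  calc ∑ i ∈ Finset.range n, ‖act (Q ^ i) f s‖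
      ≤ ∑ i ∈ Finset.range n, (1 / 2 : ℝ) ^ (i / t) * B :=
        Finset.sum_le_sum fun i _ => norm_act_pow_le_half hQ hD ht hB hf h0 i s
    _ ≤ 2 * t * B := by
        rw [← Finset.sum_mul]
        exact mul_le_mul_of_nonneg_right (sum_half_pow_div_le t n ht1) hB

theorem Aperiodic.eventually_pow_diag_pos (hQ : ∀ i j, 0 ≤ Q i j)
    (hA : Aperiodic Q) (i : S) : ∀ᶠ n in Filter.atTop, 0 < (Q ^ n) i i := by
  have hnn : ∀ n j k, 0 ≤ (Q ^ n) j k := Matrix.pow_apply_nonneg hQ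
  have hadd : ∀ {a b}, 0 < (Q ^ a) i i → 0 < (Q ^ b) i i → 0 < (Q ^ (a + b)) i i := by
    intro a b ha hb
    rw [pow_add, Matrix.mul_apply]
    exact Finset.sum_pos' (fun x _ => mul_nonneg (hnn _ _ _) (hnn _ _ _))
      ⟨i, Finset.mem_univ _, mul_pos ha hb⟩
  let returnTimes : Set ℕ := {n | 0 < (Q ^ n) i i}
  have hgcd : Nat.setGcd returnTimes = 1 := hA i _ fun n _ hn => Nat.setGcd_dvd_of_mem hn
  obtain ⟨N, hN⟩ := Nat.exists_mem_closure_of_ge returnTimes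
  filter_upwards [Filter.eventually_ge_atTop N] with n hn
  exact AddSubmonoid.closure_induction (motive := fun n _ => 0 < (Q ^ n) i i)
    (fun _ h => h) (by simp) (fun _ _ _ _ ha hb => hadd ha hb)
    (hN n hn (by rw [hgcd]; exact one_dvd n))

theorem Aperiodic.isPrimitive (hA : Aperiodic Q) (hI : Q.IsIrreducible) :
    Q.IsPrimitive := by
  have hnn : ∀ n i j, 0 ≤ (Q ^ n) i j := Matrix.pow_apply_nonneg hI.nonneg
  choose b _ hb using (Matrix.isIrreducible_iff_exists_pow_pos hI.nonneg).1 hI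
  have hev : ∀ᶠ n in Filter.atTop, ∀ i j, 0 < (Q ^ n) i j := by
    refine Filter.eventually_all.2 fun i => Filter.eventually_all.2 fun j => ?_
    have hshift : ∀ᶠ n in Filter.atTop, b i j ≤ n ∧ 0 < (Q ^ (n - b i j)) i i :=
      (Filter.eventually_ge_atTop _).and <| (Filter.tendsto_sub_atTop_nat _).eventually <|
        hA.eventually_pow_diag_pos hI.nonneg i
    filter_upwards [hshift] with n ⟨hbn, hn⟩
    rw [← Nat.sub_add_cancel hbn, pow_add, Matrix.mul_apply]
    exact Finset.sum_pos' (fun x _ => mul_nonneg (hnn _ _ _) (hnn _ _ _))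
      ⟨i, Finset.mem_univ _, mul_pos hn (hb i j)⟩
  obtain ⟨n, hn, hn0⟩ := (hev.and (Filter.eventually_gt_atTop 0)).exists
  exact ⟨hI.nonneg, n, hn0, hn⟩

/-- A left null vector of `Q - 1` need not be nonnegative, but its absolute value is stationary as
well: `|v| ≤ |v| Q` entrywise, and both sides have the same total mass. -/
theorem exists_isStationaryLaw [Nonempty S] (hQ : Q ∈ Matrix.rowStochastic ℝ S) :
    ∃ D, IsStationaryLaw Q D := by
  have hdet : (Q - 1).det = 0 := by
    rw [← Matrix.exists_mulVec_eq_zero_iff]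
    refine ⟨1, one_ne_zero, ?_⟩
    rw [Matrix.sub_mulVec, Matrix.one_vecMul_of_mem_rowStochastic hQ, Matrix.one_mulVec, sub_self]
  obtain ⟨v, hv0, hv⟩ := Matrix.exists_vecMul_eq_zero_iff.2 hdet
  have hst : ∀ s', ∑ s, v s * Q s s' = v s' := by
    intro s'
    have := congrFun hv s'
    rw [Matrix.vecMul_sub, Matrix.vecMul_one, Pi.sub_apply, Pi.zero_apply, sub_eq_zero] at this
    simpa [Matrix.vecMul, dotProduct] using this
  have hle : ∀ s', |v s'| ≤ ∑ s, |v s| * Q s s' := by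
    intro s'
    conv_lhs => rw [← hst s']
    refine (Finset.abs_sum_le_sum_abs _ _).trans_eq (Finset.sum_congr rfl fun s _ => ?_)
    rw [abs_mul, abs_of_nonneg (Matrix.nonneg_of_mem_rowStochastic hQ)]
  have hsum : ∑ s', |v s'| = ∑ s', ∑ s, |v s| * Q s s' := by
    rw [Finset.sum_comm]
    simp_rw [← Finset.mul_sum, Matrix.sum_row_of_mem_rowStochastic hQ, mul_one]
  have heq := (Finset.sum_eq_sum_iff_of_le fun s' _ => hle s').1 hsum
  have hpos : 0 < ∑ s, |v s| := by
    obtain ⟨s, hs⟩ := Function.ne_iff.1 hv0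
    exact Finset.sum_pos' (fun _ _ => abs_nonneg _) ⟨s, Finset.mem_univ _, abs_pos.2 hs⟩
  refine ⟨fun s => |v s| / ∑ s, |v s|, fun s => by positivity, ?_, fun s' => ?_⟩
  · rw [← Finset.sum_div, div_self hpos.ne']
  · simp_rw [div_mul_eq_mul_div]
    rw [← Finset.sum_div, ← heq s' (Finset.mem_univ _)]

theorem abs_pow_sub_le_of_minorized (hR : R ∈ Matrix.rowStochastic ℝ S)
    (hD : IsStationaryLaw R D) {e : ℝ} (he1 : e ≤ 1) (he : ∀ i j, e * D j ≤ R i j)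
    (k : ℕ) (s s' : S) : |(R ^ k) s s' - D s'| ≤ (1 - e) ^ k := by
  have hc : ∀ i, ∑ j, |R i j - e * D j| ≤ 1 - e := by
    intro i
    simp_rw [fun j => abs_of_nonneg (sub_nonneg.2 (he i j)), Finset.sum_sub_distrib,
      ← Finset.mul_sum, hD.2.1, Matrix.sum_row_of_mem_rowStochastic hR, mul_one, le_refl]
  have h := norm_act_pow_le (V := ℝ) hD (B := 1) (f := fun x => (if x = s' then 1 else 0) - D s')
    zero_le_one (by linarith) ?_ ?_ hc k s
  · rw [act_sub, act_const (pow_mem hR k)] at h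
    simpa [act] using h
  · intro x
    have h1 := hD.le_one s'
    have h2 := hD.1 s'
    rw [Real.norm_eq_abs, abs_le]
    split_ifs <;> constructor <;> linarith
  · simp [mul_sub, Finset.sum_sub_distrib, ← Finset.sum_mul, hD.2.1]

theorem exists_tendsto_pow_mul_apply (hQ : Q ∈ Matrix.rowStochastic ℝ S)
    (hprim : Q.IsPrimitive) (hD : IsStationaryLaw Q D) :
    ∃ N, 0 < N ∧ ∀ s s', Filter.Tendsto (fun k => (Q ^ (N * k)) s s') Filter.atTop
      (nhds (D s')) := by
  obtain ⟨N, hN0, hN⟩ := hprim.exists_pos_pow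
  obtain ⟨e, he0, he⟩ : ∃ e : ℝ, 0 < e ∧ ∀ i j, e ≤ (Q ^ N) i j := by
    rcases isEmpty_or_nonempty S with hS | hS
    · exact ⟨1, one_pos, fun i => hS.elim i⟩
    · obtain ⟨x, hx⟩ := Finite.exists_min fun x : S × S => (Q ^ N) x.1 x.2
      exact ⟨(Q ^ N) x.1 x.2, hN _ _, fun i j => hx (i, j)⟩
  refine ⟨N, hN0, fun s s' => tendsto_iff_norm_sub_tendsto_zero.2 ?_⟩
  have he1 : e ≤ 1 := (he s s').trans (Matrix.le_one_of_mem_rowStochastic (pow_mem hQ N))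
  have hmin : ∀ i j, e * D j ≤ (Q ^ N) i j := fun i j =>
    (mul_le_of_le_one_right he0.le (hD.le_one j)).trans (he i j)
  refine squeeze_zero (fun _ => norm_nonneg _) (fun k => ?_)
    (tendsto_pow_atTop_nhds_zero_of_lt_one (by linarith : 0 ≤ 1 - e) (by linarith))
  rw [pow_mul]
  exact abs_pow_sub_le_of_minorized (pow_mem hQ N) (hD.pow N) he1 hmin k s s'

theorem exists_sum_abs_pow_sub_le (hQ : Q ∈ Matrix.rowStochastic ℝ S)
    (hprim : Q.IsPrimitive) (hD : IsStationaryLaw Q D) {ε : ℝ} (hε : 0 < ε) :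
    ∃ t, 1 ≤ t ∧ ∀ s, ∑ s', |(Q ^ t) s s' - D s'| ≤ ε := by
  obtain ⟨N, hN, hlim⟩ := exists_tendsto_pow_mul_apply hQ hprim hD
  have hsum : ∀ s, Filter.Tendsto (fun k => ∑ s', |(Q ^ (N * k)) s s' - D s'|) Filter.atTop
      (nhds 0) := fun s => by
    simpa using tendsto_finsetSum Finset.univ fun s' _ => ((hlim s s').sub_const (D s')).abs
  obtain ⟨k, hk, hk1⟩ := ((Filter.eventually_all.2 fun s => (hsum s).eventually_le_const hε).and
    (Filter.eventually_ge_atTop 1)).exists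
  exact ⟨N * k, Nat.mul_pos hN hk1, hk⟩

end MarkovChain

section Model

variable {S A : Type*}

theorem CMDP.nonempty_state (M : CMDP S A) : Nonempty S := M.ρ.support_nonempty.to_type

theorem abs_sig_le (M : CMDP S A) (g : Sig) (s : S) (a : A) : |M.sig g s a| ≤ 1 := by
  rw [abs_le]
  cases g
  · have := M.r_mem s a; exact ⟨by change -1 ≤ M.r s a; linarith [this.1], this.2⟩
  · exact M.c_mem s a

variable [Fintype A] {M : CMDP S A}

/-- The mean of the signal `g` in state `s` under `π`; it reduces `CMDP.meanAt` to the action of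
the chain on a function of the state. -/
def CMDP.sigBar (M : CMDP S A) (π : Policy S A) (g : Sig) (s : S) : ℝ :=
  ∑ a, prob (π s) a * M.sig g s a

theorem abs_sigBar_le (M : CMDP S A) (π : Policy S A) (g : Sig) (s : S) :
    |M.sigBar π g s| ≤ 1 :=
  abs_sum_mul_le_of_weights (prob_nonneg _) (sum_prob _) fun a => abs_sig_le M g s a

variable [Fintype S]

theorem sum_prob_act (M : CMDP S A) (π : Policy S A) (f : S → ℝ) (s : S) :
    ∑ a, prob (π s) a * ∑ s', prob (M.P s a) s' * f s' = act (M.trans π) f s := by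
  simp only [act, CMDP.trans, Matrix.of_apply, smul_eq_mul, Finset.sum_mul, Finset.mul_sum]
  rw [Finset.sum_comm]
  simp only [mul_assoc]

theorem CMDP.trans_mem [DecidableEq S] (M : CMDP S A) (π : Policy S A) :
    M.trans π ∈ Matrix.rowStochastic ℝ S := by
  rw [Matrix.mem_rowStochastic_iff_sum]
  refine ⟨fun i j => Finset.sum_nonneg fun a _ => mul_nonneg (prob_nonneg _ _) (prob_nonneg _ _),
    fun i => ?_⟩
  simp only [CMDP.trans, Matrix.of_apply]
  rw [Finset.sum_comm]
  simp_rw [← Finset.mul_sum, sum_prob, mul_one]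
  exact sum_prob _

theorem CMDP.isStationaryLaw_statDist (M : CMDP S A) (π : Policy S A) :
    IsStationaryLaw (M.trans π) (M.statDist π) := by
  classical
  have := M.nonempty_state
  exact Classical.epsilon_spec (p := M.IsStationary π) (exists_isStationaryLaw (M.trans_mem π))

theorem occ_nonneg (M : CMDP S A) (π : Policy S A) (s : S) (a : A) : 0 ≤ M.occ π s a :=
  mul_nonneg ((M.isStationaryLaw_statDist π).1 s) (prob_nonneg _ _)

theorem sum_occ_right (M : CMDP S A) (π : Policy S A) (s : S) :
    ∑ a, M.occ π s a = M.statDist π s := by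
  simp only [CMDP.occ, ← Finset.mul_sum, sum_prob, mul_one]

theorem sum_occ_mul_prob (M : CMDP S A) (π : Policy S A) (s' : S) :
    ∑ s, ∑ a, M.occ π s a * prob (M.P s a) s' = ∑ a, M.occ π s' a := by
  rw [sum_occ_right, ← (M.isStationaryLaw_statDist π).2.2 s']
  simp only [CMDP.occ, CMDP.trans, Matrix.of_apply, Finset.mul_sum, mul_assoc]

variable [DecidableEq S]

theorem CMDP.Ergodic.isPrimitive (hM : M.Ergodic) (π : Policy S A) : (M.trans π).IsPrimitive :=
  (hM π).2.isPrimitive (hM π).1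

theorem CMDP.Ergodic.mixTime_spec (hM : M.Ergodic) (π : Policy S A) :
    1 ≤ M.mixTime π ∧
      ∀ s, ∑ s', |(M.trans π ^ M.mixTime π) s s' - M.statDist π s'| ≤ 1 / 2 := by
  have hne : {t : ℕ | 1 ≤ t ∧
    ∀ s, (1 / 2 : ℝ) * ∑ s', |(M.trans π ^ t) s s' - M.statDist π s'| ≤ 1 / 4}.Nonempty := by
    obtain ⟨t, ht1, ht⟩ :=
      exists_sum_abs_pow_sub_le (M.trans_mem π) (hM.isPrimitive π) (M.isStationaryLaw_statDist π)
        one_half_pos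
    exact ⟨t, ht1, fun s => by linarith [ht s]⟩
  have h := Nat.sInf_mem hne
  exact ⟨h.1, fun s => by have := h.2 s; unfold CMDP.mixTime; linarith⟩

theorem CMDP.Ergodic.sum_norm_act_le {V : Type*} [NormedAddCommGroup V] [NormedSpace ℝ V]
    (hM : M.Ergodic) {π : Policy S A} {τ : ℕ} (hτ : M.mixTime π ≤ τ)
    {f : S → V} {B : ℝ} (hB : 0 ≤ B) (hf : ∀ s, ‖f s‖ ≤ B)
    (h0 : ∑ s, M.statDist π s • f s = 0) (n : ℕ) (s : S) :
    ∑ i ∈ Finset.range n, ‖act (M.trans π ^ i) f s‖ ≤ 2 * τ * B := by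
  obtain ⟨h1, h2⟩ := hM.mixTime_spec π
  have hD := M.isStationaryLaw_statDist π
  refine (sum_norm_act_pow_le (M.trans_mem π) hD h1 h2 hB hf h0 n s).trans ?_
  have : (M.mixTime π : ℝ) ≤ τ := by exact_mod_cast hτ
  gcongr

theorem mixTime_le_of_tauMix {d : ℕ} {π : E d → Policy S A} {τ : ℕ} (h : tauMix M π = τ)
    (hτ : 1 ≤ τ) (θ : E d) : M.mixTime (π θ) ≤ τ := by
  by_cases hb : BddAbove (Set.range fun θ => M.mixTime (π θ))
  · rw [← h]; exact le_ciSup hb θ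
  · have : tauMix M π = 0 := Nat.sSup_of_not_bddAbove hb
    lia

theorem meanAt_eq (M : CMDP S A) (π : Policy S A) (g : Sig) (t : ℕ) (s : S) :
    M.meanAt π g t s = act (M.trans π ^ t) (M.sigBar π g) s := rfl

theorem CMDP.Ergodic.tendsto_meanAt (hM : M.Ergodic) (π : Policy S A) {D : S → ℝ}
    (hD : IsStationaryLaw (M.trans π) D) (g : Sig) (s : S) :
    Filter.Tendsto (fun t => M.meanAt π g t s) Filter.atTop
      (nhds (∑ s, D s * M.sigBar π g s)) := by
  obtain ⟨t, ht1, ht⟩ :=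
    exists_sum_abs_pow_sub_le (M.trans_mem π) (hM.isPrimitive π) hD one_half_pos
  set j := ∑ s, D s * M.sigBar π g s with hj
  have hj1 : |j| ≤ 1 := abs_sum_mul_le_of_weights hD.1 hD.2.1 fun s => abs_sigBar_le M π g s
  rw [tendsto_iff_norm_sub_tendsto_zero]
  have hlim : Filter.Tendsto (fun n : ℕ => (1 / 2 : ℝ) ^ (n / t) * 2) Filter.atTop
      (nhds (0 * 2)) :=
    ((tendsto_pow_atTop_nhds_zero_of_lt_one (by norm_num) (by norm_num)).comp
      (Nat.tendsto_div_const_atTop (by lia))).mul_const 2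
  rw [zero_mul] at hlim
  refine squeeze_zero (fun _ => norm_nonneg _) (fun n => ?_) hlim
  have h := norm_act_pow_le_half (V := ℝ) (M.trans_mem π) hD ht (B := 2)
    (f := fun s => M.sigBar π g s - j) (by norm_num) ?_ ?_ n s
  · rwa [act_sub, act_const (pow_mem (M.trans_mem π) n)] at h
  · intro s
    calc |M.sigBar π g s - j| ≤ |M.sigBar π g s| + |j| := abs_sub _ _
      _ ≤ 2 := by linarith [abs_sigBar_le M π g s]
  · simp [mul_sub, Finset.sum_sub_distrib, ← Finset.sum_mul, hD.2.1, hj]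

theorem CMDP.Ergodic.J_eq (hM : M.Ergodic) (π : Policy S A) {D : S → ℝ}
    (hD : IsStationaryLaw (M.trans π) D) (g : Sig) : M.J g π = ∑ s, D s * M.sigBar π g s := by
  refine Filter.Tendsto.limUnder_eq ?_
  have h : Filter.Tendsto (fun t => ∑ s, prob M.ρ s * M.meanAt π g t s) Filter.atTop
      (nhds (∑ s, prob M.ρ s * ∑ s, D s * M.sigBar π g s)) :=
    tendsto_finsetSum _ fun s _ => (hM.tendsto_meanAt π hD g s).const_mul _
  rw [← Finset.sum_mul, sum_prob, one_mul] at h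
  simpa [one_div] using h.cesaro

theorem CMDP.Ergodic.J_eq_statDist (hM : M.Ergodic) (π : Policy S A) (g : Sig) :
    M.J g π = ∑ s, M.statDist π s * M.sigBar π g s :=
  hM.J_eq π (M.isStationaryLaw_statDist π) g

theorem CMDP.Ergodic.abs_J_le (hM : M.Ergodic) (π : Policy S A) (g : Sig) : |M.J g π| ≤ 1 := by
  rw [hM.J_eq_statDist]
  have hD := M.isStationaryLaw_statDist π
  exact abs_sum_mul_le_of_weights hD.1 hD.2.1 fun s => abs_sigBar_le M π g s

theorem CMDP.Ergodic.J_r_mem (hM : M.Ergodic) (π : Policy S A) : M.J .r π ∈ Set.Icc (0 : ℝ) 1 := by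
  refine ⟨?_, (abs_le.1 (hM.abs_J_le π .r)).2⟩
  rw [hM.J_eq_statDist]
  exact Finset.sum_nonneg fun s _ => mul_nonneg ((M.isStationaryLaw_statDist π).1 s)
    (Finset.sum_nonneg fun a _ => mul_nonneg (prob_nonneg _ _) (M.r_mem s a).1)

/-- The mean signal centred at its long-run average, on which the powers of the chain contract. -/
def CMDP.sigCent (M : CMDP S A) (π : Policy S A) (g : Sig) (s : S) : ℝ :=
  M.sigBar π g s - M.J g π

theorem CMDP.Ergodic.abs_sigCent_le (hM : M.Ergodic) (π : Policy S A) (g : Sig) (s : S) :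
    |M.sigCent π g s| ≤ 2 :=
  (abs_sub _ _).trans (by linarith [abs_sigBar_le M π g s, hM.abs_J_le π g])

theorem CMDP.Ergodic.sum_sigCent (hM : M.Ergodic) (π : Policy S A) (g : Sig) :
    ∑ s, M.statDist π s • M.sigCent π g s = 0 := by
  simp [CMDP.sigCent, mul_sub, Finset.sum_sub_distrib, ← Finset.sum_mul,
    (M.isStationaryLaw_statDist π).2.1, ← hM.J_eq_statDist]

theorem act_sigCent (M : CMDP S A) (π : Policy S A) (g : Sig) (t : ℕ) (s : S) :
    act (M.trans π ^ t) (M.sigCent π g) s = M.meanAt π g t s - M.J g π := by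
  unfold CMDP.sigCent
  rw [act_sub, act_const (pow_mem (M.trans_mem π) t), meanAt_eq]

/-- The differential value function as a series along the chain. It equals `CMDP.V`, but this form
makes Poisson's equation a shift of the series. -/
def CMDP.potential (M : CMDP S A) (π : Policy S A) (g : Sig) (s : S) : ℝ :=
  ∑' t : ℕ, (M.meanAt π g t s - M.J g π)

theorem CMDP.Ergodic.sum_abs_meanAt_le (hM : M.Ergodic) {π : Policy S A} {τ : ℕ}
    (hτ : M.mixTime π ≤ τ) (g : Sig) (s : S) (n : ℕ) :
    ∑ t ∈ Finset.range n, |M.meanAt π g t s - M.J g π| ≤ 4 * τ := by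
  have := hM.sum_norm_act_le hτ (by norm_num) (hM.abs_sigCent_le π g) (hM.sum_sigCent π g) n s
  simp only [act_sigCent, Real.norm_eq_abs] at this
  linarith

theorem CMDP.Ergodic.summable_meanAt (hM : M.Ergodic) (π : Policy S A) (g : Sig) (s : S) :
    Summable fun t => M.meanAt π g t s - M.J g π :=
  Summable.of_norm (summable_of_sum_range_le (fun _ => norm_nonneg _)
    (hM.sum_abs_meanAt_le le_rfl g s))

theorem meanAt_succ (M : CMDP S A) (π : Policy S A) (g : Sig) (t : ℕ) (s : S) :
    M.meanAt π g (t + 1) s = act (M.trans π) (fun s' => M.meanAt π g t s') s := by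
  rw [meanAt_eq, pow_succ', act_mul]
  rfl

theorem CMDP.Ergodic.Q_eq_potential (hM : M.Ergodic) (π : Policy S A) (g : Sig) (s : S) (a : A) :
    M.Q g π s a =
      M.sig g s a - M.J g π + ∑ s', prob (M.P s a) s' * M.potential π g s' := by
  have hstep : ∀ t, M.meanAtSA π g (t + 1) s a - M.J g π =
      ∑ s', prob (M.P s a) s' * (M.meanAt π g t s' - M.J g π) := by
    intro t
    simp only [CMDP.meanAtSA, mul_sub, Finset.sum_sub_distrib, ← Finset.sum_mul, sum_prob, one_mul]
  have hsum : HasSum (fun t => M.meanAtSA π g (t + 1) s a - M.J g π)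
      (∑ s', prob (M.P s a) s' * M.potential π g s') := by
    simp_rw [hstep]
    exact hasSum_sum fun s' _ => (hM.summable_meanAt π g s').hasSum.mul_left _
  have h1 : Summable fun t => M.meanAtSA π g t s a - M.J g π :=
    (summable_nat_add_iff 1).1 hsum.summable
  rw [CMDP.Q, h1.tsum_eq_zero_add, hsum.tsum_eq]
  rfl

theorem CMDP.Ergodic.potential_eq (hM : M.Ergodic) (π : Policy S A) (g : Sig) (s : S) :
    M.potential π g s = M.sigCent π g s + act (M.trans π) (M.potential π g) s := by
  have hsum : HasSum (fun t => M.meanAt π g (t + 1) s - M.J g π)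
      (act (M.trans π) (M.potential π g) s) := by
    have e : ∀ t, M.meanAt π g (t + 1) s - M.J g π =
        ∑ s', M.trans π s s' * (M.meanAt π g t s' - M.J g π) := by
      intro t
      rw [meanAt_succ]
      simp [act, mul_sub, Finset.sum_sub_distrib, ← Finset.sum_mul,
        Matrix.sum_row_of_mem_rowStochastic (M.trans_mem π)]
    simp_rw [e]
    exact hasSum_sum fun s' _ => (hM.summable_meanAt π g s').hasSum.mul_left _
  rw [CMDP.potential, (hM.summable_meanAt π g s).tsum_eq_zero_add, hsum.tsum_eq, meanAt_eq,
    pow_zero, act_one]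
  rfl

theorem CMDP.Ergodic.V_eq_potential (hM : M.Ergodic) (π : Policy S A) (g : Sig) (s : S) :
    M.V g π s = M.potential π g s := by
  rw [hM.potential_eq, CMDP.V, ← sum_prob_act]
  simp only [hM.Q_eq_potential, mul_add, mul_sub, Finset.sum_add_distrib, Finset.sum_sub_distrib,
    ← Finset.sum_mul, sum_prob, one_mul]
  rfl

theorem CMDP.Ergodic.adv_eq (hM : M.Ergodic) (π : Policy S A) (g : Sig) (s : S) (a : A) :
    M.Adv g π s a = M.sig g s a - M.J g π + ∑ s', prob (M.P s a) s' * M.V g π s' - M.V g π s := by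
  simp_rw [CMDP.Adv, hM.Q_eq_potential, ← hM.V_eq_potential]

theorem CMDP.Ergodic.sum_occ_adv (hM : M.Ergodic) (πs π : Policy S A) (g : Sig) :
    ∑ s, ∑ a, M.occ πs s a * M.Adv g π s a = M.J g πs - M.J g π := by
  have hst := M.isStationaryLaw_statDist πs
  have h1 : ∀ s, ∑ a, M.occ πs s a * M.Adv g π s a =
      M.statDist πs s * M.sigBar πs g s - M.statDist πs s * M.J g π +
        (M.statDist πs s • act (M.trans πs) (M.V g π) s - M.statDist πs s • M.V g π s) := by
    intro s
    rw [← sum_prob_act]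
    simp only [CMDP.occ, mul_assoc, ← Finset.mul_sum, smul_eq_mul, ← mul_sub, ← mul_add]
    congr 1
    simp only [hM.adv_eq, mul_add, mul_sub, Finset.sum_add_distrib, Finset.sum_sub_distrib,
      ← Finset.sum_mul, sum_prob, one_mul, CMDP.sigBar]
    ring
  simp_rw [h1, Finset.sum_add_distrib, Finset.sum_sub_distrib, hst.sum_act, sub_self, add_zero,
    ← Finset.sum_mul, hst.2.1, one_mul, ← hM.J_eq_statDist]

theorem CMDP.Ergodic.J_eq_sum_occ (hM : M.Ergodic) (π : Policy S A) (g : Sig) :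
    M.J g π = ∑ s, ∑ a, M.occ π s a * M.sig g s a := by
  simp only [hM.J_eq_statDist, CMDP.occ, CMDP.sigBar, Finset.mul_sum, mul_assoc]

/-- The policy `ν(s, a) / ∑ₐ ν(s, a)` has the state marginal of `ν` as a stationary law. -/
theorem CMDP.Ergodic.exists_policy_of_flow (hM : M.Ergodic) {ν : S → A → ℝ}
    (h0 : ∀ s a, 0 ≤ ν s a) (h1 : ∑ s, ∑ a, ν s a = 1)
    (hflow : ∀ s', ∑ s, ∑ a, ν s a * prob (M.P s a) s' = ∑ a, ν s' a) :
    ∃ π : Policy S A, ∀ g, M.J g π = ∑ s, ∑ a, ν s a * M.sig g s a := by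
  obtain ⟨s₀, -, hs₀⟩ := Finset.exists_ne_zero_of_sum_ne_zero (h1.trans_ne one_ne_zero)
  obtain ⟨a₀, -, -⟩ := Finset.exists_ne_zero_of_sum_ne_zero hs₀
  have : Nonempty A := ⟨a₀⟩
  choose π hπ using fun s => exists_sum_mul_prob_eq (ν s) (h0 s)
  have hstat : IsStationaryLaw (M.trans π) fun s => ∑ a, ν s a := by
    refine ⟨fun s => Finset.sum_nonneg fun a _ => h0 s a, h1, fun s' => ?_⟩
    simp only [← hflow s', CMDP.trans, Matrix.of_apply, Finset.mul_sum, ← mul_assoc, hπ]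
  refine ⟨π, fun g => ?_⟩
  simp only [hM.J_eq π hstat, CMDP.sigBar, Finset.mul_sum, ← mul_assoc, hπ]

theorem CMDP.Ergodic.exists_mixture (hM : M.Ergodic) (π₁ π₂ : Policy S A) {t : ℝ} (ht0 : 0 ≤ t)
    (ht1 : t ≤ 1) : ∃ π : Policy S A, ∀ g, M.J g π = t * M.J g π₁ + (1 - t) * M.J g π₂ := by
  have hsplit : ∀ (f : S → A → ℝ) (s : S),
      ∑ a, (t * M.occ π₁ s a + (1 - t) * M.occ π₂ s a) * f s a =
        t * ∑ a, M.occ π₁ s a * f s a + (1 - t) * ∑ a, M.occ π₂ s a * f s a := by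
    intro f s
    simp only [add_mul, Finset.sum_add_distrib, mul_assoc, ← Finset.mul_sum]
  have hmass : ∑ s, ∑ a, (t * M.occ π₁ s a + (1 - t) * M.occ π₂ s a) = 1 := by
    simp only [Finset.sum_add_distrib, ← Finset.mul_sum, sum_occ_right,
      (M.isStationaryLaw_statDist _).2.1]
    ring
  have hflow : ∀ s', ∑ s, ∑ a,
      (t * M.occ π₁ s a + (1 - t) * M.occ π₂ s a) * prob (M.P s a) s' =
        ∑ a, (t * M.occ π₁ s' a + (1 - t) * M.occ π₂ s' a) := by
    intro s'
    simp only [hsplit fun s a => prob (M.P s a) s', Finset.sum_add_distrib, ← Finset.mul_sum,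
      sum_occ_mul_prob]
  obtain ⟨π, hπ⟩ := hM.exists_policy_of_flow
    (fun s a => add_nonneg (mul_nonneg ht0 (occ_nonneg M π₁ s a))
      (mul_nonneg (sub_nonneg.2 ht1) (occ_nonneg M π₂ s a))) hmass hflow
  refine ⟨π, fun g => ?_⟩
  simp only [hπ, hsplit, Finset.sum_add_distrib, ← Finset.mul_sum, hM.J_eq_sum_occ]

/-- Mixing `π` and `π'` in the proportion that makes the constraint tight gives a feasible policy,
to which the optimality of `πs` applies. -/
theorem CMDP.Ergodic.slope_le_slope (hM : M.Ergodic) {πs π π' : Policy S A}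
    (hopt : M.IsOptimal πs) (hneg : M.J .c π < 0) (hpos : 0 < M.J .c π') :
    (M.J .r π - M.J .r πs) / (-M.J .c π) ≤ (M.J .r πs - M.J .r π') / M.J .c π' := by
  set x := M.J .c π
  set y := M.J .c π'
  have hxy : 0 < y - x := by linarith
  obtain ⟨πm, hm⟩ := hM.exists_mixture π π' (t := y / (y - x)) (div_nonneg hpos.le hxy.le)
    (by rw [div_le_one hxy]; linarith)
  have htight : M.J .c πm = 0 := by
    rw [hm .c]
    change y / (y - x) * x + (1 - y / (y - x)) * y = 0
    field_simp
    ring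
  have hr := hopt.2 πm htight.ge
  have hscaled : (y - x) * M.J .r πm = y * M.J .r π + (-x) * M.J .r π' := by
    rw [hm .r]
    field_simp
    ring
  rw [div_le_div_iff₀ (by linarith) hpos]
  nlinarith [mul_le_mul_of_nonneg_left hr hxy.le]

/-- Strong duality. The multiplier is the largest slope `(J_r^π - J_r^*) / (-J_c^π)` over the
policies `π` that violate the constraint. -/
theorem CMDP.Ergodic.exists_multiplier (hM : M.Ergodic) {πs πb : Policy S A} {δ : ℝ}
    (hδ : 0 < δ) (hopt : M.IsOptimal πs) (hb : δ ≤ M.J .c πb) :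
    ∃ l : ℝ, 0 ≤ l ∧ l ≤ 1 / δ ∧ ∀ π, M.J .r π + l * M.J .c π ≤ M.J .r πs := by
  set U : Set ℝ := insert 0 {u | ∃ π, M.J .c π < 0 ∧ u = (M.J .r π - M.J .r πs) / (-M.J .c π)}
  have hub : ∀ π', 0 < M.J .c π' → ∀ u ∈ U, u ≤ (M.J .r πs - M.J .r π') / M.J .c π' := by
    rintro π' h' u (rfl | ⟨π, h, rfl⟩)
    · exact div_nonneg (by linarith [hopt.2 π' h'.le]) h'.le
    · exact hM.slope_le_slope hopt h h'
  have hbdd : BddAbove U := ⟨_, hub πb (hδ.trans_le hb)⟩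
  have hne : U.Nonempty := ⟨0, Set.mem_insert _ _⟩
  refine ⟨sSup U, le_csSup hbdd (Set.mem_insert _ _), ?_, fun π => ?_⟩
  · refine (csSup_le hne (hub πb (hδ.trans_le hb))).trans ?_
    exact div_le_div₀ zero_le_one (by linarith [(hM.J_r_mem πs).2, (hM.J_r_mem πb).1]) hδ hb
  · rcases lt_trichotomy (M.J .c π) 0 with h | h | h
    · have hslope := le_csSup hbdd (Set.mem_insert_of_mem 0 ⟨π, h, rfl⟩ :
        (M.J .r π - M.J .r πs) / (-M.J .c π) ∈ U)
      rw [div_le_iff₀ (by linarith)] at hslope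
      linarith
    · rw [h]
      linarith [hopt.2 π h.ge]
    · have hslope := csSup_le hne (hub π h)
      rw [le_div_iff₀ h] at hslope
      linarith

end Model

section Rollout

variable {S A : Type*} {M : CMDP S A} {V : Type*} [NormedAddCommGroup V] [NormedSpace ℝ V]

/-- The law of one transition `(s, a, s')` of the chain that `π` induces, started in `s`. -/
def stepLaw (M : CMDP S A) (π : Policy S A) (s : S) : PMF (S × A × S) :=
  (π s).bind fun a => (M.P s a).map fun s' => (s, a, s')

theorem rollout_succ (M : CMDP S A) (π : Policy S A) (n : ℕ) (s : S) :
    rollout M π (n + 1) s =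
      (stepLaw M π s).bind fun z => (rollout M π n z.2.2).map fun zs => z :: zs := by
  simp only [rollout, stepLaw, PMF.bind_bind, PMF.bind_map]
  rfl

theorem length_of_mem_rollout {π : Policy S A} {n : ℕ} {s : S} {zs : List (S × A × S)}
    (h : zs ∈ (rollout M π n s).support) : zs.length = n := by
  induction n generalizing s zs with
  | zero => simp_all [rollout, PMF.support_pure]
  | succ n ih =>
    rw [rollout_succ, PMF.mem_support_bind_iff] at h
    obtain ⟨z, -, h⟩ := h
    rw [PMF.mem_support_map_iff] at h
    obtain ⟨ws, hws, rfl⟩ := h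
    simp [ih hws]

theorem rollout_map_take (M : CMDP S A) (π : Policy S A) {n N : ℕ} (h : n ≤ N) (s : S) :
    (rollout M π N s).map (List.take n) = rollout M π n s := by
  induction n generalizing N s with
  | zero =>
    have : (List.take 0 : List (S × A × S) → _) = Function.const _ [] := by funext; simp
    rw [this, PMF.map_const]; rfl
  | succ n ih =>
    obtain ⟨N, rfl⟩ : ∃ k, N = k + 1 := ⟨N - 1, by lia⟩
    simp only [rollout_succ, PMF.map_bind, PMF.map_comp]
    congr 1
    funext z
    rw [← ih (N := N) (by lia), PMF.map_comp]
    congr 1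

theorem levelAvg_eq_take {X : Type*} [AddCommGroup X] [Module ℝ X] (v : S × A × S → X)
    (zs : List (S × A × S)) (j : ℕ) : levelAvg v zs j = levelAvg v (zs.take (2 ^ j)) j := by
  rw [levelAvg, levelAvg, List.take_take, min_self]

theorem levelAvg_sub_const (v : S × A × S → V) (c : V) {zs : List (S × A × S)} {j : ℕ}
    (h : zs.length = 2 ^ j) :
    levelAvg v zs j - c = ((2 : ℝ) ^ j)⁻¹ • (zs.map fun z => v z - c).sum := by
  have e : (zs.map fun z => v z - c).sum = (zs.map v).sum - zs.length • c := by
    clear h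
    induction zs with
    | nil => simp
    | cons z zs ih =>
      simp only [List.map_cons, List.sum_cons, ih, List.length_cons, add_smul, one_smul]
      abel
  have h2 : (2 : ℝ) ^ j ≠ 0 := by positivity
  rw [e, h, levelAvg, List.take_of_length_le h.le, smul_sub, ← Nat.cast_smul_eq_nsmul ℝ,
    smul_smul]
  push_cast
  rw [inv_mul_cancel₀ h2, one_smul]

theorem norm_levelAvg_le {v : S × A × S → V} {B : ℝ} (hv : ∀ z, ‖v z‖ ≤ B)
    (hB : 0 ≤ B) (zs : List (S × A × S)) (j : ℕ) : ‖levelAvg v zs j‖ ≤ B := by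
  have h : ∀ ws : List (S × A × S), ‖(ws.map v).sum‖ ≤ ws.length * B := by
    intro ws
    induction ws with
    | nil => simp
    | cons z ws ih =>
      simp only [List.map_cons, List.sum_cons, List.length_cons]
      push_cast
      linarith [norm_add_le (v z) (ws.map v).sum, hv z]
  rw [levelAvg, norm_smul, norm_inv, Real.norm_of_nonneg (by positivity), inv_mul_le_iff₀
    (by positivity)]
  refine (h _).trans (mul_le_mul_of_nonneg_right ?_ hB)
  have : (zs.take (2 ^ j)).length ≤ 2 ^ j := List.length_take_le _ _
  exact_mod_cast this

section Finite

variable [Finite S] [Finite A]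

theorem finSupp_stepLaw (M : CMDP S A) (π : Policy S A) (s : S) : FinSupp (stepLaw M π s) :=
  (finSupp_of_finite _).bind fun _ => (finSupp_of_finite _).map _

theorem finSupp_rollout (M : CMDP S A) (π : Policy S A) (n : ℕ) (s : S) :
    FinSupp (rollout M π n s) := by
  induction n generalizing s with
  | zero => exact finSupp_pure _
  | succ n ih =>
    rw [rollout_succ]
    exact (finSupp_stepLaw M π s).bind fun z => (ih _).map _

theorem ev_rollout_succ (M : CMDP S A) (π : Policy S A) (n : ℕ) (s : S) (F : List (S × A × S) → V) :
    ev (rollout M π (n + 1) s) F =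
      ev (stepLaw M π s) fun z => ev (rollout M π n z.2.2) fun zs => F (z :: zs) := by
  rw [rollout_succ, (finSupp_stepLaw M π s).ev_bind fun z => (finSupp_rollout M π n _).map _]
  simp_rw [(finSupp_rollout M π n _).ev_map]

theorem ev_rollout_take (M : CMDP S A) (π : Policy S A) {n N : ℕ} (h : n ≤ N) (s : S)
    (F : List (S × A × S) → V) :
    ev (rollout M π N s) (fun zs => F (zs.take n)) = ev (rollout M π n s) F := by
  rw [← rollout_map_take M π h, (finSupp_rollout M π N s).ev_map]

theorem ev_levelAvg (M : CMDP S A) (π : Policy S A) (v : S × A × S → V) {j N : ℕ}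
    (h : 2 ^ j ≤ N) (s : S) :
    ev (rollout M π N s) (fun zs => levelAvg v zs j) =
      ev (rollout M π (2 ^ j) s) (fun zs => levelAvg v zs j) := by
  rw [← ev_rollout_take M π h s fun zs => levelAvg v zs j]
  simp_rw [← levelAvg_eq_take]

/-- After conditioning on the first transition the cross term only sees the conditional mean of the
remaining sum, so the second moment grows linearly in `n`. -/
theorem ev_rollout_norm_sum_sq_le
    {V : Type*} [NormedAddCommGroup V] [InnerProductSpace ℝ V]
    (M : CMDP S A) (π : Policy S A) {u : S × A × S → V} {B R : ℝ}
    (hB : 0 ≤ B) (hu : ∀ z, ‖u z‖ ≤ B)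
    (hR : ∀ n s, ‖ev (rollout M π n s) (fun zs => (zs.map u).sum)‖ ≤ R) (n : ℕ) (s : S) :
    ev (rollout M π n s) (fun zs => ‖(zs.map u).sum‖ ^ 2) ≤ n * (B ^ 2 + 2 * B * R) := by
  induction n generalizing s with
  | zero => simp [rollout, ev_pure]
  | succ n ih =>
    rw [ev_rollout_succ]
    refine (finSupp_stepLaw M π s).ev_le fun z _ => ?_
    have hF := finSupp_rollout M π n z.2.2
    simp only [List.map_cons, List.sum_cons]
    simp_rw [norm_add_sq_real]
    rw [hF.ev_add, hF.ev_add, hF.ev_const, hF.ev_mul]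
    have e : ev (rollout M π n z.2.2) (fun zs => inner ℝ (u z) (zs.map u).sum) =
        inner ℝ (u z) (ev (rollout M π n z.2.2) fun zs => (zs.map u).sum) :=
      (hF.map_ev (innerₗ V (u z)) fun zs => (zs.map u).sum).symm
    rw [e]
    have h1 := real_inner_le_norm (u z) (ev (rollout M π n z.2.2) fun zs => (zs.map u).sum)
    have h2 := mul_le_mul (hu z) (hR n z.2.2) (norm_nonneg _) hB
    have h3 : ‖u z‖ ^ 2 ≤ B ^ 2 := pow_le_pow_left₀ (norm_nonneg _) (hu z) 2
    have h4 := ih z.2.2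
    push_cast
    linarith

end Finite

variable [Fintype S] [Fintype A]

theorem ev_stepLaw (M : CMDP S A) (π : Policy S A) (s : S) (v : S × A × S → V) :
    ev (stepLaw M π s) v = ∑ a, prob (π s) a • ∑ s', prob (M.P s a) s' • v (s, a, s') := by
  rw [stepLaw, (finSupp_of_finite _).ev_bind fun _ => (finSupp_of_finite _).map _, ev_eq_sum_univ]
  simp_rw [(finSupp_of_finite _).ev_map, ev_eq_sum_univ]

theorem ev_stepLaw_next (M : CMDP S A) (π : Policy S A) (s : S) (f : S → V) :
    ev (stepLaw M π s) (fun z => f z.2.2) = act (M.trans π) f s := by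
  rw [ev_stepLaw]
  simp only [act, CMDP.trans, Matrix.of_apply, Finset.sum_smul, Finset.smul_sum, mul_smul]
  rw [Finset.sum_comm]

/-- The mean of a function of a transition in the stationary regime; `meanZ` for one policy rather
than a parametrized class. -/
def statMean (M : CMDP S A) (π : Policy S A) (v : S × A × S → V) : V :=
  ∑ s, M.statDist π s • ev (stepLaw M π s) v

theorem meanZ_eq_statMean {d : ℕ} (M : CMDP S A) (π : E d → Policy S A) (θ : E d)
    (f : S × A × S → V) : meanZ M π θ f = statMean M (π θ) f := by
  simp only [meanZ, statMean, ev_stepLaw, CMDP.occ, Finset.smul_sum, smul_smul, mul_assoc]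

theorem norm_statMean_le (M : CMDP S A) (π : Policy S A) {v : S × A × S → V} {B : ℝ}
    (hv : ∀ z, ‖v z‖ ≤ B) : ‖statMean M π v‖ ≤ B :=
  norm_sum_smul_le_of_weights (M.isStationaryLaw_statDist π).1 (M.isStationaryLaw_statDist π).2.1
    fun s => (finSupp_stepLaw M π s).norm_ev_le_of_le hv

variable [DecidableEq S]

theorem ev_rollout_sum (M : CMDP S A) (π : Policy S A) (u : S × A × S → V) (n : ℕ) (s : S) :
    ev (rollout M π n s) (fun zs => (zs.map u).sum) =
      ∑ i ∈ Finset.range n, act (M.trans π ^ i) (fun s' => ev (stepLaw M π s') u) s := by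
  induction n generalizing s with
  | zero => simp [rollout, ev_pure]
  | succ n ih =>
    rw [ev_rollout_succ]
    simp only [List.map_cons, List.sum_cons]
    simp_rw [(finSupp_rollout M π n _).ev_add, (finSupp_rollout M π n _).ev_const]
    rw [(finSupp_stepLaw M π s).ev_add]
    simp_rw [ih]
    rw [ev_stepLaw_next M π s (fun x => ∑ i ∈ Finset.range n,
        act (M.trans π ^ i) (fun s' => ev (stepLaw M π s') u) x), act_sum,
      Finset.sum_range_succ', pow_zero, act_one, add_comm]
    simp_rw [pow_succ', act_mul]

theorem CMDP.Ergodic.norm_ev_rollout_sum_le (hM : M.Ergodic) {π : Policy S A} {τ : ℕ}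
    (hτ : M.mixTime π ≤ τ) {v : S × A × S → V} {B : ℝ} (hB : 0 ≤ B) (hv : ∀ z, ‖v z‖ ≤ B)
    (n : ℕ) (s : S) :
    ‖ev (rollout M π n s) (fun zs => (zs.map fun z => v z - statMean M π v).sum)‖ ≤
      4 * τ * B := by
  rw [ev_rollout_sum]
  have hc : ∀ z, ‖v z - statMean M π v‖ ≤ 2 * B := fun z =>
    (norm_sub_le _ _).trans (by linarith [hv z, norm_statMean_le M π hv])
  refine (norm_sum_le _ _).trans
    ((hM.sum_norm_act_le hτ (B := 2 * B) (by linarith)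
      (fun s => (finSupp_stepLaw M π s).norm_ev_le_of_le hc) ?_ n s).trans_eq (by ring))
  simp_rw [(finSupp_stepLaw M π _).ev_sub, (finSupp_stepLaw M π _).ev_const, smul_sub,
    Finset.sum_sub_distrib, ← Finset.sum_smul, (M.isStationaryLaw_statDist π).2.1, one_smul]
  exact sub_self _

theorem CMDP.Ergodic.norm_ev_levelAvg_sub_le (hM : M.Ergodic) {π : Policy S A} {τ : ℕ}
    (hτ : M.mixTime π ≤ τ) {v : S × A × S → V} {B : ℝ} (hB : 0 ≤ B) (hv : ∀ z, ‖v z‖ ≤ B)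
    (j : ℕ) (s : S) :
    ‖ev (rollout M π (2 ^ j) s) (fun zs => levelAvg v zs j) - statMean M π v‖ ≤
      4 * τ * B / 2 ^ j := by
  have hF := finSupp_rollout M π (2 ^ j) s
  have e : ev (rollout M π (2 ^ j) s) (fun zs => levelAvg v zs j) - statMean M π v =
      ((2 : ℝ) ^ j)⁻¹ •
        ev (rollout M π (2 ^ j) s) (fun zs => (zs.map fun z => v z - statMean M π v).sum) := by
    rw [← hF.ev_smul]
    conv_lhs => rw [← hF.ev_const (statMean M π v), ← hF.ev_sub]
    exact ev_congr fun zs hzs => levelAvg_sub_const v _ (length_of_mem_rollout hzs)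
  rw [e, norm_smul, norm_inv, Real.norm_of_nonneg (by positivity), div_eq_inv_mul]
  exact mul_le_mul_of_nonneg_left (hM.norm_ev_rollout_sum_le hτ hB hv _ s) (by positivity)

theorem CMDP.Ergodic.ev_levelAvg_sub_sq_le
    {V : Type*} [NormedAddCommGroup V] [InnerProductSpace ℝ V]
    (hM : M.Ergodic) {π : Policy S A} {τ : ℕ}
    (hτ : M.mixTime π ≤ τ) {v : S × A × S → V} {B : ℝ} (hB : 0 ≤ B) (hv : ∀ z, ‖v z‖ ≤ B)
    {j N : ℕ} (hj : 2 ^ j ≤ N) (s : S) :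
    ev (rollout M π N s) (fun zs => ‖levelAvg v zs j - statMean M π v‖ ^ 2) ≤
      (4 + 16 * τ) * B ^ 2 / 2 ^ j := by
  have hF := finSupp_rollout M π (2 ^ j) s
  have e1 := ev_rollout_take M π hj s fun zs => ‖levelAvg v zs j - statMean M π v‖ ^ 2
  simp_rw [← levelAvg_eq_take] at e1
  have e2 : ev (rollout M π (2 ^ j) s) (fun zs => ‖levelAvg v zs j - statMean M π v‖ ^ 2) =
      (((2 : ℝ) ^ j)⁻¹) ^ 2 * ev (rollout M π (2 ^ j) s)
        (fun zs => ‖(zs.map fun z => v z - statMean M π v).sum‖ ^ 2) := by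
    rw [← hF.ev_mul]
    refine ev_congr fun zs hzs => ?_
    rw [levelAvg_sub_const v _ (length_of_mem_rollout hzs), norm_smul, norm_inv,
      Real.norm_of_nonneg (by positivity), mul_pow]
  have hc : ∀ z, ‖v z - statMean M π v‖ ≤ 2 * B := fun z =>
    (norm_sub_le _ _).trans (by linarith [hv z, norm_statMean_le M π hv])
  have h := ev_rollout_norm_sum_sq_le M π (by linarith) hc
    (hM.norm_ev_rollout_sum_le hτ hB hv) (2 ^ j) s
  rw [e1, e2]
  calc _ ≤ (((2 : ℝ) ^ j)⁻¹) ^ 2 *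
        (((2 ^ j : ℕ) : ℝ) * ((2 * B) ^ 2 + 2 * (2 * B) * (4 * τ * B))) :=
        mul_le_mul_of_nonneg_left h (by positivity)
    _ = (4 + 16 * τ) * B ^ 2 / 2 ^ j := by push_cast; field_simp; ring

end Rollout

section MultiLevel

variable {S A V : Type*} {M : CMDP S A}

/-- The level of a multi-level estimate, with all levels above `J` merged into `J + 1`. Levels with
`2 ^ q > Tmax` all yield the same one-step estimate, so this replaces `geomHalf` by a law of finite
support. -/
def truncGeom (J : ℕ) : PMF ℕ := geomHalf.map fun q => min q (J + 1)

theorem support_truncGeom (J : ℕ) : (truncGeom J).support ⊆ Finset.range (J + 2) := by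
  intro q hq
  rw [truncGeom, PMF.mem_support_map_iff] at hq
  obtain ⟨a, -, rfl⟩ := hq
  simp

theorem finSupp_truncGeom (J : ℕ) : FinSupp (truncGeom J) :=
  (Finset.finite_toSet _).subset (support_truncGeom J)

theorem prob_truncGeom {J q : ℕ} (hq : q ≤ J) :
    prob (truncGeom J) q = if q = 0 then 0 else ((2 : ℝ) ^ q)⁻¹ := by
  have h : truncGeom J q = geomHalf q := by
    rw [truncGeom, PMF.map_apply, tsum_eq_single q]
    · rw [if_pos (by lia)]
    · intro b hb
      rw [if_neg (by lia)]
  have h2 : geomHalf q = if q = 0 then 0 else (2⁻¹ : ENNReal) ^ q := rfl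
  rw [prob, h, h2]
  split_ifs <;> simp

theorem ne_zero_of_mem_support_truncGeom {J q : ℕ} (hq : q ∈ (truncGeom J).support) : q ≠ 0 := by
  rintro rfl
  have h := prob_truncGeom (Nat.zero_le J)
  rw [if_pos rfl, prob, ENNReal.toReal_eq_zero_iff] at h
  exact h.elim ((PMF.mem_support_iff _ _).1 hq) (PMF.apply_ne_top _ _)

theorem ev_truncGeom_pow_smul [NormedAddCommGroup V] [NormedSpace ℝ V] (J : ℕ) (f : ℕ → V) :
    ev (truncGeom J) (fun q => if q ≤ J then (2 : ℝ) ^ q • f q else 0) =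
      ∑ q ∈ Finset.range J, f (q + 1) := by
  rw [ev_eq_sum (support_truncGeom J), Finset.sum_range_succ, Finset.sum_range_succ',
    prob_truncGeom (Nat.zero_le J), if_pos rfl, zero_smul, add_zero, if_neg (by lia), smul_zero,
    add_zero]
  refine Finset.sum_congr rfl fun q hq => ?_
  have hqJ : q + 1 ≤ J := Finset.mem_range.1 hq
  rw [if_pos hqJ, prob_truncGeom hqJ, if_neg q.succ_ne_zero, inv_smul_smul₀ (by positivity)]

theorem pow_le_iff_le_log {Tmax q : ℕ} (hT : Tmax ≠ 0) : 2 ^ q ≤ Tmax ↔ q ≤ Nat.log 2 Tmax :=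
  (Nat.le_log_iff_pow_le (by norm_num) hT).symm

theorem trajLen_eq_pow {Tmax q : ℕ} (h : 2 ^ q ≤ Tmax) : trajLen Tmax q = 2 ^ q := by
  rw [trajLen, if_pos h, Nat.sub_add_cancel Nat.one_le_two_pow]

/-- The joint law of the (truncated) level and of the trajectory that a multi-level estimate
uses. -/
def sampleLaw (M : CMDP S A) (π : Policy S A) (Tmax : ℕ) (s : S) :
    PMF (ℕ × List (S × A × S)) :=
  (truncGeom (Nat.log 2 Tmax)).bind fun q =>
    (rollout M π (trajLen Tmax q) s).map fun zs => (q, zs)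

theorem geomHalf_bind_rollout {Y : Type*} (M : CMDP S A) (π : Policy S A) {Tmax : ℕ}
    (hT : Tmax ≠ 0) (s : S) (F : ℕ → List (S × A × S) → Y)
    (hF : ∀ q q', ¬ 2 ^ q ≤ Tmax → ¬ 2 ^ q' ≤ Tmax → F q = F q') :
    (geomHalf.bind fun q => (rollout M π (trajLen Tmax q) s).map (F q)) =
      (sampleLaw M π Tmax s).map fun w => F w.1 w.2 := by
  rw [sampleLaw, truncGeom, PMF.bind_map, PMF.map_bind]
  congr 1
  funext q
  simp only [Function.comp, PMF.map_comp]
  rcases le_or_gt q (Nat.log 2 Tmax + 1) with h | h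
  · rw [min_eq_left h]; rfl
  · rw [min_eq_right h.le]
    have h1 : ¬ 2 ^ q ≤ Tmax := by rw [pow_le_iff_le_log hT]; lia
    have h2 : ¬ 2 ^ (Nat.log 2 Tmax + 1) ≤ Tmax := by rw [pow_le_iff_le_log hT]; lia
    rw [trajLen, trajLen, if_neg h1, if_neg h2, hF q _ h1 h2]
    rfl

theorem norm_add_sq_le_two [SeminormedAddCommGroup V] (x y : V) :
    ‖x + y‖ ^ 2 ≤ 2 * ‖x‖ ^ 2 + 2 * ‖y‖ ^ 2 :=
  calc ‖x + y‖ ^ 2 ≤ (‖x‖ + ‖y‖) ^ 2 := pow_le_pow_left₀ (norm_nonneg _) (norm_add_le x y) 2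
    _ ≤ 2 * ‖x‖ ^ 2 + 2 * ‖y‖ ^ 2 := add_sq_le.trans_eq (mul_add _ _ _)

theorem FinSupp.ev_norm_sq_le [SeminormedAddCommGroup V] {X : Type*} {p : PMF X}
    (hp : FinSupp p) (f : X → V) (v : V) :
    ev p (fun x => ‖f x‖ ^ 2) ≤ 2 * ev p (fun x => ‖f x - v‖ ^ 2) + 2 * ‖v‖ ^ 2 := by
  rw [← hp.ev_const (2 * ‖v‖ ^ 2), ← hp.ev_mul, ← hp.ev_add]
  exact hp.ev_mono fun x _ => by simpa only [sub_add_cancel] using norm_add_sq_le_two (f x - v) v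

theorem norm_mlmc_sq_le [NormedAddCommGroup V] [NormedSpace ℝ V] {v : S × A × S → V} {B : ℝ}
    (hB : 0 ≤ B) (hv : ∀ z, ‖v z‖ ≤ B) {Tmax q : ℕ} (h : 2 ^ q ≤ Tmax) (m : V)
    (zs : List (S × A × S)) :
    ‖mlmc Tmax v zs q‖ ^ 2 ≤ 2 * B ^ 2 + 4 * (2 ^ q) ^ 2 *
      (‖levelAvg v zs q - m‖ ^ 2 + ‖levelAvg v zs (q - 1) - m‖ ^ 2) := by
  have hbase : ‖levelAvg v zs 0‖ ^ 2 ≤ B ^ 2 :=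
    pow_le_pow_left₀ (norm_nonneg _) (norm_levelAvg_le hv hB zs 0) 2
  have hdiff : ‖levelAvg v zs q - levelAvg v zs (q - 1)‖ ^ 2 ≤
      2 * ‖levelAvg v zs q - m‖ ^ 2 + 2 * ‖levelAvg v zs (q - 1) - m‖ ^ 2 := by
    have := norm_add_sq_le_two (levelAvg v zs q - m) (m - levelAvg v zs (q - 1))
    rwa [sub_add_sub_cancel, norm_sub_rev m] at this
  have hsplit := norm_add_sq_le_two (levelAvg v zs 0)
    ((2 : ℝ) ^ q • (levelAvg v zs q - levelAvg v zs (q - 1)))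
  rw [norm_smul, Real.norm_of_nonneg (by positivity), mul_pow] at hsplit
  have hscaled := mul_le_mul_of_nonneg_left hdiff (show (0 : ℝ) ≤ 2 * (2 ^ q) ^ 2 by positivity)
  rw [mlmc, if_pos h]
  linarith

section Finite

variable [Finite S] [Finite A] [NormedAddCommGroup V] [NormedSpace ℝ V]

theorem finSupp_sampleLaw (M : CMDP S A) (π : Policy S A) (Tmax : ℕ) (s : S) :
    FinSupp (sampleLaw M π Tmax s) :=
  (finSupp_truncGeom _).bind fun _ => (finSupp_rollout M π _ s).map _

theorem ev_sampleLaw (M : CMDP S A) (π : Policy S A) (Tmax : ℕ) (s : S)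
    (F : ℕ × List (S × A × S) → V) :
    ev (sampleLaw M π Tmax s) F = ev (truncGeom (Nat.log 2 Tmax)) fun q =>
      ev (rollout M π (trajLen Tmax q) s) fun zs => F (q, zs) := by
  rw [sampleLaw, (finSupp_truncGeom _).ev_bind fun _ => (finSupp_rollout M π _ s).map _]
  simp_rw [(finSupp_rollout M π _ s).ev_map]

theorem ev_rollout_mlmc (M : CMDP S A) (π : Policy S A) {Tmax : ℕ} (hT : Tmax ≠ 0) (s : S)
    (v : S × A × S → V) {L : ℕ → V}
    (hL : ∀ j, L j = ev (rollout M π (2 ^ j) s) fun zs => levelAvg v zs j) (q : ℕ) :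
    ev (rollout M π (trajLen Tmax q) s) (fun zs => mlmc Tmax v zs q) =
      L 0 + if q ≤ Nat.log 2 Tmax then (2 : ℝ) ^ q • (L q - L (q - 1)) else 0 := by
  have hF := finSupp_rollout M π (trajLen Tmax q) s
  have hlevel : ∀ j, 2 ^ j ≤ trajLen Tmax q →
      ev (rollout M π (trajLen Tmax q) s) (fun zs => levelAvg v zs j) = L j := fun j hj => by
    rw [hL, ev_levelAvg M π v hj s]
  simp only [mlmc]
  rw [hF.ev_add, hlevel 0 (by simp [trajLen])]
  congr 1
  by_cases h : 2 ^ q ≤ Tmax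
  · have hlen := trajLen_eq_pow h
    simp only [if_pos h, if_pos ((pow_le_iff_le_log hT).1 h)]
    rw [hF.ev_smul, hF.ev_sub, hlevel q hlen.ge,
      hlevel (q - 1) (hlen ▸ Nat.pow_le_pow_right two_pos (Nat.sub_le q 1))]
  · simp only [if_neg h, if_neg (mt (pow_le_iff_le_log hT).2 h)]
    exact hF.ev_const 0

/-- The level corrections telescope, so the estimate has the bias of its finest level. -/
theorem ev_mlmc (M : CMDP S A) (π : Policy S A) {Tmax : ℕ} (hT : Tmax ≠ 0) (s : S)
    (v : S × A × S → V) :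
    ev (sampleLaw M π Tmax s) (fun w => mlmc Tmax v w.2 w.1) =
      ev (rollout M π (2 ^ Nat.log 2 Tmax) s) fun zs => levelAvg v zs (Nat.log 2 Tmax) := by
  have hG := finSupp_truncGeom (Nat.log 2 Tmax)
  let L : ℕ → V := fun j => ev (rollout M π (2 ^ j) s) fun zs => levelAvg v zs j
  rw [ev_sampleLaw]
  simp_rw [ev_rollout_mlmc M π hT s v (L := L) fun _ => rfl]
  rw [hG.ev_add, hG.ev_const, ev_truncGeom_pow_smul]
  simp only [Nat.add_sub_cancel]
  rw [Finset.sum_range_sub, add_sub_cancel]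

end Finite

variable [Fintype S] [DecidableEq S] [Fintype A]

theorem CMDP.Ergodic.norm_ev_mlmc_sub_le [NormedAddCommGroup V]
    [NormedSpace ℝ V] (hM : M.Ergodic) {π : Policy S A} {τ : ℕ}
    (hτ : M.mixTime π ≤ τ) {v : S × A × S → V} {B : ℝ} (hB : 0 ≤ B) (hv : ∀ z, ‖v z‖ ≤ B)
    {Tmax : ℕ} (hT : Tmax ≠ 0) (s : S) :
    ‖ev (sampleLaw M π Tmax s) (fun w => mlmc Tmax v w.2 w.1) - statMean M π v‖ ≤
      8 * τ / Tmax * B := by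
  rw [ev_mlmc M π hT]
  refine (hM.norm_ev_levelAvg_sub_le hτ hB hv _ s).trans ?_
  have h : (Tmax : ℝ) ≤ 2 * 2 ^ Nat.log 2 Tmax := by
    have := Nat.lt_pow_succ_log_self (b := 2) (by norm_num) Tmax
    rw [Nat.succ_eq_add_one, pow_succ'] at this
    exact_mod_cast this.le
  have hT' : (0 : ℝ) < Tmax := by positivity
  rw [div_mul_eq_mul_div, div_le_div_iff₀ (by positivity) hT']
  calc 4 * τ * B * Tmax ≤ 4 * τ * B * (2 * 2 ^ Nat.log 2 Tmax) := by gcongr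
    _ = 8 * τ * B * 2 ^ Nat.log 2 Tmax := by ring

theorem CMDP.Ergodic.ev_rollout_norm_mlmc_sq_le [NormedAddCommGroup V] [InnerProductSpace ℝ V]
    (hM : M.Ergodic) {π : Policy S A} {τ : ℕ} (hτ : M.mixTime π ≤ τ) {v : S × A × S → V} {B : ℝ}
    (hB : 0 ≤ B) (hv : ∀ z, ‖v z‖ ≤ B) {Tmax q : ℕ} (hT : Tmax ≠ 0) (hq : q ≠ 0) (s : S) :
    ev (rollout M π (trajLen Tmax q) s) (fun zs => ‖mlmc Tmax v zs q‖ ^ 2) ≤ 2 * B ^ 2 +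
      if q ≤ Nat.log 2 Tmax then (2 : ℝ) ^ q • (12 * (4 + 16 * τ) * B ^ 2) else 0 := by
  have hF := finSupp_rollout M π (trajLen Tmax q) s
  by_cases h : 2 ^ q ≤ Tmax
  · have hlen := trajLen_eq_pow h
    have hfine := hM.ev_levelAvg_sub_sq_le hτ hB hv hlen.ge s
    have hcoarse := hM.ev_levelAvg_sub_sq_le hτ hB hv
      (hlen ▸ Nat.pow_le_pow_right two_pos (Nat.sub_le q 1)) s
    rw [if_pos ((pow_le_iff_le_log hT).1 h)]
    refine (hF.ev_mono fun zs _ => norm_mlmc_sq_le hB hv h (statMean M π v) zs).trans ?_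
    rw [hF.ev_add, hF.ev_const, hF.ev_mul, hF.ev_add]
    have hpow : (2 : ℝ) ^ q = 2 * 2 ^ (q - 1) := by
      rw [← pow_succ', Nat.sub_add_cancel (by lia)]
    refine add_le_add_right ((mul_le_mul_of_nonneg_left (add_le_add hfine hcoarse)
      (by positivity)).trans_eq ?_) _
    rw [smul_eq_mul, hpow]
    field
  · rw [if_neg (mt (pow_le_iff_le_log hT).2 h), add_zero]
    refine hF.ev_le fun zs _ => ?_
    rw [mlmc, if_neg h, add_zero]
    have := pow_le_pow_left₀ (norm_nonneg _) (norm_levelAvg_le hv hB zs 0) 2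
    linarith [sq_nonneg B]

theorem CMDP.Ergodic.ev_norm_mlmc_sq_le [NormedAddCommGroup V] [InnerProductSpace ℝ V]
    (hM : M.Ergodic) {π : Policy S A} {τ : ℕ} (hτ : M.mixTime π ≤ τ) {v : S × A × S → V} {B : ℝ}
    (hB : 0 ≤ B) (hv : ∀ z, ‖v z‖ ≤ B) {Tmax : ℕ} (hT : Tmax ≠ 0) (s : S) :
    ev (sampleLaw M π Tmax s) (fun w => ‖mlmc Tmax v w.2 w.1‖ ^ 2) ≤
      (2 + 12 * (4 + 16 * τ) * Nat.log 2 Tmax) * B ^ 2 := by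
  have hG := finSupp_truncGeom (Nat.log 2 Tmax)
  rw [ev_sampleLaw]
  refine (hG.ev_mono fun q hq => hM.ev_rollout_norm_mlmc_sq_le hτ hB hv hT
    (ne_zero_of_mem_support_truncGeom hq) s).trans_eq ?_
  rw [hG.ev_add, hG.ev_const, ev_truncGeom_pow_smul, Finset.sum_const, Finset.card_range,
    nsmul_eq_mul]
  ring

end MultiLevel

section StochasticApproximation

variable {S A V : Type*} {M : CMDP S A} {π : Policy S A}

theorem le_pow_mul_add_of_affine_rec {e : ℕ → ℝ} {c m : ℝ} (hc1 : c ≤ 1) (hm : 0 ≤ m)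
    (h : ∀ n, e (n + 1) ≤ (1 - c) * e n + c * m) (n : ℕ) :
    e n ≤ (1 - c) ^ n * e 0 + m := by
  induction n with
  | zero => simpa using hm
  | succ n ih =>
    have := mul_le_mul_of_nonneg_left ih (show 0 ≤ 1 - c by linarith)
    rw [pow_succ]
    linarith [h n]

/-- One step of stochastic approximation for the zero of the stationary mean of `v`, driven by
multi-level estimates; the current state of the chain is carried along. -/
def saStep [AddCommGroup V] [Module ℝ V] (M : CMDP S A) (π : Policy S A) (Tmax : ℕ) (γ : ℝ)
    (v : V → S × A × S → V) (x : S × V) : PMF (S × V) :=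
  (sampleLaw M π Tmax x.1).map fun w =>
    (finalState x.1 w.2, x.2 - γ • mlmc Tmax (v x.2) w.2 w.1)

/-- The step size `γ` is small, and the multi-level horizon large, for a field with Lipschitz
constant `a` and coercivity constant `κ` along a chain with mixing time `τ`. -/
structure StepSmall (τ Tmax : ℕ) (γ a κ : ℝ) : Prop where
  T_ne : Tmax ≠ 0
  pos : 0 ≤ γ
  le_one : γ * κ ≤ 1
  bias : 4 * (8 * τ / Tmax) * a ≤ κ
  var : 8 * γ * (2 + 12 * (4 + 16 * τ) * Nat.log 2 Tmax) * a ^ 2 ≤ κ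

section Finite

variable [Finite S] [Finite A] [NormedAddCommGroup V] {v : V → S × A × S → V}

theorem finSupp_saStep [NormedSpace ℝ V] (M : CMDP S A) (π : Policy S A) (Tmax : ℕ) (γ : ℝ)
    (v : V → S × A × S → V) (x : S × V) : FinSupp (saStep M π Tmax γ v x) :=
  (finSupp_sampleLaw M π Tmax x.1).map _

theorem ev_saStep_norm_sub_sq [InnerProductSpace ℝ V] (M : CMDP S A) (π : Policy S A) (Tmax : ℕ)
    (γ : ℝ) (v : V → S × A × S → V) (x : S × V) (xs : V) :
    ev (saStep M π Tmax γ v x) (fun y => ‖y.2 - xs‖ ^ 2) = ‖x.2 - xs‖ ^ 2 -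
      2 * γ * inner ℝ (x.2 - xs)
        (ev (sampleLaw M π Tmax x.1) fun w => mlmc Tmax (v x.2) w.2 w.1) +
      γ ^ 2 * ev (sampleLaw M π Tmax x.1) (fun w => ‖mlmc Tmax (v x.2) w.2 w.1‖ ^ 2) := by
  have hF := finSupp_sampleLaw M π Tmax x.1
  have hexp : ∀ u : V, ‖x.2 - γ • u - xs‖ ^ 2 =
      ‖x.2 - xs‖ ^ 2 - 2 * γ * inner ℝ (x.2 - xs) u + γ ^ 2 * ‖u‖ ^ 2 := by
    intro u
    rw [sub_right_comm, norm_sub_sq_real, norm_smul, mul_pow, inner_smul_right,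
      Real.norm_eq_abs, sq_abs]
    ring
  rw [saStep, hF.ev_map]
  simp_rw [hexp]
  rw [hF.ev_add, hF.ev_sub, hF.ev_const, hF.ev_mul, hF.ev_mul]
  congr 3
  exact (hF.map_ev (innerₗ V (x.2 - xs)) fun w => mlmc Tmax (v x.2) w.2 w.1).symm

end Finite

variable [Fintype S] [Fintype A] [NormedAddCommGroup V] [InnerProductSpace ℝ V]

/-- A field for stochastic approximation whose stationary mean `x ↦ Kb (x - xs)` is affine and
coercive with zero `xs`; `a`, `B` and `κ` are its growth, noise and coercivity constants. -/
structure LinField (M : CMDP S A) (π : Policy S A) (v : V → S × A × S → V) (Kb : V →ₗ[ℝ] V)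
    (xs : V) (a B κ : ℝ) : Prop where
  a_pos : 0 < a
  B_nonneg : 0 ≤ B
  κ_pos : 0 < κ
  bound : ∀ x z, ‖v x z‖ ≤ a * ‖x - xs‖ + B
  mean : ∀ x, statMean M π (v x) = Kb (x - xs)
  coer : ∀ x, κ * ‖x‖ ^ 2 ≤ inner ℝ x (Kb x)
  op : ∀ x, ‖Kb x‖ ≤ a * ‖x‖

variable {v : V → S × A × S → V} {Kb : V →ₗ[ℝ] V} {xs : V} {a B κ γ : ℝ} {τ Tmax : ℕ}

theorem LinField.noise_nonneg (hv : LinField M π v Kb xs a B κ) (x : V) :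
    0 ≤ a * ‖x - xs‖ + B :=
  add_nonneg (mul_nonneg hv.a_pos.le (norm_nonneg _)) hv.B_nonneg

theorem LinField.norm_sub_smul_le (hv : LinField M π v Kb xs a B κ)
    (hγ : StepSmall τ Tmax γ a κ) (y : V) :
    ‖y - γ • Kb y‖ ≤ (1 - γ * κ / 2) * ‖y‖ := by
  have ha := hv.a_pos
  have hκ := hv.κ_pos
  have hγ0 := hγ.pos
  have hγa : γ * a ^ 2 ≤ κ := by
    have hvar := hγ.var
    have : 0 ≤ γ * a ^ 2 * (12 * (4 + 16 * (τ : ℝ)) * Nat.log 2 Tmax) := by positivity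
    linarith [mul_nonneg hγ0 (sq_nonneg a)]
  have hfactor : 0 ≤ 1 - γ * κ / 2 := by linarith [hγ.le_one]
  have hcross := mul_le_mul_of_nonneg_left (hv.coer y) hγ0
  have hquad : γ ^ 2 * ‖Kb y‖ ^ 2 ≤ γ * κ * ‖y‖ ^ 2 :=
    calc γ ^ 2 * ‖Kb y‖ ^ 2 ≤ γ ^ 2 * (a * ‖y‖) ^ 2 := by gcongr; exact hv.op y
      _ = γ * (γ * a ^ 2) * ‖y‖ ^ 2 := by ring
      _ ≤ γ * κ * ‖y‖ ^ 2 := by gcongr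
  refine le_of_sq_le_sq ?_ (by positivity)
  rw [norm_sub_sq_real, norm_smul, mul_pow, inner_smul_right, Real.norm_eq_abs, sq_abs]
  calc ‖y‖ ^ 2 - 2 * (γ * inner ℝ y (Kb y)) + γ ^ 2 * ‖Kb y‖ ^ 2
      ≤ (1 - γ * κ) * ‖y‖ ^ 2 := by linarith
    _ ≤ (1 - γ * κ) * ‖y‖ ^ 2 + (γ * κ / 2 * ‖y‖) ^ 2 := le_add_of_nonneg_right (sq_nonneg _)
    _ = ((1 - γ * κ / 2) * ‖y‖) ^ 2 := by ring

variable [DecidableEq S]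

theorem LinField.norm_ev_mlmc_sub_le (hv : LinField M π v Kb xs a B κ) (hM : M.Ergodic)
    (hτ : M.mixTime π ≤ τ) (hT : Tmax ≠ 0) (x : S × V) :
    ‖ev (sampleLaw M π Tmax x.1) (fun w => mlmc Tmax (v x.2) w.2 w.1) - Kb (x.2 - xs)‖ ≤
      8 * τ / Tmax * (a * ‖x.2 - xs‖ + B) := by
  rw [← hv.mean]
  exact hM.norm_ev_mlmc_sub_le hτ (hv.noise_nonneg _) (hv.bound x.2) hT x.1

theorem LinField.le_inner_ev_mlmc (hv : LinField M π v Kb xs a B κ) (hM : M.Ergodic)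
    (hτ : M.mixTime π ≤ τ) (hT : Tmax ≠ 0) (x : S × V) :
    κ * ‖x.2 - xs‖ ^ 2 - ‖x.2 - xs‖ * (8 * τ / Tmax * (a * ‖x.2 - xs‖ + B)) ≤
      inner ℝ (x.2 - xs)
        (ev (sampleLaw M π Tmax x.1) fun w => mlmc Tmax (v x.2) w.2 w.1) := by
  set m := ev (sampleLaw M π Tmax x.1) fun w => mlmc Tmax (v x.2) w.2 w.1
  have hsplit : inner ℝ (x.2 - xs) m = inner ℝ (x.2 - xs) (Kb (x.2 - xs)) +
      inner ℝ (x.2 - xs) (m - Kb (x.2 - xs)) := by rw [← inner_add_right, add_sub_cancel]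
  have hcs := abs_real_inner_le_norm (x.2 - xs) (m - Kb (x.2 - xs))
  have hbias := mul_le_mul_of_nonneg_left (hv.norm_ev_mlmc_sub_le hM hτ hT x)
    (norm_nonneg (x.2 - xs))
  linarith [neg_abs_le (inner ℝ (x.2 - xs) (m - Kb (x.2 - xs))), hv.coer (x.2 - xs)]

theorem ev_saStep_sq_le (hM : M.Ergodic) (hτ : M.mixTime π ≤ τ)
    (hv : LinField M π v Kb xs a B κ) (hγ : StepSmall τ Tmax γ a κ) (x : S × V) :
    ev (saStep M π Tmax γ v x) (fun y => ‖y.2 - xs‖ ^ 2) ≤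
      (1 - γ * κ) * ‖x.2 - xs‖ ^ 2 + γ * κ * (B ^ 2 / (2 * a ^ 2)) := by
  have ha := hv.a_pos
  have hB := hv.B_nonneg
  have hκ := hv.κ_pos
  have hγ0 := hγ.pos
  have hdrift := hv.le_inner_ev_mlmc hM hτ hγ.T_ne x
  have hvar := hM.ev_norm_mlmc_sq_le hτ (hv.noise_nonneg x.2) (hv.bound x.2) hγ.T_ne x.1
  rw [ev_saStep_norm_sub_sq]
  set m := ev (sampleLaw M π Tmax x.1) fun w => mlmc Tmax (v x.2) w.2 w.1
  set r := ‖x.2 - xs‖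
  have : 0 ≤ r := norm_nonneg _
  obtain ⟨y, hy0, rfl⟩ : ∃ y, 0 ≤ y ∧ B = a * y := ⟨B / a, by positivity, by field_simp⟩
  have hnoise : (a * y) ^ 2 / (2 * a ^ 2) = y ^ 2 / 2 := by field_simp
  rw [hnoise]
  have hbias : r * (8 * τ / Tmax * (a * r + a * y)) ≤ κ / 4 * (r * (r + y)) := by
    have h := mul_le_mul_of_nonneg_right (show 8 * τ / Tmax * a ≤ κ / 4 by linarith [hγ.bias])
      (show 0 ≤ r * (r + y) by positivity)
    linarith
  have hsecond : γ ^ 2 * ((2 + 12 * (4 + 16 * τ) * Nat.log 2 Tmax) * (a * r + a * y) ^ 2) ≤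
      γ * (κ / 8 * (r + y) ^ 2) := by
    have h := mul_le_mul_of_nonneg_left (mul_le_mul_of_nonneg_right
      (show γ * (2 + 12 * (4 + 16 * τ) * Nat.log 2 Tmax) * a ^ 2 ≤ κ / 8 by linarith [hγ.var])
      (show 0 ≤ (r + y) ^ 2 by positivity)) hγ0
    linarith
  have hvar' := mul_le_mul_of_nonneg_left hvar (sq_nonneg γ)
  have hdrift' := mul_le_mul_of_nonneg_left
    (show κ * r ^ 2 - κ / 4 * (r * (r + y)) ≤ inner ℝ (x.2 - xs) m by linarith)
    (show 0 ≤ 2 * γ by linarith)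
  have hsq : 0 ≤ γ * κ * (r - y) ^ 2 := by positivity
  linarith

theorem ev_saStep_iter_sq_le (hM : M.Ergodic) (hτ : M.mixTime π ≤ τ)
    (hv : LinField M π v Kb xs a B κ) (hγ : StepSmall τ Tmax γ a κ) (x : S × V) (n : ℕ) :
    ev (iterLaw (saStep M π Tmax γ v) n x) (fun y => ‖y.2 - xs‖ ^ 2) ≤
      ‖x.2 - xs‖ ^ 2 + B ^ 2 / (2 * a ^ 2) := by
  have hS := finSupp_saStep M π Tmax γ v
  have hc0 : 0 ≤ γ * κ := mul_nonneg hγ.pos hv.κ_pos.le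
  have ha := hv.a_pos
  have h := le_pow_mul_add_of_affine_rec (e := fun n =>
    ev (iterLaw (saStep M π Tmax γ v) n x) (fun y => ‖y.2 - xs‖ ^ 2)) hγ.le_one
    (show 0 ≤ B ^ 2 / (2 * a ^ 2) by positivity) (fun n => by
      have hI := finSupp_iterLaw hS n x
      change ev (iterLaw _ (n + 1) x) _ ≤ _
      rw [ev_iterLaw_succ hS]
      refine (hI.ev_mono fun y _ => ev_saStep_sq_le hM hτ hv hγ y).trans_eq ?_
      rw [hI.ev_add, hI.ev_const, hI.ev_mul]) n
  refine h.trans ?_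
  simp only [iterLaw, ev_pure]
  gcongr
  exact mul_le_of_le_one_left (sq_nonneg _) (pow_le_one₀ (by linarith [hγ.le_one]) (by linarith))

theorem norm_ev_saStep_sub_le (hM : M.Ergodic) (hτ : M.mixTime π ≤ τ)
    (hv : LinField M π v Kb xs a B κ) (hT : Tmax ≠ 0) (hγ : 0 ≤ γ) (y : S × V) :
    ‖ev (saStep M π Tmax γ v y) (fun y => y.2 - xs) - ((y.2 - xs) - γ • Kb (y.2 - xs))‖ ≤
      γ * (8 * τ / Tmax * (a * ‖y.2 - xs‖ + B)) := by
  have hF := finSupp_sampleLaw M π Tmax y.1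
  have hfactor : ∀ m : V, y.2 - γ • m - xs - (y.2 - xs - γ • Kb (y.2 - xs)) =
      -(γ • (m - Kb (y.2 - xs))) := fun m => by rw [smul_sub]; abel
  rw [saStep, hF.ev_map, hF.ev_sub, hF.ev_sub, hF.ev_const, hF.ev_const, hF.ev_smul, hfactor,
    norm_neg, norm_smul, Real.norm_of_nonneg hγ]
  exact mul_le_mul_of_nonneg_left (hv.norm_ev_mlmc_sub_le hM hτ hT y) hγ

/-- The mean itself contracts: `Kb` is linear, so it commutes with the expectation over the law `q`
of the current iterate, and only the bias of the estimator is left. -/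
theorem norm_ev_ev_saStep_sub_le (hM : M.Ergodic) (hτ : M.mixTime π ≤ τ)
    (hv : LinField M π v Kb xs a B κ) (hγ : StepSmall τ Tmax γ a κ) {q : PMF (S × V)}
    (hq : FinSupp q) :
    ‖ev q fun y => ev (saStep M π Tmax γ v y) fun y => y.2 - xs‖ ≤
      (1 - γ * κ / 2) * ‖ev q fun y => y.2 - xs‖ +
        γ * (8 * τ / Tmax * (a * (ev q fun y => ‖y.2 - xs‖) + B)) := by
  have hsplit : ev q (fun y => ev (saStep M π Tmax γ v y) fun y => y.2 - xs) =
      (ev q (fun y => y.2 - xs) - γ • Kb (ev q fun y => y.2 - xs)) +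
      ev q (fun y => ev (saStep M π Tmax γ v y) (fun y => y.2 - xs) -
        ((y.2 - xs) - γ • Kb (y.2 - xs))) := by
    rw [hq.map_ev, ← hq.ev_smul, ← hq.ev_sub, ← hq.ev_add]
    simp only [add_sub_cancel]
  rw [hsplit]
  refine (norm_add_le _ _).trans (add_le_add (hv.norm_sub_smul_le hγ _) ?_)
  refine (hq.norm_ev_le _).trans ((hq.ev_mono fun y _ =>
    norm_ev_saStep_sub_le hM hτ hv hγ.T_ne hγ.pos y).trans_eq ?_)
  rw [hq.ev_mul, hq.ev_mul, hq.ev_add, hq.ev_mul, hq.ev_const]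

theorem norm_ev_saStep_iter_sub_le (hM : M.Ergodic) (hτ : M.mixTime π ≤ τ)
    (hv : LinField M π v Kb xs a B κ) (hγ : StepSmall τ Tmax γ a κ) (x : S × V) (n : ℕ) :
    ‖ev (iterLaw (saStep M π Tmax γ v) n x) (fun y => y.2) - xs‖ ≤
      (1 - γ * κ / 2) ^ n * ‖x.2 - xs‖ +
        2 * (8 * τ / Tmax) / κ * (a * √(‖x.2 - xs‖ ^ 2 + B ^ 2 / (2 * a ^ 2)) + B) := by
  have hS := finSupp_saStep M π Tmax γ v
  have ha := hv.a_pos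
  have hB := hv.B_nonneg
  have hκ := hv.κ_pos
  have hγ0 := hγ.pos
  set R := √(‖x.2 - xs‖ ^ 2 + B ^ 2 / (2 * a ^ 2))
  have : 0 ≤ R := Real.sqrt_nonneg _
  have hrec : ∀ n, ‖ev (iterLaw (saStep M π Tmax γ v) (n + 1) x) fun y => y.2 - xs‖ ≤
      (1 - γ * κ / 2) * ‖ev (iterLaw (saStep M π Tmax γ v) n x) fun y => y.2 - xs‖ +
        γ * κ / 2 * (2 * (8 * τ / Tmax) / κ * (a * R + B)) := by
    intro n
    have hI := finSupp_iterLaw hS n x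
    have hR : ev (iterLaw (saStep M π Tmax γ v) n x) (fun y => ‖y.2 - xs‖) ≤ R :=
      (hI.ev_le_sqrt _).trans (Real.sqrt_le_sqrt (ev_saStep_iter_sq_le hM hτ hv hγ x n))
    rw [ev_iterLaw_succ hS]
    calc _ ≤ _ := norm_ev_ev_saStep_sub_le hM hτ hv hγ hI
      _ ≤ _ := add_le_add_right (show _ ≤ γ * (8 * τ / Tmax * (a * R + B)) by gcongr) _
      _ = _ := by field_simp
  have h := le_pow_mul_add_of_affine_rec (c := γ * κ / 2)
    (e := fun n => ‖ev (iterLaw (saStep M π Tmax γ v) n x) fun y => y.2 - xs‖)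
    (by linarith [hγ.le_one]) (by positivity) hrec n
  simp only [iterLaw, ev_pure] at h
  have hI := finSupp_iterLaw hS n x
  rwa [hI.ev_sub, hI.ev_const] at h

end StochasticApproximation

section Linearity

variable {S A X Y : Type*} [AddCommGroup X] [Module ℝ X] [AddCommGroup Y] [Module ℝ Y]

theorem levelAvg_map (L : X →ₗ[ℝ] Y) (v : S × A × S → X)
    (zs : List (S × A × S)) (j : ℕ) : L (levelAvg v zs j) = levelAvg (fun z => L (v z)) zs j := by
  simp only [levelAvg, map_smul, map_list_sum, List.map_map]
  rfl

theorem mlmc_map (L : X →ₗ[ℝ] Y) (Tmax : ℕ) (v : S × A × S → X)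
    (zs : List (S × A × S)) (q : ℕ) : L (mlmc Tmax v zs q) = mlmc Tmax (fun z => L (v z)) zs q := by
  simp only [mlmc, map_add, levelAvg_map]
  split_ifs <;> simp only [map_smul, map_sub, map_zero, levelAvg_map]

theorem mlmc_congr_level {Tmax q q' : ℕ}
    (h : ¬ 2 ^ q ≤ Tmax) (h' : ¬ 2 ^ q' ≤ Tmax) (v : S × A × S → X) (zs : List (S × A × S)) :
    mlmc Tmax v zs q = mlmc Tmax v zs q' := by
  simp only [mlmc, if_neg h, if_neg h']

theorem meanZ_map [Fintype S] [Fintype A] {d : ℕ} (L : X →ₗ[ℝ] Y) (M : CMDP S A)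
    (π : E d → Policy S A) (θ : E d) (f : S × A × S → X) :
    L (meanZ M π θ f) = meanZ M π θ fun z => L (f z) := by
  simp only [meanZ, map_sum, map_smul]

end Linearity

section StationaryLaw

variable {S A V : Type*} [Fintype S] [Fintype A] [NormedAddCommGroup V]

/-- The stationary distribution as a discrete law. -/
def statPMF (M : CMDP S A) (π : Policy S A) : PMF S :=
  Classical.choose (exists_prob_eq (M.statDist π) (M.isStationaryLaw_statDist π).1
    (M.isStationaryLaw_statDist π).2.1)

theorem prob_statPMF (M : CMDP S A) (π : Policy S A) (s : S) :
    prob (statPMF M π) s = M.statDist π s :=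
  Classical.choose_spec (exists_prob_eq (M.statDist π) (M.isStationaryLaw_statDist π).1
    (M.isStationaryLaw_statDist π).2.1) s

/-- The stationary law of a transition `(s, a, s')`, so that stationary means are expectations. -/
def statLaw (M : CMDP S A) (π : Policy S A) : PMF (S × A × S) :=
  (statPMF M π).bind (stepLaw M π)

theorem finSupp_statLaw (M : CMDP S A) (π : Policy S A) : FinSupp (statLaw M π) :=
  (finSupp_of_finite _).bind (finSupp_stepLaw M π)

variable [NormedSpace ℝ V]

theorem ev_statPMF (M : CMDP S A) (π : Policy S A) (f : S → V) :
    ev (statPMF M π) f = ∑ s, M.statDist π s • f s := by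
  rw [ev_eq_sum_univ]
  simp_rw [prob_statPMF]

theorem statMean_eq_ev (M : CMDP S A) (π : Policy S A) (v : S × A × S → V) :
    statMean M π v = ev (statLaw M π) v := by
  rw [statLaw, (finSupp_of_finite _).ev_bind (finSupp_stepLaw M π), ev_statPMF]
  rfl

theorem ev_statLaw_fst (M : CMDP S A) (π : Policy S A) (f : S → V) :
    ev (statLaw M π) (fun z => f z.1) = ∑ s, M.statDist π s • f s := by
  rw [← statMean_eq_ev, statMean]
  refine Finset.sum_congr rfl fun s _ => ?_
  rw [ev_stepLaw]
  simp_rw [← Finset.sum_smul, sum_prob, one_smul, ← Finset.sum_smul, sum_prob, one_smul]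

theorem ev_statLaw_next (M : CMDP S A) (π : Policy S A) (f : S → V) :
    ev (statLaw M π) (fun z => f z.2.2) = ∑ s, M.statDist π s • f s := by
  rw [← statMean_eq_ev, statMean]
  simp_rw [ev_stepLaw_next]
  exact (M.isStationaryLaw_statDist π).sum_act f

theorem ev_statLaw_eq (M : CMDP S A) (π : Policy S A) (v : S × A × S → V) :
    ev (statLaw M π) v =
      ∑ s, ∑ a, M.occ π s a • ∑ s', prob (M.P s a) s' • v (s, a, s') := by
  rw [← statMean_eq_ev, statMean]
  simp_rw [ev_stepLaw, Finset.smul_sum, smul_smul, CMDP.occ, mul_assoc]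

theorem sum_occ_eq_ev (M : CMDP S A) (π : Policy S A) (f : S → A → V) :
    ∑ s, ∑ a, M.occ π s a • f s a = ev (statLaw M π) fun z => f z.1 z.2.1 := by
  rw [ev_statLaw_eq]
  simp_rw [← Finset.sum_smul, sum_prob, one_smul]

theorem CMDP.Ergodic.ev_statLaw_sig [DecidableEq S] {M : CMDP S A} (hM : M.Ergodic)
    (π : Policy S A) (g : Sig) :
    ev (statLaw M π) (fun z => M.sig g z.1 z.2.1) = M.J g π := by
  rw [hM.J_eq_statDist, ← sum_occ_eq_ev M π (M.sig g)]
  simp only [CMDP.occ, CMDP.sigBar, smul_eq_mul, mul_assoc, Finset.mul_sum]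

/-- The stationary mean of a field `k` of linear maps: the linear part of the mean of an affine
field of stochastic approximation. -/
def meanOp (M : CMDP S A) (π : Policy S A) (k : S × A × S → V →ₗ[ℝ] V) : V →ₗ[ℝ] V where
  toFun x := ev (statLaw M π) fun z => k z x
  map_add' x y := by simp_rw [map_add]; exact (finSupp_statLaw M π).ev_add _ _
  map_smul' c x := by simp_rw [map_smul]; exact (finSupp_statLaw M π).ev_smul _ _

end StationaryLaw

section Affine

variable {S A V : Type*} [NormedAddCommGroup V] [InnerProductSpace ℝ V]

theorem norm_le_of_coercive {K : V →ₗ[ℝ] V} {κ : ℝ} (hκ : 0 < κ)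
    (h : ∀ x, κ * ‖x‖ ^ 2 ≤ inner ℝ x (K x)) (x : V) : ‖x‖ ≤ ‖K x‖ / κ := by
  rw [le_div_iff₀ hκ]
  rcases (norm_nonneg x).eq_or_lt with h0 | h0
  · rw [← h0, zero_mul]; exact norm_nonneg _
  · have h1 := (h x).trans (real_inner_le_norm x (K x))
    have h2 : ‖x‖ * (‖x‖ * κ) ≤ ‖x‖ * ‖K x‖ := by linarith
    exact le_of_mul_le_mul_left h2 h0

theorem injective_of_coercive {K : V →ₗ[ℝ] V} {κ : ℝ} (hκ : 0 < κ)
    (h : ∀ x, κ * ‖x‖ ^ 2 ≤ inner ℝ x (K x)) : Function.Injective K := by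
  rw [injective_iff_map_eq_zero]
  intro x hx
  have := norm_le_of_coercive hκ h x
  rw [hx, norm_zero, zero_div] at this
  exact norm_le_zero_iff.1 this

theorem one_sub_half_pow_le_inv_sqrt {c T : ℝ} {H : ℕ} (hc : c ≤ 1) (hT : 0 < T)
    (hH : Real.log T ≤ c * H) : (1 - c / 2) ^ H ≤ 1 / √T :=
  calc (1 - c / 2) ^ H ≤ Real.exp (-(c / 2)) ^ H :=
        pow_le_pow_left₀ (by linarith) (by linarith [Real.add_one_le_exp (-(c / 2))]) H
    _ ≤ Real.exp (-Real.log √T) := by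
        rw [← Real.exp_nat_mul, Real.exp_le_exp, Real.log_sqrt hT.le]
        linarith
    _ = 1 / √T := by rw [Real.exp_neg, Real.exp_log (Real.sqrt_pos.2 hT), one_div]

variable [Fintype S] [Fintype A] {M : CMDP S A} {π : Policy S A}

theorem inner_meanOp (M : CMDP S A) (π : Policy S A) (k : S × A × S → V →ₗ[ℝ] V) (x y : V) :
    inner ℝ y (meanOp M π k x) = ev (statLaw M π) fun z => inner ℝ y (k z x) :=
  (finSupp_statLaw M π).map_ev (innerₗ V y) fun z => k z x

/-- The affine field `x ↦ k z x - b z` has growth constant `a`, offset bounded by `B`, and a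
`κ`-coercive stationary mean, which vanishes at `xs`. -/
structure AffineField (M : CMDP S A) (π : Policy S A) (k : S × A × S → V →ₗ[ℝ] V)
    (b : S × A × S → V) (xs : V) (a B κ : ℝ) : Prop where
  a_pos : 0 < a
  B_nonneg : 0 ≤ B
  κ_pos : 0 < κ
  norm_lin_le : ∀ z x, ‖k z x‖ ≤ a * ‖x‖
  norm_offset_le : ∀ z, ‖b z‖ ≤ B
  coercive : ∀ x, κ * ‖x‖ ^ 2 ≤ inner ℝ x (meanOp M π k x)
  zero : meanOp M π k xs = ev (statLaw M π) b

/-- The constant in the mean square bound for stochastic approximation, in units of the squared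
offset bound. -/
def saVar (a κ : ℝ) : ℝ := 1 / κ ^ 2 + (a / κ + 1) ^ 2 / (2 * a ^ 2)

/-- The constant in the second moment bound for stochastic approximation, in units of the squared
offset bound. -/
def saMom (a κ : ℝ) : ℝ := 2 * saVar a κ + 2 / κ ^ 2

/-- The constant in the bias bound for stochastic approximation, in units of the offset bound. -/
def saBias (a κ : ℝ) : ℝ := 1 / κ + 16 / κ * (a * √(saVar a κ) + (a / κ + 1))

theorem saVar_nonneg (a κ : ℝ) : 0 ≤ saVar a κ := by unfold saVar; positivity

theorem saMom_nonneg (a κ : ℝ) : 0 ≤ saMom a κ := by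
  have := saVar_nonneg a κ
  unfold saMom; positivity

theorem saBias_nonneg {a κ : ℝ} (ha : 0 < a) (hκ : 0 < κ) : 0 ≤ saBias a κ := by
  unfold saBias; positivity

variable {k : S × A × S → V →ₗ[ℝ] V} {b : S × A × S → V} {xs : V} {a B κ γ : ℝ} {τ Tmax : ℕ}

theorem AffineField.norm_zero_le (h : AffineField M π k b xs a B κ) : ‖xs‖ ≤ B / κ := by
  refine (norm_le_of_coercive h.κ_pos h.coercive xs).trans ?_
  rw [h.zero]
  exact div_le_div_of_nonneg_right ((finSupp_statLaw M π).norm_ev_le_of_le h.norm_offset_le)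
    h.κ_pos.le

theorem AffineField.linField (h : AffineField M π k b xs a B κ) :
    LinField M π (fun x z => k z x - b z) (meanOp M π k) xs a ((a / κ + 1) * B) κ where
  a_pos := h.a_pos
  B_nonneg := by have := h.a_pos; have := h.B_nonneg; have := h.κ_pos; positivity
  κ_pos := h.κ_pos
  bound x z :=
    calc ‖k z x - b z‖ ≤ a * ‖x‖ + B :=
          (norm_sub_le _ _).trans (add_le_add (h.norm_lin_le z x) (h.norm_offset_le z))
      _ ≤ a * (‖x - xs‖ + B / κ) + B := by
          have hx : ‖x‖ ≤ ‖x - xs‖ + B / κ :=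
            (norm_le_norm_sub_add x xs).trans (add_le_add_right h.norm_zero_le _)
          have := h.a_pos
          gcongr
      _ = a * ‖x - xs‖ + (a / κ + 1) * B := by ring
  mean x := by
    rw [statMean_eq_ev, (finSupp_statLaw M π).ev_sub, map_sub, h.zero]
    rfl
  coer := h.coercive
  op x := (finSupp_statLaw M π).norm_ev_le_of_le fun z => h.norm_lin_le z x

theorem AffineField.zero_sub_sq_add_le (h : AffineField M π k b xs a B κ) :
    ‖(0 : V) - xs‖ ^ 2 + ((a / κ + 1) * B) ^ 2 / (2 * a ^ 2) ≤ saVar a κ * B ^ 2 := by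
  have hvar : saVar a κ * B ^ 2 = (B / κ) ^ 2 + ((a / κ + 1) * B) ^ 2 / (2 * a ^ 2) := by
    unfold saVar; ring
  rw [hvar, zero_sub, norm_neg]
  gcongr
  exact h.norm_zero_le

variable [DecidableEq S]

theorem AffineField.ev_iterLaw_saStep_sq_le (h : AffineField M π k b xs a B κ) (hM : M.Ergodic)
    (hτ : M.mixTime π ≤ τ) (hγ : StepSmall τ Tmax γ a κ) (H : ℕ) (s : S) :
    ev (iterLaw (saStep M π Tmax γ fun x z => k z x - b z) H (s, 0))
      (fun y => ‖y.2 - xs‖ ^ 2) ≤ saVar a κ * B ^ 2 :=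
  (ev_saStep_iter_sq_le hM hτ h.linField hγ (s, 0) H).trans h.zero_sub_sq_add_le

theorem AffineField.ev_iterLaw_saStep_norm_sq_le (h : AffineField M π k b xs a B κ)
    (hM : M.Ergodic) (hτ : M.mixTime π ≤ τ) (hγ : StepSmall τ Tmax γ a κ) (H : ℕ) (s : S) :
    ev (iterLaw (saStep M π Tmax γ fun x z => k z x - b z) H (s, 0)) (fun y => ‖y.2‖ ^ 2) ≤
      saMom a κ * B ^ 2 := by
  have hI := finSupp_iterLaw (finSupp_saStep M π Tmax γ fun x z => k z x - b z) H (s, (0 : V))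
  have hvar := h.ev_iterLaw_saStep_sq_le hM hτ hγ H s
  have hxs := pow_le_pow_left₀ (norm_nonneg _) h.norm_zero_le 2
  calc _ ≤ 2 * (saVar a κ * B ^ 2) + 2 * (B / κ) ^ 2 :=
        (hI.ev_norm_sq_le _ xs).trans (by linarith)
    _ = saMom a κ * B ^ 2 := by unfold saMom; ring

theorem AffineField.norm_ev_iterLaw_saStep_sub_le (h : AffineField M π k b xs a B κ)
    (hM : M.Ergodic) (hτ : M.mixTime π ≤ τ) (hτ1 : 1 ≤ τ) (hγ : StepSmall τ Tmax γ a κ) {H : ℕ}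
    (hH : Real.log Tmax ≤ γ * κ * H) (s : S) :
    ‖ev (iterLaw (saStep M π Tmax γ fun x z => k z x - b z) H (s, 0)) (fun y => y.2) - xs‖ ≤
      saBias a κ * τ / √Tmax * B := by
  have ha := h.a_pos
  have hB := h.B_nonneg
  have hκ := h.κ_pos
  have hT1 : (1 : ℝ) ≤ Tmax := by exact_mod_cast Nat.one_le_iff_ne_zero.2 hγ.T_ne
  have hT0 : (0 : ℝ) < Tmax := by linarith
  have : 0 < √(Tmax : ℝ) := Real.sqrt_pos.2 hT0
  have hs1 : √(Tmax : ℝ) ≤ Tmax := by rw [Real.sqrt_le_left hT0.le]; nlinarith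
  have hτ1' : (1 : ℝ) ≤ τ := by exact_mod_cast hτ1
  have hpow : (1 - γ * κ / 2) ^ H ≤ τ / √Tmax :=
    (one_sub_half_pow_le_inv_sqrt hγ.le_one hT0 hH).trans (by gcongr)
  have hx0 : ‖(0 : V) - xs‖ ≤ B / κ := by
    rw [zero_sub, norm_neg]
    exact h.norm_zero_le
  have hroot : √(‖(0 : V) - xs‖ ^ 2 + ((a / κ + 1) * B) ^ 2 / (2 * a ^ 2)) ≤
      √(saVar a κ) * B := by
    refine (Real.sqrt_le_sqrt h.zero_sub_sq_add_le).trans_eq ?_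
    rw [Real.sqrt_mul (saVar_nonneg a κ), Real.sqrt_sq hB]
  calc _ ≤ (1 - γ * κ / 2) ^ H * ‖(0 : V) - xs‖ + 2 * (8 * τ / Tmax) / κ *
        (a * √(‖(0 : V) - xs‖ ^ 2 + ((a / κ + 1) * B) ^ 2 / (2 * a ^ 2)) + (a / κ + 1) * B) :=
        norm_ev_saStep_iter_sub_le hM hτ h.linField hγ (s, 0) H
    _ ≤ τ / √Tmax * (B / κ) + 2 * (8 * τ / √Tmax) / κ *
        (a * (√(saVar a κ) * B) + (a / κ + 1) * B) := by gcongr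
    _ = saBias a κ * τ / √Tmax * B := by unfold saBias; ring

end Affine

section CriticAnalysis

variable {S A : Type*} {d m : ℕ}

/-- The Hilbert space of critic vectors `(η, ζ)`, with the Euclidean norm of the pair. -/
abbrev CriticSpace (m : ℕ) := WithLp 2 (ℝ × E m)

/-- The identification of critic vectors with elements of `CriticSpace`, which gives the critic a
norm and an inner product. -/
def critEmb : Critic m →ₗ[ℝ] CriticSpace m where
  toFun ξ := WithLp.toLp 2 (ξ (Sum.inl ()), WithLp.toLp 2 fun i => ξ (Sum.inr i))
  map_add' _ _ := rfl
  map_smul' _ _ := rfl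

theorem critEmb_fst (ξ : Critic m) : (critEmb ξ).fst = ξ (Sum.inl ()) := rfl

theorem critEmb_snd_apply (ξ : Critic m) (i : Fin m) : (critEmb ξ).snd i = ξ (Sum.inr i) := rfl

theorem critEmb_injective : Function.Injective (critEmb (m := m)) := by
  intro ξ ξ' h
  funext i
  rcases i with ⟨⟩ | i
  · exact congrArg (fun x : CriticSpace m => x.fst) h
  · exact congrArg (fun x : CriticSpace m => x.snd i) h

/-- The linear part `𝐀_g(z)` of the critic field, acting on `CriticSpace`. -/
def criticLin (φ : Sig → S → E m) (cγ : ℝ) (g : Sig) (z : S × A × S) :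
    CriticSpace m →ₗ[ℝ] CriticSpace m where
  toFun x := WithLp.toLp 2
    (cγ * x.fst, (x.fst + inner ℝ (φ g z.1 - φ g z.2.2) x.snd) • φ g z.1)
  map_add' x y := by
    refine (WithLp.equiv 2 _).injective (Prod.ext ?_ ?_)
    · exact mul_add _ _ _
    · change (x.fst + y.fst + inner ℝ _ (x.snd + y.snd)) • _ =
        (_ : ℝ) • φ g z.1 + (_ : ℝ) • φ g z.1
      rw [inner_add_right, ← add_smul, add_add_add_comm]
  map_smul' c x := by
    refine (WithLp.equiv 2 _).injective (Prod.ext ?_ ?_)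
    · exact mul_left_comm _ _ _
    · change (c * x.fst + inner ℝ _ (c • x.snd)) • _ = c • (_ • φ g z.1)
      rw [inner_smul_right, smul_smul, mul_add]

variable {M : CMDP S A}

/-- The offset `𝐛_g(z)` of the critic field, as an element of `CriticSpace`. -/
def criticOffset (M : CMDP S A) (φ : Sig → S → E m) (cγ : ℝ) (g : Sig) (z : S × A × S) :
    CriticSpace m :=
  WithLp.toLp 2 (cγ * M.sig g z.1 z.2.1, M.sig g z.1 z.2.1 • φ g z.1)

theorem inner_eq_sum (x y : E m) : inner ℝ x y = ∑ i, x i * y i := by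
  rw [PiLp.inner_apply]
  exact Finset.sum_congr rfl fun i _ => by simp [mul_comm]

theorem critEmb_mulVec (φ : Sig → S → E m) (cγ : ℝ) (g : Sig) (z : S × A × S) (ξ : Critic m) :
    critEmb (Matrix.mulVec (critA φ cγ g z) ξ) = criticLin φ cγ g z (critEmb ξ) := by
  apply (WithLp.equiv 2 _).injective
  refine Prod.ext ?_ ?_
  · change Matrix.mulVec (critA φ cγ g z) ξ (Sum.inl ()) = cγ * ξ (Sum.inl ())
    simp [Matrix.mulVec, dotProduct, critA]
  · ext i
    change Matrix.mulVec (critA φ cγ g z) ξ (Sum.inr i) =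
      (ξ (Sum.inl ()) + inner ℝ (φ g z.1 - φ g z.2.2) (critEmb ξ).snd) * φ g z.1 i
    rw [inner_eq_sum]
    simp only [Matrix.mulVec, dotProduct, critA, Fintype.sum_sum_type, Finset.univ_unique,
      Finset.sum_singleton, Matrix.fromBlocks_apply₂₁, Matrix.fromBlocks_apply₂₂, Matrix.of_apply,
      critEmb_snd_apply, PiLp.sub_apply, add_mul, Finset.sum_mul]
    congr 1
    · exact mul_comm _ _
    · exact Finset.sum_congr rfl fun j _ => by ring

theorem critEmb_critb (M : CMDP S A) (φ : Sig → S → E m) (cγ : ℝ) (g : Sig) (z : S × A × S) :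
    critEmb (critb M φ cγ g z) = criticOffset M φ cγ g z := rfl

theorem norm_sub_le_two {V : Type*} [SeminormedAddCommGroup V] {x y : V} (hx : ‖x‖ ≤ 1)
    (hy : ‖y‖ ≤ 1) : ‖x - y‖ ≤ 2 :=
  (norm_sub_le_of_le hx hy).trans_eq one_add_one_eq_two

theorem norm_criticLin_le {φ : Sig → S → E m} (hφ : ∀ g s, ‖φ g s‖ ≤ 1) {cγ : ℝ} (hc : 0 ≤ cγ)
    (g : Sig) (z : S × A × S) (x : CriticSpace m) :
    ‖criticLin φ cγ g z x‖ ≤ (cγ + 3) * ‖x‖ := by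
  have hcoef : ‖x.fst + inner ℝ (φ g z.1 - φ g z.2.2) x.snd‖ ≤ ‖x.fst‖ + 2 * ‖x.snd‖ := by
    refine (norm_add_le _ _).trans (add_le_add_right ((norm_inner_le_norm _ _).trans ?_) _)
    gcongr
    exact norm_sub_le_two (hφ g _) (hφ g _)
  have hsnd : ‖(x.fst + inner ℝ (φ g z.1 - φ g z.2.2) x.snd) • φ g z.1‖ ≤
      ‖x.fst‖ + 2 * ‖x.snd‖ := by
    rw [norm_smul]
    exact (mul_le_of_le_one_right (norm_nonneg _) (hφ g z.1)).trans hcoef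
  have hsnd_sq := pow_le_pow_left₀ (norm_nonneg _) hsnd 2
  refine le_of_sq_le_sq ?_ (by positivity)
  rw [mul_pow, WithLp.prod_norm_sq_eq_of_L2, WithLp.prod_norm_sq_eq_of_L2]
  change ‖cγ * x.fst‖ ^ 2 + ‖(x.fst + inner ℝ (φ g z.1 - φ g z.2.2) x.snd) • φ g z.1‖ ^ 2 ≤ _
  rw [norm_mul, Real.norm_of_nonneg hc]
  have : 0 ≤ cγ * (‖x.fst‖ ^ 2 + ‖x.snd‖ ^ 2) := by positivity
  have : 0 ≤ cγ ^ 2 * ‖x.snd‖ ^ 2 := by positivity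
  nlinarith [sq_nonneg ‖x.fst‖, sq_nonneg ‖x.snd‖, sq_nonneg (2 * ‖x.fst‖ - ‖x.snd‖)]

theorem norm_criticOffset_le {φ : Sig → S → E m} (hφ : ∀ g s, ‖φ g s‖ ≤ 1) {cγ : ℝ}
    (hc : 0 ≤ cγ) (g : Sig) (z : S × A × S) : ‖criticOffset M φ cγ g z‖ ≤ cγ + 1 := by
  have hsig := abs_sig_le M g z.1 z.2.1
  have hη : cγ * |M.sig g z.1 z.2.1| ≤ cγ := mul_le_of_le_one_right hc hsig
  have hζ : |M.sig g z.1 z.2.1| * ‖φ g z.1‖ ≤ 1 :=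
    mul_le_one₀ hsig (norm_nonneg _) (hφ g z.1)
  have hη_sq := pow_le_pow_left₀ (by positivity) hη 2
  have hζ_sq := pow_le_pow_left₀ (by positivity) hζ 2
  refine le_of_sq_le_sq ?_ (by positivity)
  rw [WithLp.prod_norm_sq_eq_of_L2]
  change ‖cγ * M.sig g z.1 z.2.1‖ ^ 2 + ‖M.sig g z.1 z.2.1 • φ g z.1‖ ^ 2 ≤ _
  rw [norm_mul, norm_smul, Real.norm_of_nonneg hc, Real.norm_eq_abs]
  nlinarith

theorem one_le_mul_two_mul_sub {lam cγ : ℝ} (hlam : 0 < lam)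
    (hcγ : lam + √(1 / lam ^ 2 - 1) ≤ cγ) : 1 ≤ lam * (2 * cγ - lam) := by
  rcases le_or_gt lam 1 with h | h
  · set u := √(1 / lam ^ 2 - 1)
    have hu : u ^ 2 = 1 / lam ^ 2 - 1 := by
      refine Real.sq_sqrt ?_
      rw [sub_nonneg, le_div_iff₀ (by positivity)]
      nlinarith
    have hw : (lam * u) ^ 2 = 1 - lam ^ 2 := by rw [mul_pow, hu]; field_simp
    have hw0 : 0 ≤ lam * u := mul_nonneg hlam.le (Real.sqrt_nonneg _)
    have hw1 : lam * u ≤ 1 := by nlinarith [sq_nonneg lam]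
    nlinarith [mul_le_mul_of_nonneg_left hcγ hlam.le]
  · have : lam ≤ cγ := by linarith [Real.sqrt_nonneg (1 / lam ^ 2 - 1)]
    nlinarith

theorem mul_sq_add_sq_le_of_le {lam cγ p r : ℝ} (hlam : 0 < lam)
    (hcγ : lam + √(1 / lam ^ 2 - 1) ≤ cγ) :
    lam / 2 * (p ^ 2 + r ^ 2) ≤ cγ * p ^ 2 - |p| * r + lam * r ^ 2 := by
  have hsq : 0 ≤ lam / 2 * (r - |p| / lam) ^ 2 := by positivity
  have hexpand : lam / 2 * (r - |p| / lam) ^ 2 =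
      lam / 2 * r ^ 2 - |p| * r + p ^ 2 / (2 * lam) := by
    rw [← sq_abs p]; field_simp; ring
  have hp : p ^ 2 / (2 * lam) ≤ (cγ - lam / 2) * p ^ 2 := by
    rw [div_le_iff₀ (by positivity)]
    nlinarith [mul_le_mul_of_nonneg_left (one_le_mul_two_mul_sub hlam hcγ) (sq_nonneg p)]
  linarith

theorem inner_criticLin (φ : Sig → S → E m) (cγ : ℝ) (g : Sig) (x : CriticSpace m)
    (z : S × A × S) :
    inner ℝ x (criticLin φ cγ g z x) = cγ * x.fst ^ 2 + (x.fst * inner ℝ x.snd (φ g z.1) +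
      inner ℝ x.snd (φ g z.1) * inner ℝ (φ g z.1 - φ g z.2.2) x.snd) := by
  rw [WithLp.prod_inner_apply]
  change inner ℝ x.fst (cγ * x.fst) +
    inner ℝ x.snd ((x.fst + inner ℝ (φ g z.1 - φ g z.2.2) x.snd) • φ g z.1) = _
  rw [inner_smul_right]
  simp only [RCLike.inner_apply, conj_trivial]
  ring

theorem criticStep_eq (M : CMDP S A) (π : E d → Policy S A) (φ : Sig → S → E m) {p : Params}
    (hT : p.Tmax ≠ 0) (θ : E d) (x : S × (Sig → Critic m)) :
    criticStep M π φ p θ x = (sampleLaw M (π θ) p.Tmax x.1).map fun w =>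
      (finalState x.1 w.2, fun g => x.2 g - p.γξ • mlmc p.Tmax (fun z =>
        Matrix.mulVec (critA φ p.cγ g z) (x.2 g) - critb M φ p.cγ g z) w.2 w.1) := by
  refine geomHalf_bind_rollout M (π θ) hT x.1 (fun q zs => (finalState x.1 zs,
    fun g => x.2 g - p.γξ • mlmc p.Tmax (fun z =>
        Matrix.mulVec (critA φ p.cγ g z) (x.2 g) - critb M φ p.cγ g z) zs q)) ?_
  intro q q' h h'
  funext zs
  simp only [mlmc_congr_level h h']

theorem criticStep_map (M : CMDP S A) (π : E d → Policy S A) (φ : Sig → S → E m) {p : Params}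
    (hT : p.Tmax ≠ 0) (θ : E d) (g : Sig) (x : S × (Sig → Critic m)) :
    (criticStep M π φ p θ x).map (fun y => (y.1, critEmb (y.2 g))) =
      saStep M (π θ) p.Tmax p.γξ (fun y z => criticLin φ p.cγ g z y - criticOffset M φ p.cγ g z)
        (x.1, critEmb (x.2 g)) := by
  rw [criticStep_eq M π φ hT, PMF.map_comp, saStep]
  congr 1
  funext w
  simp only [Function.comp, map_sub, map_smul, mlmc_map, critEmb_mulVec, critEmb_critb]

section Finite

variable [Finite S] [Finite A]

theorem finSupp_criticStep (M : CMDP S A) (π : E d → Policy S A) (φ : Sig → S → E m) {p : Params}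
    (hT : p.Tmax ≠ 0) (θ : E d) (x : S × (Sig → Critic m)) :
    FinSupp (criticStep M π φ p θ x) := by
  rw [criticStep_eq M π φ hT]
  exact (finSupp_sampleLaw _ _ _ _).map _

theorem ev_iterLaw_criticStep {V : Type*} [NormedAddCommGroup V] [NormedSpace ℝ V]
    (M : CMDP S A) (π : E d → Policy S A) (φ : Sig → S → E m) {p : Params} (hT : p.Tmax ≠ 0)
    (θ : E d) (g : Sig) (n : ℕ) (s : S) (f : CriticSpace m → V) :
    ev (iterLaw (criticStep M π φ p θ) n (s, 0)) (fun y => f (critEmb (y.2 g))) =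
      ev (iterLaw (saStep M (π θ) p.Tmax p.γξ fun y z =>
        criticLin φ p.cγ g z y - criticOffset M φ p.cγ g z) n (s, 0)) fun y => f y.2 := by
  have hmap := iterLaw_map (criticStep_map M π φ hT θ g) n (s, 0)
  have hzero : critEmb ((0 : Sig → Critic m) g) = 0 := map_zero _
  simp only [hzero] at hmap
  rw [← hmap, (finSupp_iterLaw (finSupp_criticStep M π φ hT θ) n (s, 0)).ev_map]

end Finite

variable [Fintype S] [Fintype A]

/-- The hypotheses under which the stationary mean of the critic field is coercive, with constant
`lam / 2`. -/
structure CriticWellPosed (M : CMDP S A) (π : E d → Policy S A) (φ : Sig → S → E m)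
    (lam cγ : ℝ) : Prop where
  norm_feat_le : ∀ g s, ‖φ g s‖ ≤ 1
  lam_pos : 0 < lam
  cγ_ge : lam + √(1 / lam ^ 2 - 1) ≤ cγ
  posDef : CriticPosDef M π φ lam

variable {π : E d → Policy S A} {φ : Sig → S → E m} {lam cγ : ℝ}

theorem CriticWellPosed.cγ_pos (h : CriticWellPosed M π φ lam cγ) : 0 < cγ := by
  linarith [Real.sqrt_nonneg (1 / lam ^ 2 - 1), h.cγ_ge, h.lam_pos]

theorem CriticWellPosed.coercive (h : CriticWellPosed M π φ lam cγ) (g : Sig) (θ : E d)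
    (x : CriticSpace m) :
    lam / 2 * ‖x‖ ^ 2 ≤ inner ℝ x (meanOp M (π θ) (criticLin φ cγ g) x) := by
  have hF := finSupp_statLaw M (π θ)
  have hpd := h.posDef g θ x.snd
  rw [meanZ_eq_statMean, statMean_eq_ev] at hpd
  have hcross : -(|x.fst| * ‖x.snd‖) ≤
      ev (statLaw M (π θ)) fun z => x.fst * inner ℝ x.snd (φ g z.1) := by
    rw [← hF.ev_const (-(|x.fst| * ‖x.snd‖))]
    refine hF.ev_mono fun z _ => neg_le_of_abs_le ?_
    rw [abs_mul]
    gcongr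
    exact (abs_real_inner_le_norm _ _).trans
      (mul_le_of_le_one_right (norm_nonneg _) (h.norm_feat_le g z.1))
  have hquad := mul_sq_add_sq_le_of_le (p := x.fst) (r := ‖x.snd‖) h.lam_pos h.cγ_ge
  rw [inner_meanOp, WithLp.prod_norm_sq_eq_of_L2, Real.norm_eq_abs, sq_abs]
  simp_rw [inner_criticLin]
  rw [hF.ev_add, hF.ev_add, hF.ev_const]
  linarith

theorem critEmb_meanZ_mulVec (M : CMDP S A) (π : E d → Policy S A) (φ : Sig → S → E m)
    (cγ : ℝ) (g : Sig) (θ : E d) (ξ : Critic m) :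
    critEmb (Matrix.mulVec (meanZ M π θ (critA φ cγ g)) ξ) =
      meanOp M (π θ) (criticLin φ cγ g) (critEmb ξ) := by
  let L : Matrix (Unit ⊕ Fin m) (Unit ⊕ Fin m) ℝ →ₗ[ℝ] CriticSpace m :=
    { toFun := fun X => critEmb (Matrix.mulVec X ξ)
      map_add' := fun X Y => by rw [Matrix.add_mulVec, map_add]
      map_smul' := fun c X => by rw [Matrix.smul_mulVec, map_smul]; rfl }
  change L _ = _
  rw [meanZ_map, meanZ_eq_statMean, statMean_eq_ev]
  change ev _ (fun z => critEmb (Matrix.mulVec (critA φ cγ g z) ξ)) = ev _ _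
  simp_rw [critEmb_mulVec]

theorem CriticWellPosed.meanOp_xiStar (h : CriticWellPosed M π φ lam cγ) (g : Sig) (θ : E d) :
    meanOp M (π θ) (criticLin φ cγ g) (critEmb (xiStar M π φ cγ g θ)) =
      ev (statLaw M (π θ)) (criticOffset M φ cγ g) := by
  have hinj : Function.Injective (Matrix.mulVec (meanZ M π θ (critA φ cγ g))) := by
    intro ξ ξ' hξ
    refine critEmb_injective (injective_of_coercive (half_pos h.lam_pos) (h.coercive g θ) ?_)
    rw [← critEmb_meanZ_mulVec, ← critEmb_meanZ_mulVec, hξ]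
  have hu : IsUnit (meanZ M π θ (critA φ cγ g)).det :=
    (Matrix.isUnit_iff_isUnit_det _).1 (Matrix.mulVec_injective_iff_isUnit.1 hinj)
  rw [← critEmb_meanZ_mulVec, xiStar, Matrix.mulVec_mulVec, Matrix.mul_nonsing_inv _ hu,
    Matrix.one_mulVec, meanZ_map, meanZ_eq_statMean, statMean_eq_ev]
  rfl

theorem CriticWellPosed.xiStar_inl [DecidableEq S] (h : CriticWellPosed M π φ lam cγ)
    (hM : M.Ergodic) (g : Sig) (θ : E d) : xiStar M π φ cγ g θ (Sum.inl ()) = M.J g (π θ) := by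
  have hF := finSupp_statLaw M (π θ)
  let η := WithLp.fstₗ 2 ℝ ℝ (E m)
  have hlin : η (meanOp M (π θ) (criticLin φ cγ g) (critEmb (xiStar M π φ cγ g θ))) =
      ev (statLaw M (π θ)) fun _ => cγ * xiStar M π φ cγ g θ (Sum.inl ()) :=
    hF.map_ev η _
  have hoff : η (ev (statLaw M (π θ)) (criticOffset M φ cγ g)) =
      ev (statLaw M (π θ)) fun z => cγ * M.sig g z.1 z.2.1 :=
    hF.map_ev η _
  rw [h.meanOp_xiStar, hoff, hF.ev_const, hF.ev_mul, hM.ev_statLaw_sig] at hlin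
  exact (mul_left_cancel₀ h.cγ_pos.ne' hlin).symm

theorem CriticWellPosed.affineField (h : CriticWellPosed M π φ lam cγ) (g : Sig) (θ : E d) :
    AffineField M (π θ) (criticLin φ cγ g) (criticOffset M φ cγ g)
      (critEmb (xiStar M π φ cγ g θ)) (cγ + 3) (cγ + 1) (lam / 2) where
  a_pos := by linarith [h.cγ_pos]
  B_nonneg := by linarith [h.cγ_pos]
  κ_pos := half_pos h.lam_pos
  norm_lin_le := norm_criticLin_le h.norm_feat_le h.cγ_pos.le g
  norm_offset_le := norm_criticOffset_le h.norm_feat_le h.cγ_pos.le g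
  coercive := h.coercive g θ
  zero := h.meanOp_xiStar g θ

/-- A bound for the second moment of the critic output. -/
def criticMom (lam cγ : ℝ) : ℝ := saMom (cγ + 3) (lam / 2) * (cγ + 1) ^ 2

/-- A bound for the bias of the critic output, in units of `1 / √Tmax`. -/
def criticBias (lam cγ : ℝ) (τ : ℕ) : ℝ := saBias (cγ + 3) (lam / 2) * τ * (cγ + 1)

theorem criticMom_nonneg (lam cγ : ℝ) : 0 ≤ criticMom lam cγ :=
  mul_nonneg (saMom_nonneg _ _) (sq_nonneg _)

theorem criticBias_nonneg {lam cγ : ℝ} (hlam : 0 < lam) (hc : 0 < cγ) (τ : ℕ) :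
    0 ≤ criticBias lam cγ τ := by
  have := saBias_nonneg (a := cγ + 3) (by positivity) (half_pos hlam)
  unfold criticBias; positivity

variable [DecidableEq S] {p : Params} {τ : ℕ} {θ : E d}

theorem CriticWellPosed.ev_norm_sq_le (h : CriticWellPosed M π φ lam p.cγ) (hM : M.Ergodic)
    (hτ : M.mixTime (π θ) ≤ τ) (hγ : StepSmall τ p.Tmax p.γξ (p.cγ + 3) (lam / 2)) (g : Sig)
    (s : S) :
    ev (iterLaw (criticStep M π φ p θ) p.H (s, 0)) (fun y => ‖critEmb (y.2 g)‖ ^ 2) ≤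
      criticMom lam p.cγ :=
  (ev_iterLaw_criticStep M π φ hγ.T_ne θ g p.H s fun x => ‖x‖ ^ 2).trans_le
    ((h.affineField g θ).ev_iterLaw_saStep_norm_sq_le hM hτ hγ p.H s)

theorem CriticWellPosed.norm_ev_sub_xiStar_le (h : CriticWellPosed M π φ lam p.cγ)
    (hM : M.Ergodic) (hτ : M.mixTime (π θ) ≤ τ) (hτ1 : 1 ≤ τ)
    (hγ : StepSmall τ p.Tmax p.γξ (p.cγ + 3) (lam / 2))
    (hH : Real.log p.Tmax ≤ p.γξ * (lam / 2) * p.H) (g : Sig) (s : S) :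
    ‖ev (iterLaw (criticStep M π φ p θ) p.H (s, 0)) (fun y => critEmb (y.2 g)) -
      critEmb (xiStar M π φ p.cγ g θ)‖ ≤ criticBias lam p.cγ τ / √p.Tmax := by
  rw [ev_iterLaw_criticStep M π φ hγ.T_ne θ g p.H s fun x => x]
  refine ((h.affineField g θ).norm_ev_iterLaw_saStep_sub_le hM hτ hτ1 hγ hH s).trans_eq ?_
  unfold criticBias; ring

end CriticAnalysis

section ActorAnalysis

variable {S A : Type*} {d m : ℕ}

/-- The score at a transition. -/
def scoreZ (π : E d → Policy S A) (θ : E d) (z : S × A × S) : E d := score π θ z.1 z.2.1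

/-- The linear part `ω ↦ ψψᵀω` of the actor field, with `ψ` the score at the transition. -/
def actorLin (π : E d → Policy S A) (θ : E d) (z : S × A × S) : E d →ₗ[ℝ] E d :=
  (innerₗ (E d) (scoreZ π θ z)).smulRight (scoreZ π θ z)

theorem actorLin_apply (π : E d → Policy S A) (θ : E d) (z : S × A × S) (x : E d) :
    actorLin π θ z x = inner ℝ (scoreZ π θ z) x • scoreZ π θ z := rfl

/-- The part of the temporal difference error that is linear in the critic vector. -/
def advLin (φ : Sig → S → E m) (g : Sig) (z : S × A × S) : CriticSpace m →ₗ[ℝ] ℝ :=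
  innerₗ (E m) (φ g z.2.2 - φ g z.1) ∘ₗ WithLp.sndₗ 2 ℝ ℝ (E m) - WithLp.fstₗ 2 ℝ ℝ (E m)

theorem advLin_apply (φ : Sig → S → E m) (g : Sig) (z : S × A × S) (x : CriticSpace m) :
    advLin φ g z x = inner ℝ (φ g z.2.2 - φ g z.1) x.snd - x.fst := rfl

theorem advEst_eq_sig_add (M : CMDP S A) (φ : Sig → S → E m) (g : Sig) (ξ : Critic m)
    (z : S × A × S) : advEst M φ g ξ z = M.sig g z.1 z.2.1 + advLin φ g z (critEmb ξ) := by
  simp only [advEst, advLin_apply, inner_eq_sum, critEmb_fst, critEmb_snd_apply, PiLp.sub_apply,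
    mul_comm (ξ _)]
  ring

theorem abs_advLin_le {φ : Sig → S → E m} (hφ : ∀ g s, ‖φ g s‖ ≤ 1) (g : Sig) (z : S × A × S)
    (x : CriticSpace m) : |advLin φ g z x| ≤ 3 * ‖x‖ :=
  calc |advLin φ g z x| ≤ ‖φ g z.2.2 - φ g z.1‖ * ‖x.snd‖ + ‖x.fst‖ := by
        rw [advLin_apply]
        exact (abs_sub _ _).trans (add_le_add (abs_real_inner_le_norm _ _) le_rfl)
    _ ≤ 2 * ‖x‖ + ‖x‖ := by
        gcongr
        · exact norm_sub_le_two (hφ g _) (hφ g _)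
        · exact WithLp.norm_snd_le _ x
        · exact WithLp.norm_fst_le _ x
    _ = 3 * ‖x‖ := by ring

variable {π : E d → Policy S A} {φ : Sig → S → E m} {G₁ G₂ μ : ℝ} {θ : E d}

theorem norm_scoreZ_le (hS : ScoreBounds π G₁ G₂) (θ : E d) (z : S × A × S) :
    ‖scoreZ π θ z‖ ≤ G₁ := hS.bound θ _ _

theorem norm_actorLin_le (hS : ScoreBounds π G₁ G₂) (θ : E d) (z : S × A × S) (x : E d) :
    ‖actorLin π θ z x‖ ≤ G₁ ^ 2 * ‖x‖ :=
  calc ‖actorLin π θ z x‖ ≤ ‖scoreZ π θ z‖ * ‖x‖ * ‖scoreZ π θ z‖ := by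
        rw [actorLin_apply, norm_smul]
        gcongr
        exact norm_inner_le_norm _ _
    _ = ‖scoreZ π θ z‖ ^ 2 * ‖x‖ := by ring
    _ ≤ G₁ ^ 2 * ‖x‖ := by
        gcongr
        exact norm_scoreZ_le hS θ z

theorem norm_advEst_smul_scoreZ_le {M : CMDP S A} (hφ : ∀ g s, ‖φ g s‖ ≤ 1)
    (hS : ScoreBounds π G₁ G₂) (g : Sig) (θ : E d) (ξ : Critic m) (z : S × A × S) :
    ‖advEst M φ g ξ z • scoreZ π θ z‖ ≤ G₁ * (1 + 3 * ‖critEmb ξ‖) := by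
  have hadv : |advEst M φ g ξ z| ≤ 1 + 3 * ‖critEmb ξ‖ := by
    rw [advEst_eq_sig_add]
    exact (abs_add_le _ _).trans (add_le_add (abs_sig_le M g _ _) (abs_advLin_le hφ g z _))
  rw [norm_smul, mul_comm]
  exact mul_le_mul (norm_scoreZ_le hS θ z) hadv (norm_nonneg _)
    ((norm_nonneg _).trans (norm_scoreZ_le hS θ z))

theorem actorStep_eq (M : CMDP S A) (π : E d → Policy S A) (φ : Sig → S → E m) {p : Params}
    (hT : p.Tmax ≠ 0) (θ : E d) (ξ : Sig → Critic m) (x : S × (Sig → E d)) :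
    actorStep M π φ p θ ξ x = (sampleLaw M (π θ) p.Tmax x.1).map fun w =>
      (finalState x.1 w.2, fun g => x.2 g - p.γω • mlmc p.Tmax
        (npgGrad M π φ θ g (ξ g) (x.2 g)) w.2 w.1) := by
  refine geomHalf_bind_rollout M (π θ) hT x.1 (fun q zs => (finalState x.1 zs,
    fun g => x.2 g - p.γω • mlmc p.Tmax (npgGrad M π φ θ g (ξ g) (x.2 g)) zs q)) ?_
  intro q q' h h'
  funext zs
  simp only [mlmc_congr_level h h']

theorem actorStep_map (M : CMDP S A) (π : E d → Policy S A) (φ : Sig → S → E m) {p : Params}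
    (hT : p.Tmax ≠ 0) (θ : E d) (ξ : Sig → Critic m) (g : Sig) (x : S × (Sig → E d)) :
    (actorStep M π φ p θ ξ x).map (fun y => (y.1, y.2 g)) =
      saStep M (π θ) p.Tmax p.γω
        (fun y z => actorLin π θ z y - advEst M φ g (ξ g) z • scoreZ π θ z) (x.1, x.2 g) := by
  rw [actorStep_eq M π φ hT, PMF.map_comp, saStep]
  rfl

section Finite

variable [Finite S] [Finite A]

theorem finSupp_actorStep (M : CMDP S A) (π : E d → Policy S A) (φ : Sig → S → E m) {p : Params}
    (hT : p.Tmax ≠ 0) (θ : E d) (ξ : Sig → Critic m) (x : S × (Sig → E d)) :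
    FinSupp (actorStep M π φ p θ ξ x) := by
  rw [actorStep_eq M π φ hT]
  exact (finSupp_sampleLaw _ _ _ _).map _

theorem ev_iterLaw_actorStep {V : Type*} [NormedAddCommGroup V] [NormedSpace ℝ V]
    (M : CMDP S A) (π : E d → Policy S A) (φ : Sig → S → E m) {p : Params} (hT : p.Tmax ≠ 0)
    (θ : E d) (ξ : Sig → Critic m) (g : Sig) (n : ℕ) (s : S) (f : E d → V) :
    ev (iterLaw (actorStep M π φ p θ ξ) n (s, 0)) (fun w => f (w.2 g)) =
      ev (iterLaw (saStep M (π θ) p.Tmax p.γω fun y z =>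
        actorLin π θ z y - advEst M φ g (ξ g) z • scoreZ π θ z) n (s, 0)) fun y => f y.2 := by
  have hmap := iterLaw_map (actorStep_map M π φ hT θ ξ g) n (s, 0)
  simp only [Pi.zero_apply] at hmap
  rw [← hmap, (finSupp_iterLaw (finSupp_actorStep M π φ hT θ ξ) n (s, 0)).ev_map]

end Finite

variable [Fintype S] [Fintype A] {M : CMDP S A}

theorem dotProduct_fisher_mulVec (M : CMDP S A) (π : E d → Policy S A) (θ x : E d) :
    (x : Fin d → ℝ) ⬝ᵥ Matrix.mulVec (fisher M π θ) x =
      inner ℝ x (meanOp M (π θ) (actorLin π θ) x) := by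
  simp only [inner_meanOp, actorLin_apply, inner_smul_right]
  refine Eq.trans ?_ (sum_occ_eq_ev M (π θ) fun s a =>
    inner ℝ (score π θ s a) x * inner ℝ x (score π θ s a))
  simp only [fisher, Matrix.sum_mulVec, Matrix.smul_mulVec, dotProduct_sum, dotProduct_smul,
    smul_eq_mul]
  refine Finset.sum_congr rfl fun s _ => Finset.sum_congr rfl fun a _ => ?_
  congr 1
  rw [Matrix.vecMulVec_mulVec, dotProduct_smul, op_smul_eq_smul, smul_eq_mul, inner_eq_sum,
    inner_eq_sum]
  rfl

theorem FisherNonDeg.coercive (hF : FisherNonDeg M π μ) (θ x : E d) :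
    μ * ‖x‖ ^ 2 ≤ inner ℝ x (meanOp M (π θ) (actorLin π θ) x) := by
  have hpos := (hF θ).dotProduct_mulVec_nonneg (x : Fin d → ℝ)
  have hnorm : ‖x‖ ^ 2 = (x : Fin d → ℝ) ⬝ᵥ (x : Fin d → ℝ) := by
    rw [← real_inner_self_eq_norm_sq, inner_eq_sum]; rfl
  rw [star_trivial, Matrix.sub_mulVec, dotProduct_sub, Matrix.smul_mulVec, Matrix.one_mulVec,
    dotProduct_smul, smul_eq_mul, ← hnorm, dotProduct_fisher_mulVec] at hpos
  linarith

/-- The policy gradient `𝔼_{ν^{π_θ}}[A_g^{π_θ} ψ_θ]`. -/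
def polGrad [DecidableEq S] (M : CMDP S A) (π : E d → Policy S A) (g : Sig) (θ : E d) : E d :=
  ev (statLaw M (π θ)) fun z => M.Adv g (π θ) z.1 z.2.1 • scoreZ π θ z

/-- The surrogate of the policy gradient in which the temporal difference error of the critic
vector `ξ` replaces the advantage. -/
def gradEst (M : CMDP S A) (π : E d → Policy S A) (φ : Sig → S → E m) (g : Sig) (θ : E d)
    (ξ : Critic m) : E d :=
  ev (statLaw M (π θ)) fun z => advEst M φ g ξ z • scoreZ π θ z

/-- `ω` is a natural policy gradient direction: it solves the normal equations
`F(θ) ω = 𝔼_{ν^{π_θ}}[A_g^{π_θ} ψ_θ]`. -/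
def IsNatGrad [DecidableEq S] (M : CMDP S A) (π : E d → Policy S A) (g : Sig) (θ ω : E d) : Prop :=
  meanOp M (π θ) (actorLin π θ) ω = polGrad M π g θ

/-- The linear part of `gradEst` as a function of the critic vector. -/
def gradLin (M : CMDP S A) (π : E d → Policy S A) (φ : Sig → S → E m) (g : Sig) (θ : E d) :
    CriticSpace m →ₗ[ℝ] E d where
  toFun x := ev (statLaw M (π θ)) fun z => advLin φ g z x • scoreZ π θ z
  map_add' x y := by
    simp_rw [map_add, add_smul]
    exact (finSupp_statLaw M (π θ)).ev_add _ _
  map_smul' c x := by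
    simp_rw [map_smul, smul_assoc]
    exact (finSupp_statLaw M (π θ)).ev_smul _ _

theorem gradEst_eq_add (M : CMDP S A) (π : E d → Policy S A) (φ : Sig → S → E m) (g : Sig)
    (θ : E d) (ξ : Critic m) :
    gradEst M π φ g θ ξ = ev (statLaw M (π θ)) (fun z => M.sig g z.1 z.2.1 • scoreZ π θ z) +
      gradLin M π φ g θ (critEmb ξ) := by
  simp only [gradEst, advEst_eq_sig_add, add_smul]
  exact (finSupp_statLaw M (π θ)).ev_add _ _

theorem norm_gradLin_le (hφ : ∀ g s, ‖φ g s‖ ≤ 1) (hS : ScoreBounds π G₁ G₂) (g : Sig)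
    (x : CriticSpace m) : ‖gradLin M π φ g θ x‖ ≤ 3 * G₁ * ‖x‖ := by
  refine (finSupp_statLaw M (π θ)).norm_ev_le_of_le fun z => ?_
  calc ‖advLin φ g z x • scoreZ π θ z‖ ≤ 3 * ‖x‖ * G₁ := by
        rw [norm_smul, Real.norm_eq_abs]
        gcongr
        · exact abs_advLin_le hφ g z x
        · exact norm_scoreZ_le hS θ z
    _ = 3 * G₁ * ‖x‖ := by ring

/-- The hypotheses under which the stationary mean of the actor field, which is the Fisher matrix,
is bounded and `μ`-coercive. -/
structure ActorWellPosed (M : CMDP S A) (π : E d → Policy S A) (G₁ G₂ μ : ℝ) : Prop where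
  score : ScoreBounds π G₁ G₂
  fisher : FisherNonDeg M π μ
  G₁_pos : 0 < G₁
  μ_pos : 0 < μ

/-- The map `ω ↦ F(θ) ω` as a linear equivalence. -/
def ActorWellPosed.fisherEquiv (h : ActorWellPosed M π G₁ G₂ μ) (θ : E d) : E d ≃ₗ[ℝ] E d :=
  LinearEquiv.ofInjectiveEndo (meanOp M (π θ) (actorLin π θ))
    (injective_of_coercive h.μ_pos (h.fisher.coercive θ))

theorem ActorWellPosed.meanOp_fisherEquiv_symm (h : ActorWellPosed M π G₁ G₂ μ) (θ v : E d) :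
    meanOp M (π θ) (actorLin π θ) ((h.fisherEquiv θ).symm v) = v :=
  (h.fisherEquiv θ).apply_symm_apply v

theorem ActorWellPosed.affineField (h : ActorWellPosed M π G₁ G₂ μ) (hφ : ∀ g s, ‖φ g s‖ ≤ 1)
    (g : Sig) (θ : E d) (ξ : Critic m) :
    AffineField M (π θ) (actorLin π θ) (fun z => advEst M φ g ξ z • scoreZ π θ z)
      ((h.fisherEquiv θ).symm (gradEst M π φ g θ ξ)) (G₁ ^ 2) (G₁ * (1 + 3 * ‖critEmb ξ‖)) μ where
  a_pos := pow_pos h.G₁_pos 2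
  B_nonneg := mul_nonneg h.G₁_pos.le (by positivity)
  κ_pos := h.μ_pos
  norm_lin_le := norm_actorLin_le h.score θ
  norm_offset_le := norm_advEst_smul_scoreZ_le hφ h.score g θ ξ
  coercive := h.fisher.coercive θ
  zero := h.meanOp_fisherEquiv_symm θ _

/-- A bound for the second moment of the actor output. -/
def actorMom (G₁ μ lam cγ : ℝ) : ℝ := saMom (G₁ ^ 2) μ * (G₁ ^ 2 * (2 + 18 * criticMom lam cγ))

/-- The constant in the bound for the bias of the actor output: the bias of the actor iteration,
the bias it inherits from the critic, and the error of the best critic. -/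
def actorBias (G₁ μ lam cγ : ℝ) (τ : ℕ) : ℝ :=
  saBias (G₁ ^ 2) μ * τ * (G₁ * (1 + 3 * √(criticMom lam cγ))) +
    3 * G₁ / μ * criticBias lam cγ τ + 2 * G₁ / μ

theorem actorMom_nonneg (G₁ μ lam cγ : ℝ) : 0 ≤ actorMom G₁ μ lam cγ := by
  have := saMom_nonneg (G₁ ^ 2) μ
  have := criticMom_nonneg lam cγ
  unfold actorMom; positivity

theorem actorBias_nonneg {G₁ μ lam cγ : ℝ} (hG : 0 < G₁) (hμ : 0 < μ) (hlam : 0 < lam)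
    (hc : 0 < cγ) (τ : ℕ) : 0 ≤ actorBias G₁ μ lam cγ τ := by
  have := saBias_nonneg (pow_pos hG 2) hμ
  have := criticBias_nonneg hlam hc τ
  unfold actorBias; positivity

variable [DecidableEq S] {p : Params} {τ : ℕ}

theorem ActorWellPosed.ev_norm_sq_le (h : ActorWellPosed M π G₁ G₂ μ)
    (hφ : ∀ g s, ‖φ g s‖ ≤ 1) (hM : M.Ergodic) (hτ : M.mixTime (π θ) ≤ τ)
    (hγ : StepSmall τ p.Tmax p.γω (G₁ ^ 2) μ) (ξ : Sig → Critic m) (g : Sig) (s : S) :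
    ev (iterLaw (actorStep M π φ p θ ξ) p.H (s, 0)) (fun w => ‖w.2 g‖ ^ 2) ≤
      saMom (G₁ ^ 2) μ * (G₁ * (1 + 3 * ‖critEmb (ξ g)‖)) ^ 2 :=
  (ev_iterLaw_actorStep M π φ hγ.T_ne θ ξ g p.H s fun x => ‖x‖ ^ 2).trans_le
    ((h.affineField hφ g θ (ξ g)).ev_iterLaw_saStep_norm_sq_le hM hτ hγ p.H s)

theorem ActorWellPosed.norm_ev_sub_le (h : ActorWellPosed M π G₁ G₂ μ)
    (hφ : ∀ g s, ‖φ g s‖ ≤ 1) (hM : M.Ergodic) (hτ : M.mixTime (π θ) ≤ τ) (hτ1 : 1 ≤ τ)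
    (hγ : StepSmall τ p.Tmax p.γω (G₁ ^ 2) μ) (hH : Real.log p.Tmax ≤ p.γω * μ * p.H)
    (ξ : Sig → Critic m) (g : Sig) (s : S) :
    ‖ev (iterLaw (actorStep M π φ p θ ξ) p.H (s, 0)) (fun w => w.2 g) -
      (h.fisherEquiv θ).symm (gradEst M π φ g θ (ξ g))‖ ≤
      saBias (G₁ ^ 2) μ * τ / √p.Tmax * (G₁ * (1 + 3 * ‖critEmb (ξ g)‖)) := by
  rw [ev_iterLaw_actorStep M π φ hγ.T_ne θ ξ g p.H s fun x => x]
  exact (h.affineField hφ g θ (ξ g)).norm_ev_iterLaw_saStep_sub_le hM hτ hτ1 hγ hH s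

/-- The inner loops of an epoch are well tuned: their step sizes are small, and they are long
enough to forget their starting point up to an error of order `1 / √Tmax`. -/
structure Tuned (G₁ μ lam : ℝ) (p : Params) (τ : ℕ) : Prop where
  critic_step : StepSmall τ p.Tmax p.γξ (p.cγ + 3) (lam / 2)
  critic_len : Real.log p.Tmax ≤ p.γξ * (lam / 2) * p.H
  actor_step : StepSmall τ p.Tmax p.γω (G₁ ^ 2) μ
  actor_len : Real.log p.Tmax ≤ p.γω * μ * p.H

/-- The standing assumptions of the analysis of one epoch; `τ` bounds the mixing times of the
class. -/
structure Setup (M : CMDP S A) (π : E d → Policy S A) (φ : Sig → S → E m) (p : Params)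
    (G₁ G₂ μ lam : ℝ) (τ : ℕ) : Prop extends CriticWellPosed M π φ lam p.cγ,
    ActorWellPosed M π G₁ G₂ μ, Tuned G₁ μ lam p τ where
  ergodic : M.Ergodic
  errFin : CriticErrFinite M π φ p.cγ
  mix : ∀ θ, M.mixTime (π θ) ≤ τ
  one_le : 1 ≤ τ

variable {lam : ℝ}

theorem Setup.finSupp_critic (h : Setup M π φ p G₁ G₂ μ lam τ) (θ : E d) (s : S) :
    FinSupp (iterLaw (criticStep M π φ p θ) p.H (s, 0)) :=
  finSupp_iterLaw (finSupp_criticStep M π φ h.critic_step.T_ne θ) p.H (s, 0)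

theorem Setup.finSupp_actor (h : Setup M π φ p G₁ G₂ μ lam τ) (θ : E d) (ξ : Sig → Critic m)
    (s : S) : FinSupp (iterLaw (actorStep M π φ p θ ξ) p.H (s, 0)) :=
  finSupp_iterLaw (finSupp_actorStep M π φ h.actor_step.T_ne θ ξ) p.H (s, 0)

/-- The joint law of the critic vectors and of the final state and actor vectors of an epoch at the
parameter `θ` that starts in the state `s`. -/
def innerLaw (M : CMDP S A) (π : E d → Policy S A) (φ : Sig → S → E m) (p : Params) (θ : E d)
    (s : S) : PMF ((Sig → Critic m) × S × (Sig → E d)) :=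
  (iterLaw (criticStep M π φ p θ) p.H (s, 0)).bind fun y =>
    (iterLaw (actorStep M π φ p θ y.2) p.H (y.1, 0)).map fun w => (y.2, w)

theorem Setup.finSupp_innerLaw (h : Setup M π φ p G₁ G₂ μ lam τ) (θ : E d) (s : S) :
    FinSupp (innerLaw M π φ p θ s) :=
  (h.finSupp_critic θ s).bind fun y => (h.finSupp_actor θ y.2 y.1).map _

theorem Setup.ev_innerLaw {V : Type*} [NormedAddCommGroup V] [NormedSpace ℝ V]
    (h : Setup M π φ p G₁ G₂ μ lam τ) (θ : E d) (s : S)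
    (f : (Sig → Critic m) × S × (Sig → E d) → V) :
    ev (innerLaw M π φ p θ s) f = ev (iterLaw (criticStep M π φ p θ) p.H (s, 0)) fun y =>
      ev (iterLaw (actorStep M π φ p θ y.2) p.H (y.1, 0)) fun w => f (y.2, w) := by
  rw [innerLaw, (h.finSupp_critic θ s).ev_bind fun y => (h.finSupp_actor θ y.2 y.1).map _]
  simp_rw [(h.finSupp_actor θ _ _).ev_map]

theorem Setup.ev_innerLaw_critic {V : Type*} [NormedAddCommGroup V] [NormedSpace ℝ V]
    (h : Setup M π φ p G₁ G₂ μ lam τ) (θ : E d) (s : S) (f : (Sig → Critic m) → V) :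
    ev (innerLaw M π φ p θ s) (fun y => f y.1) =
      ev (iterLaw (criticStep M π φ p θ) p.H (s, 0)) fun y => f y.2 := by
  simp_rw [h.ev_innerLaw, (h.finSupp_actor θ _ _).ev_const]

theorem Setup.ev_critic_sq_le (h : Setup M π φ p G₁ G₂ μ lam τ) (θ : E d) (g : Sig) (s : S) :
    ev (innerLaw M π φ p θ s) (fun y => ‖critEmb (y.1 g)‖ ^ 2) ≤ criticMom lam p.cγ :=
  (h.ev_innerLaw_critic θ s fun ξ => ‖critEmb (ξ g)‖ ^ 2).trans_le
    (h.toCriticWellPosed.ev_norm_sq_le h.ergodic (h.mix θ) h.critic_step g s)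

theorem Setup.ev_critic_norm_le (h : Setup M π φ p G₁ G₂ μ lam τ) (θ : E d) (g : Sig) (s : S) :
    ev (innerLaw M π φ p θ s) (fun y => ‖critEmb (y.1 g)‖) ≤ √(criticMom lam p.cγ) :=
  ((h.finSupp_innerLaw θ s).ev_le_sqrt _).trans (Real.sqrt_le_sqrt (h.ev_critic_sq_le θ g s))

theorem Setup.norm_ev_critic_sub_le (h : Setup M π φ p G₁ G₂ μ lam τ) (θ : E d) (g : Sig)
    (s : S) :
    ‖ev (innerLaw M π φ p θ s) (fun y => critEmb (y.1 g)) -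
      critEmb (xiStar M π φ p.cγ g θ)‖ ≤ criticBias lam p.cγ τ / √p.Tmax := by
  rw [h.ev_innerLaw_critic θ s fun ξ => critEmb (ξ g)]
  exact h.toCriticWellPosed.norm_ev_sub_xiStar_le h.ergodic (h.mix θ) h.one_le h.critic_step
    h.critic_len g s

theorem Setup.ev_actor_sq_le (h : Setup M π φ p G₁ G₂ μ lam τ) (θ : E d) (g : Sig) (s : S) :
    ev (innerLaw M π φ p θ s) (fun y => ‖y.2.2 g‖ ^ 2) ≤ actorMom G₁ μ lam p.cγ := by
  have hI := h.finSupp_innerLaw θ s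
  have hcond : ∀ y ∈ (iterLaw (criticStep M π φ p θ) p.H (s, 0)).support,
      ev (iterLaw (actorStep M π φ p θ y.2) p.H (y.1, 0)) (fun w => ‖w.2 g‖ ^ 2) ≤
        saMom (G₁ ^ 2) μ * (G₁ ^ 2 * (2 + 18 * ‖critEmb (y.2 g)‖ ^ 2)) := by
    intro y _
    refine (h.toActorWellPosed.ev_norm_sq_le h.norm_feat_le h.ergodic (h.mix θ) h.actor_step
      y.2 g y.1).trans (mul_le_mul_of_nonneg_left ?_ (saMom_nonneg _ _))
    rw [mul_pow]
    gcongr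
    linarith [sq_nonneg (1 - 3 * ‖critEmb (y.2 g)‖)]
  calc _ ≤ ev (innerLaw M π φ p θ s) fun y =>
        saMom (G₁ ^ 2) μ * (G₁ ^ 2 * (2 + 18 * ‖critEmb (y.1 g)‖ ^ 2)) := by
        rw [h.ev_innerLaw, h.ev_innerLaw_critic θ s fun ξ =>
          saMom (G₁ ^ 2) μ * (G₁ ^ 2 * (2 + 18 * ‖critEmb (ξ g)‖ ^ 2))]
        exact (h.finSupp_critic θ s).ev_mono hcond
    _ = saMom (G₁ ^ 2) μ * (G₁ ^ 2 *
          (2 + 18 * ev (innerLaw M π φ p θ s) fun y => ‖critEmb (y.1 g)‖ ^ 2)) := by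
        rw [hI.ev_mul, hI.ev_mul, hI.ev_add, hI.ev_const, hI.ev_mul]
    _ ≤ actorMom G₁ μ lam p.cγ := by
        have := saMom_nonneg (G₁ ^ 2) μ
        unfold actorMom
        gcongr
        exact h.ev_critic_sq_le θ g s

theorem Setup.norm_ev_actor_sub_le (h : Setup M π φ p G₁ G₂ μ lam τ) (θ : E d) (g : Sig) (s : S) :
    ‖ev (innerLaw M π φ p θ s) (fun y => y.2.2 g) - (h.fisherEquiv θ).symm
      (ev (innerLaw M π φ p θ s) fun y => gradEst M π φ g θ (y.1 g))‖ ≤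
      saBias (G₁ ^ 2) μ * τ / √p.Tmax * (G₁ * (1 + 3 * √(criticMom lam p.cγ))) := by
  have hC := h.finSupp_critic θ s
  have hI := h.finSupp_innerLaw θ s
  have hsa : 0 ≤ saBias (G₁ ^ 2) μ := saBias_nonneg (pow_pos h.G₁_pos 2) h.μ_pos
  have hG := h.G₁_pos
  have htarget : (h.fisherEquiv θ).symm
      (ev (innerLaw M π φ p θ s) fun y => gradEst M π φ g θ (y.1 g)) =
      ev (iterLaw (criticStep M π φ p θ) p.H (s, 0)) fun y =>
        (h.fisherEquiv θ).symm (gradEst M π φ g θ (y.2 g)) := by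
    rw [h.ev_innerLaw_critic θ s fun ξ => gradEst M π φ g θ (ξ g)]
    exact hC.map_ev (h.fisherEquiv θ).symm.toLinearMap _
  rw [htarget, h.ev_innerLaw, ← hC.ev_sub]
  calc _ ≤ ev (innerLaw M π φ p θ s) fun y =>
        saBias (G₁ ^ 2) μ * τ / √p.Tmax * (G₁ * (1 + 3 * ‖critEmb (y.1 g)‖)) := by
        rw [h.ev_innerLaw_critic θ s fun ξ =>
          saBias (G₁ ^ 2) μ * τ / √p.Tmax * (G₁ * (1 + 3 * ‖critEmb (ξ g)‖))]
        exact (hC.norm_ev_le _).trans (hC.ev_mono fun y _ =>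
          h.toActorWellPosed.norm_ev_sub_le h.norm_feat_le h.ergodic (h.mix θ) h.one_le
            h.actor_step h.actor_len y.2 g y.1)
    _ = saBias (G₁ ^ 2) μ * τ / √p.Tmax *
          (G₁ * (1 + 3 * ev (innerLaw M π φ p θ s) fun y => ‖critEmb (y.1 g)‖)) := by
        rw [hI.ev_mul, hI.ev_mul, hI.ev_add, hI.ev_const, hI.ev_mul]
    _ ≤ _ := by
        gcongr
        exact h.ev_critic_norm_le θ g s

theorem Setup.critErr_le (h : Setup M π φ p G₁ G₂ μ lam τ) (θ : E d) (g : Sig) :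
    critErr M π φ p.cγ g θ ≤ epsApp M π φ p.cγ := by
  cases g
  · exact (le_ciSup (h.errFin .r) θ).trans (le_max_left _ _)
  · exact (le_ciSup (h.errFin .c) θ).trans (le_max_right _ _)

/-- The error `ζ_g^*(θ)ᵀφ_g(s) - V_g^{π_θ}(s)` of the best critic. -/
def valErr (M : CMDP S A) (π : E d → Policy S A) (φ : Sig → S → E m) (cγ : ℝ) (g : Sig)
    (θ : E d) (s : S) : ℝ :=
  ∑ i, xiStar M π φ cγ g θ (Sum.inr i) * φ g s i - M.V g (π θ) s

theorem Setup.gradEst_xiStar_sub_polGrad (h : Setup M π φ p G₁ G₂ μ lam τ) (θ : E d) (g : Sig) :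
    gradEst M π φ g θ (xiStar M π φ p.cγ g θ) - polGrad M π g θ =
      ev (statLaw M (π θ)) fun z =>
        (valErr M π φ p.cγ g θ z.2.2 - valErr M π φ p.cγ g θ z.1) • scoreZ π θ z := by
  have hscore : ∀ s a s', scoreZ π θ (s, a, s') = PDNAC.score π θ s a := fun _ _ _ => rfl
  rw [gradEst, polGrad, ← (finSupp_statLaw M (π θ)).ev_sub, ev_statLaw_eq, ev_statLaw_eq]
  refine Finset.sum_congr rfl fun s _ => Finset.sum_congr rfl fun a _ => ?_
  simp only [hscore, ← sub_smul, smul_smul, ← Finset.sum_smul]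
  congr 2
  simp only [h.ergodic.adv_eq, advEst, valErr, h.toCriticWellPosed.xiStar_inl h.ergodic g θ,
    mul_sub, mul_add, Finset.sum_sub_distrib, Finset.sum_add_distrib, ← Finset.sum_mul, sum_prob,
    one_mul]
  ring

theorem Setup.ev_abs_valErr_le (h : Setup M π φ p G₁ G₂ μ lam τ) (θ : E d) (g : Sig) :
    ev (statPMF M (π θ)) (fun s => |valErr M π φ p.cγ g θ s|) ≤ √(epsApp M π φ p.cγ) := by
  refine ((finSupp_of_finite _).ev_le_sqrt _).trans (Real.sqrt_le_sqrt ?_)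
  rw [ev_statPMF]
  simp only [sq_abs, smul_eq_mul]
  exact h.critErr_le θ g

theorem Setup.norm_gradEst_xiStar_sub_polGrad_le (h : Setup M π φ p G₁ G₂ μ lam τ) (θ : E d)
    (g : Sig) :
    ‖gradEst M π φ g θ (xiStar M π φ p.cγ g θ) - polGrad M π g θ‖ ≤
      2 * G₁ * √(epsApp M π φ p.cγ) := by
  have hF := finSupp_statLaw M (π θ)
  set e := valErr M π φ p.cγ g θ
  have hpt : ∀ z ∈ (statLaw M (π θ)).support, ‖(e z.2.2 - e z.1) • scoreZ π θ z‖ ≤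
      G₁ * (|e z.2.2| + |e z.1|) := by
    intro z _
    rw [norm_smul, mul_comm, Real.norm_eq_abs]
    exact mul_le_mul (norm_scoreZ_le h.score θ z) (abs_sub _ _) (abs_nonneg _) h.G₁_pos.le
  rw [h.gradEst_xiStar_sub_polGrad]
  calc _ ≤ G₁ * (ev (statPMF M (π θ)) (fun s => |e s|) + ev (statPMF M (π θ)) fun s => |e s|) := by
        refine (hF.norm_ev_le _).trans ((hF.ev_mono hpt).trans_eq ?_)
        rw [hF.ev_mul, hF.ev_add, ev_statLaw_next M (π θ) (fun s => |e s|),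
          ev_statLaw_fst M (π θ) (fun s => |e s|), ← ev_statPMF]
    _ ≤ G₁ * (√(epsApp M π φ p.cγ) + √(epsApp M π φ p.cγ)) :=
        mul_le_mul_of_nonneg_left (add_le_add (h.ev_abs_valErr_le θ g) (h.ev_abs_valErr_le θ g))
          h.G₁_pos.le
    _ = 2 * G₁ * √(epsApp M π φ p.cγ) := by ring

theorem Setup.norm_ev_gradEst_sub_polGrad_le (h : Setup M π φ p G₁ G₂ μ lam τ) (θ : E d)
    (g : Sig) (s : S) :
    ‖ev (innerLaw M π φ p θ s) (fun y => gradEst M π φ g θ (y.1 g)) - polGrad M π g θ‖ ≤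
      3 * G₁ * (criticBias lam p.cγ τ / √p.Tmax) + 2 * G₁ * √(epsApp M π φ p.cγ) := by
  have hI := h.finSupp_innerLaw θ s
  have hlin : ev (innerLaw M π φ p θ s) (fun y => gradEst M π φ g θ (y.1 g)) -
      gradEst M π φ g θ (xiStar M π φ p.cγ g θ) = gradLin M π φ g θ
        (ev (innerLaw M π φ p θ s) (fun y => critEmb (y.1 g)) -
          critEmb (xiStar M π φ p.cγ g θ)) := by
    simp only [gradEst_eq_add]
    rw [hI.ev_add, hI.ev_const, add_sub_add_left_eq_sub, map_sub, hI.map_ev]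
  refine (norm_sub_le_norm_sub_add_norm_sub _ (gradEst M π φ g θ (xiStar M π φ p.cγ g θ)) _).trans
    (add_le_add ?_ (h.norm_gradEst_xiStar_sub_polGrad_le θ g))
  rw [hlin]
  refine (norm_gradLin_le h.norm_feat_le h.score g _).trans
    (mul_le_mul_of_nonneg_left (h.norm_ev_critic_sub_le θ g s) ?_)
  linarith [h.G₁_pos]

theorem Setup.norm_ev_actor_sub_natGrad_le (h : Setup M π φ p G₁ G₂ μ lam τ) (θ : E d) (g : Sig)
    (s : S) {ω : E d} (hω : IsNatGrad M π g θ ω) :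
    ‖ev (innerLaw M π φ p θ s) (fun y => y.2.2 g) - ω‖ ≤
      actorBias G₁ μ lam p.cγ τ * (√(epsApp M π φ p.cγ) + 1 / √p.Tmax) := by
  set ω' := (h.fisherEquiv θ).symm
    (ev (innerLaw M π φ p θ s) fun y => gradEst M π φ g θ (y.1 g)) with hω'
  have htarget : ‖ω' - ω‖ ≤
      (3 * G₁ * (criticBias lam p.cγ τ / √p.Tmax) + 2 * G₁ * √(epsApp M π φ p.cγ)) / μ := by
    refine (norm_le_of_coercive h.μ_pos (h.fisher.coercive θ) _).trans
      (div_le_div_of_nonneg_right ?_ h.μ_pos.le)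
    rw [map_sub, hω', h.meanOp_fisherEquiv_symm, hω]
    exact h.norm_ev_gradEst_sub_polGrad_le θ g s
  have hG := h.G₁_pos
  have hμ := h.μ_pos
  have hcrit := criticBias_nonneg h.lam_pos h.cγ_pos τ
  have hsa := saBias_nonneg (pow_pos hG 2) hμ
  set c₁ := saBias (G₁ ^ 2) μ * τ * (G₁ * (1 + 3 * √(criticMom lam p.cγ)))
  set c₂ := 3 * G₁ / μ * criticBias lam p.cγ τ
  set c₃ := 2 * G₁ / μ
  have hc₁ : 0 ≤ c₁ := by simp only [c₁]; positivity
  have hc₂ : 0 ≤ c₂ := by simp only [c₂]; positivity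
  have hc₃ : 0 ≤ c₃ := by simp only [c₃]; positivity
  calc _ ≤ saBias (G₁ ^ 2) μ * τ / √p.Tmax * (G₁ * (1 + 3 * √(criticMom lam p.cγ))) +
        (3 * G₁ * (criticBias lam p.cγ τ / √p.Tmax) + 2 * G₁ * √(epsApp M π φ p.cγ)) / μ :=
        (norm_sub_le_norm_sub_add_norm_sub _ ω' _).trans
          (add_le_add (h.norm_ev_actor_sub_le θ g s) htarget)
    _ = (c₁ + c₂) * (1 / √p.Tmax) + c₃ * √(epsApp M π φ p.cγ) := by ring
    _ ≤ (c₁ + c₂ + c₃) * (1 / √p.Tmax) + (c₁ + c₂ + c₃) * √(epsApp M π φ p.cγ) := by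
        refine add_le_add (mul_le_mul_of_nonneg_right ?_ (by positivity))
          (mul_le_mul_of_nonneg_right ?_ (Real.sqrt_nonneg _)) <;> linarith
    _ = actorBias G₁ μ lam p.cγ τ * (√(epsApp M π φ p.cγ) + 1 / √p.Tmax) := by
        unfold actorBias; ring

end ActorAnalysis

section EpochDrift

variable {S A : Type*} {d m : ℕ} {M : CMDP S A} {π : E d → Policy S A} {φ : Sig → S → E m}
  {p : Params} {G₁ G₂ : ℝ}

theorem epoch_eq_map_innerLaw (M : CMDP S A) (π : E d → Policy S A) (φ : Sig → S → E m)
    (p : Params) (x : AlgState S d) :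
    epoch M π φ p x = (innerLaw M π φ p x.θ x.state).map fun y =>
      { state := y.2.1
        θ := x.θ + p.α • (y.2.2 .r + x.lam • y.2.2 .c)
        lam := max 0 (min (2 / p.δ) (x.lam - p.β * y.1 .c (Sum.inl ()))) } := by
  simp only [epoch, innerLaw, PMF.map_bind, PMF.map_comp]
  rfl

theorem lam_mem_of_mem_epoch (hδ : 0 < p.δ) {x x' : AlgState S d}
    (hx' : x' ∈ (epoch M π φ p x).support) : x'.lam ∈ Set.Icc 0 (2 / p.δ) := by
  rw [epoch_eq_map_innerLaw, PMF.mem_support_map_iff] at hx'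
  obtain ⟨y, -, rfl⟩ := hx'
  exact ⟨le_max_left _ _, max_le (by positivity) (min_le_left _ _)⟩

theorem lam_mem_of_mem_algLaw (hδ : 0 < p.δ) {θ₀ : E d} {k : ℕ} {x : AlgState S d}
    (hx : x ∈ (algLaw M π φ p θ₀ k).support) : x.lam ∈ Set.Icc 0 (2 / p.δ) := by
  rw [algLaw, PMF.mem_support_bind_iff] at hx
  obtain ⟨s, -, hx⟩ := hx
  cases k with
  | zero =>
    rw [iterLaw, PMF.mem_support_pure_iff] at hx
    rw [hx]
    exact ⟨le_rfl, by positivity⟩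
  | succ k =>
    rw [iterLaw, PMF.mem_support_bind_iff] at hx
    obtain ⟨x', -, hx⟩ := hx
    exact lam_mem_of_mem_epoch hδ hx

theorem ev_algLaw_zero [Finite S] (M : CMDP S A) (π : E d → Policy S A) (φ : Sig → S → E m)
    (p : Params) (θ₀ : E d) (f : AlgState S d → ℝ) :
    ev (algLaw M π φ p θ₀ 0) f = ev M.ρ fun s => f ⟨s, θ₀, 0⟩ :=
  (finSupp_of_finite M.ρ).ev_map (fun s => (⟨s, θ₀, 0⟩ : AlgState S d)) f

theorem log_prob_sub_ge (hS : ScoreBounds π G₁ G₂) (hG₂ : 0 ≤ G₂) (θ v : E d) (s : S) (a : A) :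
    inner ℝ (score π θ s a) v - G₂ * ‖v‖ ^ 2 ≤
      Real.log (prob (π (θ + v) s) a) - Real.log (prob (π θ s) a) := by
  obtain ⟨z, hz, hmvt⟩ := domain_mvt (f := fun θ' => Real.log (prob (π θ' s) a)) (s := Set.univ)
    (x := θ) (y := θ + v) (f' := fun θ' => InnerProductSpace.toDual ℝ (E d) (score π θ' s a))
    (fun θ' _ => (hS.diff s a θ').hasGradientAt.hasFDerivAt.hasFDerivWithinAt) convex_univ
    (Set.mem_univ _) (Set.mem_univ _)
  have hdist : ‖z - θ‖ ≤ ‖v‖ := by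
    simpa only [add_sub_cancel_left] using norm_sub_le_of_mem_segment hz
  have hlip : ‖score π z s a - score π θ s a‖ ≤ G₂ * ‖v‖ :=
    (hS.lip z θ s a).trans (mul_le_mul_of_nonneg_left hdist hG₂)
  have hgap : -(G₂ * ‖v‖ ^ 2) ≤ inner ℝ (score π z s a - score π θ s a) v :=
    calc -(G₂ * ‖v‖ ^ 2) = -(G₂ * ‖v‖ * ‖v‖) := by ring
      _ ≤ -(‖score π z s a - score π θ s a‖ * ‖v‖) := by gcongr
      _ ≤ _ := neg_le_of_abs_le (abs_real_inner_le_norm _ _)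
  rw [inner_sub_left] at hgap
  rw [hmvt, add_sub_cancel_left, InnerProductSpace.toDual_apply_apply]
  linarith

theorem sum_prob_mul_log_div_nonneg [Fintype A] (P Q : PMF A) (hQ : ∀ a, 0 < prob Q a) :
    0 ≤ ∑ a, prob P a * Real.log (prob P a / prob Q a) :=
  calc 0 ≤ ∑ a, prob Q a * InformationTheory.klFun (prob P a / prob Q a) :=
        Finset.sum_nonneg fun a _ => mul_nonneg (hQ a).le
          (InformationTheory.klFun_nonneg (div_nonneg (prob_nonneg P a) (hQ a).le))
    _ = ∑ a, (prob P a * Real.log (prob P a / prob Q a) + (prob Q a - prob P a)) := by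
        refine Finset.sum_congr rfl fun a _ => ?_
        have := (hQ a).ne'
        unfold InformationTheory.klFun
        field_simp
        ring
    _ = ∑ a, prob P a * Real.log (prob P a / prob Q a) := by
        rw [Finset.sum_add_distrib, Finset.sum_sub_distrib, sum_prob, sum_prob, sub_self, add_zero]

variable [Fintype S] [Fintype A] {πs : Policy S A}

theorem klFrom_eq (M : CMDP S A) (πs π' : Policy S A) :
    M.klFrom πs π' =
      ∑ s, ∑ a, M.occ πs s a * Real.log (prob (πs s) a / prob (π' s) a) := by
  simp only [CMDP.klFrom, CMDP.occ, Finset.mul_sum, mul_assoc]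

theorem klFrom_nonneg (M : CMDP S A) (πs : Policy S A) {π' : Policy S A}
    (hpos : ∀ s a, 0 < prob (π' s) a) : 0 ≤ M.klFrom πs π' :=
  Finset.sum_nonneg fun s _ => mul_nonneg ((M.isStationaryLaw_statDist πs).1 s)
    (sum_prob_mul_log_div_nonneg _ _ (hpos s))

theorem klFrom_sub_eq_ev {π₁ π₂ : Policy S A} (h₁ : ∀ s a, 0 < prob (π₁ s) a)
    (h₂ : ∀ s a, 0 < prob (π₂ s) a) :
    M.klFrom πs π₁ - M.klFrom πs π₂ = ev (statLaw M πs) fun z =>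
      Real.log (prob (π₂ z.1) z.2.1) - Real.log (prob (π₁ z.1) z.2.1) := by
  rw [← sum_occ_eq_ev M πs fun s a => Real.log (prob (π₂ s) a) - Real.log (prob (π₁ s) a)]
  simp only [klFrom_eq, ← Finset.sum_sub_distrib]
  refine Finset.sum_congr rfl fun s _ => Finset.sum_congr rfl fun a _ => ?_
  rw [← mul_sub]
  rcases (prob_nonneg (πs s) a).eq_or_lt with hzero | hpos
  · simp only [CMDP.occ, ← hzero, mul_zero, zero_mul, smul_eq_mul]
  · rw [Real.log_div hpos.ne' (h₁ s a).ne', Real.log_div hpos.ne' (h₂ s a).ne']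
    ring

/-- The mean score of `π_θ` under the occupancy measure of the comparison policy `πs`: up to sign,
the gradient at `θ` of the divergence from `πs` to `π_θ`. -/
def scoreStar (M : CMDP S A) (π : E d → Policy S A) (πs : Policy S A) (θ : E d) : E d :=
  ev (statLaw M πs) (scoreZ π θ)

theorem norm_scoreStar_le (hS : ScoreBounds π G₁ G₂) (θ : E d) :
    ‖scoreStar M π πs θ‖ ≤ G₁ :=
  (finSupp_statLaw M πs).norm_ev_le_of_le (norm_scoreZ_le hS θ)

theorem inner_scoreStar (M : CMDP S A) (π : E d → Policy S A) (πs : Policy S A) (θ v : E d) :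
    inner ℝ (scoreStar M π πs θ) v = ev (statLaw M πs) fun z => inner ℝ (scoreZ π θ z) v := by
  have hmap := (finSupp_statLaw M πs).map_ev (innerₗ (E d) v) (scoreZ π θ)
  simp only [innerₗ_apply_apply] at hmap
  simpa only [scoreStar, real_inner_comm _ v] using hmap

theorem klFrom_add_le (hS : ScoreBounds π G₁ G₂) (hG₂ : 0 ≤ G₂) (θ v : E d) :
    M.klFrom πs (π (θ + v)) ≤
      M.klFrom πs (π θ) - inner ℝ (scoreStar M π πs θ) v + G₂ * ‖v‖ ^ 2 := by
  have hF := finSupp_statLaw M πs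
  have hlog := hF.ev_mono (f := fun z => inner ℝ (scoreZ π θ z) v - G₂ * ‖v‖ ^ 2)
    fun z _ => log_prob_sub_ge hS hG₂ θ v z.1 z.2.1
  rw [hF.ev_sub, hF.ev_const, ← inner_scoreStar,
    ← klFrom_sub_eq_ev (hS.pos θ) (hS.pos (θ + v))] at hlog
  linarith

/-- The Lyapunov function of the algorithm: the divergence of the current policy from the
comparison policy `πs`, plus half the squared distance of the dual variable to `l₀`. -/
def lyapunov (M : CMDP S A) (π : E d → Policy S A) (πs : Policy S A) (l₀ : ℝ)
    (x : AlgState S d) : ℝ :=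
  M.klFrom πs (π x.θ) + 1 / 2 * (x.lam - l₀) ^ 2

theorem lyapunov_nonneg (hS : ScoreBounds π G₁ G₂) (l₀ : ℝ) (x : AlgState S d) :
    0 ≤ lyapunov M π πs l₀ x :=
  add_nonneg (klFrom_nonneg M πs (hS.pos x.θ)) (by positivity)

variable [DecidableEq S]

/-- The residual at a transition of the approximation of `A_r + l A_c` by the linear function
`ω ↦ ⟪ψ, ω⟫` of the score `ψ`. -/
def compRes (M : CMDP S A) (π : E d → Policy S A) (ω θ : E d) (l : ℝ) (z : S × A × S) : ℝ :=
  inner ℝ (scoreZ π θ z) ω - M.Adv .r (π θ) z.1 z.2.1 - l * M.Adv .c (π θ) z.1 z.2.1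

theorem compErr_eq_ev (M : CMDP S A) (π : E d → Policy S A) (π' : Policy S A) (ω θ : E d)
    (l : ℝ) : compErr M π (M.occ π') ω θ l =
      ev (statLaw M π') fun z => compRes M π ω θ l z ^ 2 :=
  sum_occ_eq_ev M π' fun s a =>
    (inner ℝ (score π θ s a) ω - M.Adv .r (π θ) s a - l * M.Adv .c (π θ) s a) ^ 2

section NaturalGradient

variable {θ : E d} {ω : Sig → E d}

theorem ev_compRes_smul_scoreZ (hω : ∀ g, IsNatGrad M π g θ (ω g)) (l : ℝ) :
    ev (statLaw M (π θ)) (fun z => compRes M π (ω .r + l • ω .c) θ l z • scoreZ π θ z) = 0 := by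
  have hF := finSupp_statLaw M (π θ)
  have hsplit : ∀ z, compRes M π (ω .r + l • ω .c) θ l z • scoreZ π θ z =
      actorLin π θ z (ω .r + l • ω .c) - (M.Adv .r (π θ) z.1 z.2.1 • scoreZ π θ z +
        l • (M.Adv .c (π θ) z.1 z.2.1 • scoreZ π θ z)) := by
    intro z
    simp only [actorLin_apply, compRes, sub_smul, mul_smul]
    abel
  have hmean : meanOp M (π θ) (actorLin π θ) (ω .r + l • ω .c) =
      polGrad M π .r θ + l • polGrad M π .c θ := by rw [map_add, map_smul, hω, hω]
  simp_rw [hsplit]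
  rw [hF.ev_sub, hF.ev_add, hF.ev_smul]
  exact sub_eq_zero.2 hmean

theorem ev_compRes_mul_inner (hω : ∀ g, IsNatGrad M π g θ (ω g)) (l : ℝ) (v : E d) :
    ev (statLaw M (π θ)) (fun z => compRes M π (ω .r + l • ω .c) θ l z *
      inner ℝ (scoreZ π θ z) v) = 0 := by
  have hmap := (finSupp_statLaw M (π θ)).map_ev (innerₗ (E d) v) fun z =>
    compRes M π (ω .r + l • ω .c) θ l z • scoreZ π θ z
  simp only [innerₗ_apply_apply, inner_smul_right] at hmap
  simp only [real_inner_comm v]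
  rw [← hmap, ev_compRes_smul_scoreZ hω, inner_zero_right]

theorem compErr_natGrad_le (hω : ∀ g, IsNatGrad M π g θ (ω g)) (l : ℝ) (ω' : E d) :
    compErr M π (M.occ (π θ)) (ω .r + l • ω .c) θ l ≤ compErr M π (M.occ (π θ)) ω' θ l := by
  have hF := finSupp_statLaw M (π θ)
  set v := ω' - (ω .r + l • ω .c) with hv
  have hpyth : ∀ z, compRes M π ω' θ l z ^ 2 = compRes M π (ω .r + l • ω .c) θ l z ^ 2 +
      (2 * (compRes M π (ω .r + l • ω .c) θ l z * inner ℝ (scoreZ π θ z) v) +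
        inner ℝ (scoreZ π θ z) v ^ 2) := by
    intro z
    simp only [compRes, hv, inner_sub_right]
    ring
  rw [compErr_eq_ev, compErr_eq_ev]
  simp_rw [hpyth]
  rw [hF.ev_add, hF.ev_add, hF.ev_mul, ev_compRes_mul_inner hω, mul_zero, zero_add]
  exact le_add_of_nonneg_right (hF.ev_nonneg fun z => sq_nonneg _)

theorem CMDP.Ergodic.ev_adv (hM : M.Ergodic) (g : Sig) (π₁ π₂ : Policy S A) :
    ev (statLaw M π₁) (fun z => M.Adv g π₂ z.1 z.2.1) = M.J g π₁ - M.J g π₂ := by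
  rw [← hM.sum_occ_adv, ← sum_occ_eq_ev M π₁ (M.Adv g π₂)]
  rfl

theorem CMDP.Ergodic.natGrad_gain (hM : M.Ergodic) {δ εbias : ℝ} (hb : BiasBound M π πs δ εbias)
    (hω : ∀ g, IsNatGrad M π g θ (ω g)) {l : ℝ} (hl : l ∈ Set.Icc 0 (2 / δ)) :
    M.J .r πs - M.J .r (π θ) + l * (M.J .c πs - M.J .c (π θ)) - √εbias ≤
      inner ℝ (scoreStar M π πs θ) (ω .r + l • ω .c) := by
  have hF := finSupp_statLaw M πs
  have hmean : ev (statLaw M πs) (fun z => -compRes M π (ω .r + l • ω .c) θ l z) =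
      M.J .r πs - M.J .r (π θ) + l * (M.J .c πs - M.J .c (π θ)) -
        inner ℝ (scoreStar M π πs θ) (ω .r + l • ω .c) := by
    rw [← hM.ev_adv, ← hM.ev_adv, inner_scoreStar, ← hF.ev_mul, ← hF.ev_add, ← hF.ev_sub]
    refine congrArg _ (funext fun z => ?_)
    rw [compRes]
    ring
  have hres : ev (statLaw M πs) (fun z => -compRes M π (ω .r + l • ω .c) θ l z) ≤ √εbias := by
    refine (hF.ev_le_sqrt _).trans (Real.sqrt_le_sqrt ?_)
    simp only [neg_sq, ← compErr_eq_ev]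
    exact hb θ l hl _ (compErr_natGrad_le hω l)
  linarith

end NaturalGradient

variable {μ lam : ℝ} {τ : ℕ} {εbias : ℝ}

theorem Setup.finSupp_epoch (h : Setup M π φ p G₁ G₂ μ lam τ) (x : AlgState S d) :
    FinSupp (epoch M π φ p x) := by
  rw [epoch_eq_map_innerLaw]
  exact (h.finSupp_innerLaw x.θ x.state).map _

theorem Setup.norm_ev_actor_dir_sub_le (h : Setup M π φ p G₁ G₂ μ lam τ) {θ : E d}
    {ω : Sig → E d} (hω : ∀ g, IsNatGrad M π g θ (ω g)) (s : S) {l b : ℝ}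
    (hl : l ∈ Set.Icc 0 b) :
    ‖ev (innerLaw M π φ p θ s) (fun y => y.2.2 .r + l • y.2.2 .c) - (ω .r + l • ω .c)‖ ≤
      (1 + b) * (actorBias G₁ μ lam p.cγ τ * (√(epsApp M π φ p.cγ) + 1 / √p.Tmax)) := by
  have hI := h.finSupp_innerLaw θ s
  have hr := h.norm_ev_actor_sub_natGrad_le θ .r s (hω .r)
  have hc := h.norm_ev_actor_sub_natGrad_le θ .c s (hω .c)
  rw [hI.ev_add, hI.ev_smul, add_sub_add_comm, ← smul_sub, one_add_mul]
  refine (norm_add_le _ _).trans (add_le_add hr ?_)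
  rw [norm_smul, Real.norm_of_nonneg hl.1]
  exact mul_le_mul hl.2 hc (norm_nonneg _) (hl.1.trans hl.2)

theorem Setup.ev_actor_dir_sq_le (h : Setup M π φ p G₁ G₂ μ lam τ) (θ : E d) (s : S) {l b : ℝ}
    (hl : l ∈ Set.Icc 0 b) :
    ev (innerLaw M π φ p θ s) (fun y => ‖y.2.2 .r + l • y.2.2 .c‖ ^ 2) ≤
      2 * (1 + b ^ 2) * actorMom G₁ μ lam p.cγ := by
  have hI := h.finSupp_innerLaw θ s
  have hpt : ∀ y ∈ (innerLaw M π φ p θ s).support, ‖y.2.2 .r + l • y.2.2 .c‖ ^ 2 ≤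
      2 * ‖y.2.2 .r‖ ^ 2 + 2 * b ^ 2 * ‖y.2.2 .c‖ ^ 2 := by
    intro y _
    refine (norm_add_sq_le_two _ _).trans ?_
    rw [norm_smul, mul_pow, Real.norm_of_nonneg hl.1, ← mul_assoc]
    gcongr
    exacts [hl.1, hl.2]
  calc _ ≤ 2 * ev (innerLaw M π φ p θ s) (fun y => ‖y.2.2 .r‖ ^ 2) +
        2 * b ^ 2 * ev (innerLaw M π φ p θ s) (fun y => ‖y.2.2 .c‖ ^ 2) := by
        rw [← hI.ev_mul, ← hI.ev_mul, ← hI.ev_add]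
        exact hI.ev_mono hpt
    _ ≤ 2 * actorMom G₁ μ lam p.cγ + 2 * b ^ 2 * actorMom G₁ μ lam p.cγ := by
        gcongr
        exacts [h.ev_actor_sq_le θ .r s, h.ev_actor_sq_le θ .c s]
    _ = 2 * (1 + b ^ 2) * actorMom G₁ μ lam p.cγ := by ring

theorem Setup.actor_dir_gain (h : Setup M π φ p G₁ G₂ μ lam τ)
    (hb : BiasBound M π πs p.δ εbias) (θ : E d) (s : S) {l : ℝ} (hl : l ∈ Set.Icc 0 (2 / p.δ)) :
    M.J .r πs - M.J .r (π θ) + l * (M.J .c πs - M.J .c (π θ)) - (√εbias + G₁ * ((1 + 2 / p.δ) *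
        (actorBias G₁ μ lam p.cγ τ * (√(epsApp M π φ p.cγ) + 1 / √p.Tmax)))) ≤
      inner ℝ (scoreStar M π πs θ)
        (ev (innerLaw M π φ p θ s) fun y => y.2.2 .r + l • y.2.2 .c) := by
  set ω : Sig → E d := fun g => (h.fisherEquiv θ).symm (polGrad M π g θ)
  have hω : ∀ g, IsNatGrad M π g θ (ω g) := fun g => h.meanOp_fisherEquiv_symm θ _
  have hgain := h.ergodic.natGrad_gain hb hω hl
  have herr := (real_inner_le_norm (scoreStar M π πs θ) (ω .r + l • ω .c -
    ev (innerLaw M π φ p θ s) fun y => y.2.2 .r + l • y.2.2 .c)).trans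
      (mul_le_mul (norm_scoreStar_le h.score θ)
        ((norm_sub_rev _ _).trans_le (h.norm_ev_actor_dir_sub_le hω s hl)) (norm_nonneg _)
          h.G₁_pos.le)
  rw [inner_sub_right] at herr
  linarith

theorem Setup.kl_drift (h : Setup M π φ p G₁ G₂ μ lam τ) (hG₂ : 0 ≤ G₂) (hα : 0 ≤ p.α)
    (hb : BiasBound M π πs p.δ εbias) {x : AlgState S d}
    (hl : x.lam ∈ Set.Icc 0 (2 / p.δ)) :
    ev (epoch M π φ p x) (fun x' => M.klFrom πs (π x'.θ)) ≤
      M.klFrom πs (π x.θ) - p.α * (M.J .r πs - M.J .r (π x.θ) +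
        x.lam * (M.J .c πs - M.J .c (π x.θ))) +
      p.α * (√εbias + G₁ * ((1 + 2 / p.δ) * (actorBias G₁ μ lam p.cγ τ *
        (√(epsApp M π φ p.cγ) + 1 / √p.Tmax)))) +
      p.α ^ 2 * (G₂ * (2 * (1 + (2 / p.δ) ^ 2) * actorMom G₁ μ lam p.cγ)) := by
  have hI := h.finSupp_innerLaw x.θ x.state
  set dir : (Sig → Critic m) × S × (Sig → E d) → E d := fun y => y.2.2 .r + x.lam • y.2.2 .c
  have hpt : ∀ y ∈ (innerLaw M π φ p x.θ x.state).support,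
      M.klFrom πs (π (x.θ + p.α • dir y)) ≤ M.klFrom πs (π x.θ) -
        p.α * innerₗ (E d) (scoreStar M π πs x.θ) (dir y) + p.α ^ 2 * G₂ * ‖dir y‖ ^ 2 := by
    intro y _
    have hstep := klFrom_add_le (M := M) (πs := πs) h.score hG₂ x.θ (p.α • dir y)
    rw [inner_smul_right, norm_smul, mul_pow, Real.norm_eq_abs, sq_abs] at hstep
    rw [innerₗ_apply_apply]
    linarith
  have hmean : ev (epoch M π φ p x) (fun x' => M.klFrom πs (π x'.θ)) ≤ M.klFrom πs (π x.θ) -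
      p.α * inner ℝ (scoreStar M π πs x.θ) (ev (innerLaw M π φ p x.θ x.state) dir) +
        p.α ^ 2 * G₂ * ev (innerLaw M π φ p x.θ x.state) (fun y => ‖dir y‖ ^ 2) := by
    rw [epoch_eq_map_innerLaw, hI.ev_map]
    refine (hI.ev_mono hpt).trans_eq ?_
    rw [hI.ev_add, hI.ev_sub, hI.ev_mul, hI.ev_mul, hI.ev_const, ← hI.map_ev]
    rfl
  have hgain := mul_le_mul_of_nonneg_left (h.actor_dir_gain hb x.θ x.state hl) hα
  have hsq := mul_le_mul_of_nonneg_left (h.ev_actor_dir_sq_le x.θ x.state hl)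
    (show 0 ≤ p.α ^ 2 * G₂ by positivity)
  linarith

theorem abs_max_min_sub_le {b l : ℝ} (hl : l ∈ Set.Icc 0 b) (y : ℝ) :
    |max 0 (min b y) - l| ≤ |y - l| := by
  have hproj := Set.abs_projIcc_sub_projIcc (hl.1.trans hl.2) (c := y) (d := l)
  rwa [Set.projIcc_of_mem _ hl, Set.coe_projIcc] at hproj

theorem Setup.abs_ev_critic_inl_sub_le (h : Setup M π φ p G₁ G₂ μ lam τ) (θ : E d) (g : Sig)
    (s : S) :
    |ev (innerLaw M π φ p θ s) (fun y => y.1 g (Sum.inl ())) - M.J g (π θ)| ≤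
      criticBias lam p.cγ τ / √p.Tmax := by
  refine le_trans (le_of_eq ?_) ((WithLp.norm_fst_le _ _).trans (h.norm_ev_critic_sub_le θ g s))
  have hmap := (h.finSupp_innerLaw θ s).map_ev (WithLp.fstₗ 2 ℝ ℝ (E m)) fun y => critEmb (y.1 g)
  rw [← h.toCriticWellPosed.xiStar_inl h.ergodic g θ, WithLp.sub_fst, Real.norm_eq_abs]
  exact congrArg (fun η => |η - _|) hmap.symm

theorem Setup.dual_drift (h : Setup M π φ p G₁ G₂ μ lam τ) (hβ : 0 ≤ p.β) {x : AlgState S d}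
    (hl : x.lam ∈ Set.Icc 0 (2 / p.δ)) {l₀ : ℝ} (hl₀ : l₀ ∈ Set.Icc 0 (2 / p.δ)) :
    ev (epoch M π φ p x) (fun x' => (x'.lam - l₀) ^ 2) ≤
      (x.lam - l₀) ^ 2 - 2 * p.β * ((x.lam - l₀) * M.J .c (π x.θ)) +
      2 * p.β * (2 / p.δ * (criticBias lam p.cγ τ / √p.Tmax)) +
      p.β ^ 2 * criticMom lam p.cγ := by
  have hI := h.finSupp_innerLaw x.θ x.state
  set η : (Sig → Critic m) × S × (Sig → E d) → ℝ := fun y => y.1 .c (Sum.inl ())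
  have hpt : ∀ y ∈ (innerLaw M π φ p x.θ x.state).support,
      (max 0 (min (2 / p.δ) (x.lam - p.β * η y)) - l₀) ^ 2 ≤
      (x.lam - l₀) ^ 2 - 2 * p.β * (x.lam - l₀) * η y + p.β ^ 2 * ‖critEmb (y.1 .c)‖ ^ 2 := by
    intro y _
    have habs : |η y| ≤ ‖critEmb (y.1 .c)‖ := WithLp.norm_fst_le _ (critEmb (y.1 .c))
    have hη : η y ^ 2 ≤ ‖critEmb (y.1 .c)‖ ^ 2 :=
      sq_le_sq' (neg_le_of_abs_le habs) (le_of_abs_le habs)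
    calc _ ≤ (x.lam - p.β * η y - l₀) ^ 2 := sq_le_sq.2 (abs_max_min_sub_le hl₀ _)
      _ = (x.lam - l₀) ^ 2 - 2 * p.β * (x.lam - l₀) * η y + p.β ^ 2 * η y ^ 2 := by ring
      _ ≤ _ := by gcongr
  have hmean : ev (epoch M π φ p x) (fun x' => (x'.lam - l₀) ^ 2) ≤ (x.lam - l₀) ^ 2 -
      2 * p.β * (x.lam - l₀) * ev (innerLaw M π φ p x.θ x.state) η +
        p.β ^ 2 * ev (innerLaw M π φ p x.θ x.state) (fun y => ‖critEmb (y.1 .c)‖ ^ 2) := by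
    rw [epoch_eq_map_innerLaw, hI.ev_map]
    refine (hI.ev_mono hpt).trans_eq ?_
    rw [hI.ev_add, hI.ev_sub, hI.ev_const, hI.ev_mul, hI.ev_mul]
  have hbias : -((x.lam - l₀) * (ev (innerLaw M π φ p x.θ x.state) η - M.J .c (π x.θ))) ≤
      2 / p.δ * (criticBias lam p.cγ τ / √p.Tmax) := by
    refine (neg_le_abs _).trans ?_
    rw [abs_mul]
    refine mul_le_mul ?_ (h.abs_ev_critic_inl_sub_le x.θ .c x.state) (abs_nonneg _)
      (hl.1.trans hl.2)
    exact abs_le.2 ⟨by linarith [hl.1, hl₀.2], by linarith [hl.2, hl₀.1]⟩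
  have hsq := mul_le_mul_of_nonneg_left (h.ev_critic_sq_le x.θ .c x.state) (sq_nonneg p.β)
  have hlin := mul_le_mul_of_nonneg_left hbias (show 0 ≤ 2 * p.β by positivity)
  linarith

theorem Setup.finSupp_algLaw (h : Setup M π φ p G₁ G₂ μ lam τ) (θ₀ : E d) (k : ℕ) :
    FinSupp (algLaw M π φ p θ₀ k) :=
  (finSupp_of_finite _).bind fun _ => finSupp_iterLaw h.finSupp_epoch k _

theorem Setup.ev_algLaw_succ (h : Setup M π φ p G₁ G₂ μ lam τ) (θ₀ : E d) (k : ℕ)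
    (f : AlgState S d → ℝ) :
    ev (algLaw M π φ p θ₀ (k + 1)) f =
      ev (algLaw M π φ p θ₀ k) fun x => ev (epoch M π φ p x) f := by
  rw [algLaw, algLaw, (finSupp_of_finite _).ev_bind fun _ => finSupp_iterLaw h.finSupp_epoch _ _,
    (finSupp_of_finite _).ev_bind fun _ => finSupp_iterLaw h.finSupp_epoch _ _]
  simp_rw [ev_iterLaw_succ h.finSupp_epoch]

/-- The constant in the bound on the loss per epoch in the drift of the Lyapunov function: it
collects the biases and second moments of the actor and critic estimates. -/
def epochErr (G₁ G₂ μ lam cγ δ : ℝ) (τ : ℕ) : ℝ :=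
  1 + G₁ * ((1 + 2 / δ) * actorBias G₁ μ lam cγ τ) +
    G₂ * (2 * (1 + (2 / δ) ^ 2) * actorMom G₁ μ lam cγ) +
    2 / δ * criticBias lam cγ τ + criticMom lam cγ

section EpochErr

variable {cγ δ : ℝ}

theorem epochErr_nonneg (hG : 0 < G₁) (hG₂ : 0 ≤ G₂) (hμ : 0 < μ) (hlam : 0 < lam) (hc : 0 < cγ)
    (hδ : 0 < δ) (τ : ℕ) : 0 ≤ epochErr G₁ G₂ μ lam cγ δ τ := by
  have := actorBias_nonneg hG hμ hlam hc τ
  have := criticBias_nonneg hlam hc τ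
  have := actorMom_nonneg G₁ μ lam cγ
  have := criticMom_nonneg lam cγ
  unfold epochErr
  positivity

theorem le_epochErr_mul (hG : 0 < G₁) (hG₂ : 0 ≤ G₂) (hμ : 0 < μ) (hlam : 0 < lam) (hc : 0 < cγ)
    (hδ : 0 < δ) (τ : ℕ) {a b u : ℝ} (ha : 0 ≤ a) (hb : 0 ≤ b) (hu : 0 ≤ u) :
    a + G₁ * ((1 + 2 / δ) * (actorBias G₁ μ lam cγ τ * (b + u))) +
      u * (G₂ * (2 * (1 + (2 / δ) ^ 2) * actorMom G₁ μ lam cγ)) +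
      2 / δ * (criticBias lam cγ τ * u) + u * criticMom lam cγ ≤
      epochErr G₁ G₂ μ lam cγ δ τ * (a + b + u) := by
  have := actorBias_nonneg hG hμ hlam hc τ
  have := criticBias_nonneg hlam hc τ
  have := actorMom_nonneg G₁ μ lam cγ
  have := criticMom_nonneg lam cγ
  have hae : a ≤ a + b + u := by linarith
  have hbue : b + u ≤ a + b + u := by linarith
  have hue : u ≤ a + b + u := by linarith
  generalize a + b + u = e at *
  calc _ ≤ e + G₁ * ((1 + 2 / δ) * (actorBias G₁ μ lam cγ τ * e)) +
      e * (G₂ * (2 * (1 + (2 / δ) ^ 2) * actorMom G₁ μ lam cγ)) +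
      2 / δ * (criticBias lam cγ τ * e) + e * criticMom lam cγ := by gcongr
    _ = epochErr G₁ G₂ μ lam cγ δ τ * e := by unfold epochErr; ring

end EpochErr

theorem Setup.lyapunov_drift (h : Setup M π φ p G₁ G₂ μ lam τ)
    (hα : p.α = 1 / √p.Tmax) (hβ : p.β = 1 / √p.Tmax) (hδ : 0 < p.δ)
    (hb : BiasBound M π πs p.δ εbias) (hJc : 0 ≤ M.J .c πs)
    (hG₂ : 0 ≤ G₂) {l₀ : ℝ} (hl₀ : l₀ ∈ Set.Icc 0 (2 / p.δ))
    {x : AlgState S d} (hx : x.lam ∈ Set.Icc 0 (2 / p.δ)) :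
    ev (epoch M π φ p x) (lyapunov M π πs l₀) ≤
      lyapunov M π πs l₀ x - p.α * (M.J .r πs - M.J .r (π x.θ) - l₀ * M.J .c (π x.θ)) +
        p.α * (epochErr G₁ G₂ μ lam p.cγ p.δ τ *
          (√εbias + √(epsApp M π φ p.cγ) + 1 / √p.Tmax)) := by
  have hE := h.finSupp_epoch x
  have hu : 0 ≤ 1 / √(p.Tmax : ℝ) := by positivity
  have hkl := h.kl_drift hG₂ (hα ▸ hu) hb hx
  have hdual := h.dual_drift (hβ ▸ hu) hx hl₀
  have herr := mul_le_mul_of_nonneg_left (le_epochErr_mul h.G₁_pos hG₂ h.μ_pos h.lam_pos h.cγ_pos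
    hδ τ (Real.sqrt_nonneg εbias) (Real.sqrt_nonneg (epsApp M π φ p.cγ)) hu) hu
  have hmom := mul_nonneg (sq_nonneg (1 / √(p.Tmax : ℝ))) (criticMom_nonneg lam p.cγ)
  have hslack : 0 ≤ 1 / √(p.Tmax : ℝ) * (x.lam * M.J .c πs) :=
    mul_nonneg hu (mul_nonneg hx.1 hJc)
  rw [div_eq_mul_one_div (criticBias lam p.cγ τ)] at hdual
  unfold lyapunov
  rw [hE.ev_add, hE.ev_mul]
  rw [hα] at hkl ⊢
  rw [hβ] at hdual
  linarith

theorem Setup.lagrangian_regret (h : Setup M π φ p G₁ G₂ μ lam τ)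
    (hα : p.α = 1 / √p.Tmax) (hβ : p.β = 1 / √p.Tmax) (hδ : 0 < p.δ)
    (hb : BiasBound M π πs p.δ εbias) (hJc : 0 ≤ M.J .c πs)
    (hG₂ : 0 ≤ G₂) (θ₀ : E d) {l₀ : ℝ}
    (hl₀ : l₀ ∈ Set.Icc 0 (2 / p.δ)) (K : ℕ) :
    p.α * ∑ k ∈ Finset.range K, ev (algLaw M π φ p θ₀ k)
      (fun x => M.J .r πs - M.J .r (π x.θ) - l₀ * M.J .c (π x.θ)) ≤
      M.klFrom πs (π θ₀) + l₀ ^ 2 / 2 + K * (p.α * (epochErr G₁ G₂ μ lam p.cγ p.δ τ *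
        (√εbias + √(epsApp M π φ p.cγ) + 1 / √p.Tmax))) := by
  set loss := p.α * (epochErr G₁ G₂ μ lam p.cγ p.δ τ *
    (√εbias + √(epsApp M π φ p.cγ) + 1 / √p.Tmax))
  set gap : AlgState S d → ℝ := fun x => M.J .r πs - M.J .r (π x.θ) - l₀ * M.J .c (π x.θ)
  set Ψ : ℕ → ℝ := fun k => ev (algLaw M π φ p θ₀ k) (lyapunov M π πs l₀)
  have hdrift : ∀ k, p.α * ev (algLaw M π φ p θ₀ k) gap ≤ Ψ k - Ψ (k + 1) + loss := by
    intro k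
    have hF := h.finSupp_algLaw θ₀ k
    have hstep := hF.ev_mono fun x hx =>
      h.lyapunov_drift hα hβ hδ hb hJc hG₂ hl₀ (lam_mem_of_mem_algLaw hδ hx)
    rw [← h.ev_algLaw_succ, hF.ev_add, hF.ev_sub, hF.ev_mul, hF.ev_const] at hstep
    linarith
  have hstart : Ψ 0 = M.klFrom πs (π θ₀) + l₀ ^ 2 / 2 := by
    simp only [Ψ, ev_algLaw_zero, lyapunov]
    rw [(finSupp_of_finite _).ev_const]
    ring
  calc _ ≤ ∑ k ∈ Finset.range K, (Ψ k - Ψ (k + 1) + loss) := by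
        rw [Finset.mul_sum]
        exact Finset.sum_le_sum fun k _ => hdrift k
    _ = Ψ 0 - Ψ K + K * loss := by
        rw [Finset.sum_add_distrib, Finset.sum_range_sub', Finset.sum_const, Finset.card_range,
          nsmul_eq_mul]
    _ ≤ _ := by
        have hend : 0 ≤ Ψ K := (h.finSupp_algLaw θ₀ K).ev_nonneg (lyapunov_nonneg h.score l₀)
        rw [hstart]
        linarith

end EpochDrift

section Tuning

theorem log_two_le_log {T : ℕ} (hT : 2 ≤ T) : Real.log 2 ≤ Real.log T :=
  Real.log_le_log (by norm_num) (by exact_mod_cast hT)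

theorem log_gt_d4 {T : ℕ} (hT : 2 ≤ T) : 0.6931 < Real.log T := by
  linarith [log_two_le_log hT, Real.log_two_gt_d9]

theorem natLog_two_le (T : ℕ) : (Nat.log 2 T : ℝ) ≤ 1.5 * Real.log T :=
  calc (Nat.log 2 T : ℝ) ≤ Real.log T / Real.log 2 := Real.natLog_le_logb T 2
    _ ≤ 1.5 * Real.log T := by
      rw [div_le_iff₀ (Real.log_pos one_lt_two)]
      have hlog : 0 ≤ Real.log T := Real.log_natCast_nonneg T
      have := mul_le_mul_of_nonneg_left Real.log_two_gt_d9.le hlog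
      linarith

section Thresholds

variable {τ T H : ℕ} {a γ κ : ℝ}

theorem mlmc_variance_factor_le (hτ : 1 ≤ τ) (hT : 2 ≤ T) :
    2 + 12 * (4 + 16 * (τ : ℝ)) * Nat.log 2 T ≤ 363 * (τ * Real.log T) := by
  have hτ' : (1 : ℝ) ≤ τ := Nat.one_le_cast.2 hτ
  have hlog := log_gt_d4 hT
  have hone : Real.log T ≤ τ * Real.log T := le_mul_of_one_le_left (by linarith) hτ'
  have hlevel : 12 * (4 + 16 * (τ : ℝ)) * Nat.log 2 T ≤ 240 * τ * (1.5 * Real.log T) :=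
    mul_le_mul (by linarith) (natLog_two_le T) (Nat.cast_nonneg _) (by positivity)
  linarith

theorem mul_le_of_loop_ge {c c₀ : ℝ} (hc₀ : 0 ≤ c₀) (hcc : c ≤ c₀) (hτ : 1 ≤ τ)
    (hH : c₀ * τ ^ 2 * Real.log T ^ 2 ≤ H) : c * (τ * Real.log T ^ 2) ≤ H := by
  have hτ' : (τ : ℝ) ≤ τ ^ 2 := le_self_pow₀ (Nat.one_le_cast.2 hτ) two_ne_zero
  calc c * (τ * Real.log T ^ 2) ≤ c₀ * (τ ^ 2 * Real.log T ^ 2) := by gcongr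
    _ = c₀ * τ ^ 2 * Real.log T ^ 2 := by ring
    _ ≤ H := hH

theorem step_mul_coer_le_one (hτ : 1 ≤ τ) (hT : 2 ≤ T) (hγ : γ * κ * H ≤ 2 * Real.log T)
    (hH : 3 * (τ * Real.log T ^ 2) ≤ H) : γ * κ ≤ 1 := by
  have hlog := log_gt_d4 hT
  have hτ' : Real.log T ^ 2 ≤ τ * Real.log T ^ 2 :=
    le_mul_of_one_le_left (sq_nonneg _) (Nat.one_le_cast.2 hτ)
  have hH0 : (0 : ℝ) < H := by nlinarith
  refine le_of_mul_le_mul_right ?_ hH0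
  nlinarith

theorem mlmc_bias_le (ha : 0 ≤ a) (hT : 2 ≤ T)
    (hH : 80 * a * (τ * Real.log T ^ 2) ≤ κ * T) : 4 * (8 * (τ : ℝ) / T) * a ≤ κ := by
  have hT0 : (0 : ℝ) < T := Nat.cast_pos.2 (by lia)
  have hsq : 0.48 ≤ Real.log T ^ 2 := by nlinarith [log_gt_d4 hT]
  have hlow := mul_le_mul_of_nonneg_left hsq (show 0 ≤ 80 * a * τ by positivity)
  rw [show 4 * (8 * (τ : ℝ) / T) * a = 32 * (a * τ) / T by ring, div_le_iff₀ hT0]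
  linarith [mul_nonneg ha (Nat.cast_nonneg (α := ℝ) τ)]

theorem mlmc_variance_le (hκ : 0 < κ) (hτ : 1 ≤ τ) (hT : 2 ≤ T) (hH0 : 0 < H)
    (hγ : γ * κ * H ≤ 2 * Real.log T) (hH : 5808 * a ^ 2 * (τ * Real.log T ^ 2) ≤ κ ^ 2 * H) :
    8 * γ * (2 + 12 * (4 + 16 * (τ : ℝ)) * Nat.log 2 T) * a ^ 2 ≤ κ := by
  have hfactor := mlmc_variance_factor_le hτ hT
  set σ := 2 + 12 * (4 + 16 * (τ : ℝ)) * Nat.log 2 T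
  have : 0 ≤ Real.log T := Real.log_natCast_nonneg T
  have : (0 : ℝ) < H := Nat.cast_pos.2 hH0
  refine le_of_mul_le_mul_right (a := κ * H) ?_ (by positivity)
  calc 8 * γ * σ * a ^ 2 * (κ * H) = γ * κ * H * (8 * σ * a ^ 2) := by ring
    _ ≤ 2 * Real.log T * (8 * σ * a ^ 2) := by gcongr
    _ = 16 * Real.log T * a ^ 2 * σ := by ring
    _ ≤ 16 * Real.log T * a ^ 2 * (363 * (τ * Real.log T)) := by gcongr
    _ = 5808 * a ^ 2 * (τ * Real.log T ^ 2) := by ring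
    _ ≤ κ ^ 2 * H := hH
    _ = κ * (κ * H) := by ring

/-- A factor `c` for which loops of at least `c τ² (log T)²` steps of size about `log T / (κ H)`
satisfy `StepSmall`; the three summands are for `le_one`, `bias` and `var` respectively. -/
def stepConst (a κ : ℝ) : ℝ :=
  3 + 80 * a / κ + 5808 * a ^ 2 / κ ^ 2

theorem stepConst_pos (ha : 0 < a) (hκ : 0 < κ) : 0 < stepConst a κ := by
  unfold stepConst
  positivity

theorem stepSmall_of_loop_ge {c₀ : ℝ} (hτ : 1 ≤ τ) (hT : 2 ≤ T) (hH0 : 0 < H) (hHT : H ≤ T)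
    (ha : 0 < a) (hκ : 0 < κ) (hγ0 : 0 ≤ γ) (hγ : γ * κ * H ≤ 2 * Real.log T)
    (hc₀ : stepConst a κ ≤ c₀) (hH : c₀ * τ ^ 2 * Real.log T ^ 2 ≤ H) :
    StepSmall τ T γ a κ := by
  have hbias0 : 0 ≤ 80 * a / κ := by positivity
  have hvar0 : 0 ≤ 5808 * a ^ 2 / κ ^ 2 := by positivity
  have hlow : ∀ c, c ≤ stepConst a κ → c * (τ * Real.log T ^ 2) ≤ H := fun c hc =>
    mul_le_of_loop_ge ((stepConst_pos ha hκ).le.trans hc₀) (hc.trans hc₀) hτ hH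
  unfold stepConst at hlow
  have hbias := (hlow (80 * a / κ) (by linarith)).trans (Nat.cast_le.2 hHT)
  have hvar := hlow (5808 * a ^ 2 / κ ^ 2) (by linarith)
  rw [div_mul_eq_mul_div, div_le_iff₀' (by positivity)] at hbias hvar
  exact
    { T_ne := by lia
      pos := hγ0
      le_one := step_mul_coer_le_one hτ hT hγ (hlow 3 (by linarith))
      bias := mlmc_bias_le ha.le hT hbias
      var := mlmc_variance_le hκ hτ hT hH0 hγ hvar }

end Thresholds

/-- The factor `c₀` of the theorem: loops of at least `c₀ τ² (log T)²` steps are long enough for the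
critic and the actor recursions and for the two bounds on the step sizes. -/
def loopConst (G₁ μ lam cγ : ℝ) : ℝ :=
  stepConst (cγ + 3) (lam / 2) + stepConst (G₁ ^ 2) μ + 48 * cγ ^ 2 / lam ^ 2 +
    8 * (6 * G₁ ^ 4 + 2 * G₁ ^ 2) / μ ^ 2

section LoopConst

variable {G₁ μ lam cγ δ : ℝ} {τ T H : ℕ}

theorem loopConst_pos (hG : 0 < G₁) (hμ : 0 < μ) (hlam : 0 < lam) (hc : 0 < cγ) :
    0 < loopConst G₁ μ lam cγ := by
  have := stepConst_pos (show 0 < cγ + 3 by linarith) (half_pos hlam)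
  have := stepConst_pos (pow_pos hG 2) hμ
  unfold loopConst
  positivity

theorem summands_le_loopConst (hG : 0 < G₁) (hμ : 0 < μ) (hlam : 0 < lam) (hc : 0 < cγ) :
    stepConst (cγ + 3) (lam / 2) ≤ loopConst G₁ μ lam cγ ∧
    stepConst (G₁ ^ 2) μ ≤ loopConst G₁ μ lam cγ ∧
    48 * cγ ^ 2 / lam ^ 2 ≤ loopConst G₁ μ lam cγ ∧
    8 * (6 * G₁ ^ 4 + 2 * G₁ ^ 2) / μ ^ 2 ≤ loopConst G₁ μ lam cγ := by
  have := stepConst_pos (show 0 < cγ + 3 by linarith) (half_pos hlam)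
  have := stepConst_pos (pow_pos hG 2) hμ
  have : 0 ≤ 48 * cγ ^ 2 / lam ^ 2 := by positivity
  have : 0 ≤ 8 * (6 * G₁ ^ 4 + 2 * G₁ ^ 2) / μ ^ 2 := by positivity
  unfold loopConst
  refine ⟨?_, ?_, ?_, ?_⟩ <;> linarith

theorem loop_pos (hG : 0 < G₁) (hμ : 0 < μ) (hlam : 0 < lam) (hc : 0 < cγ)
    (hτ : 1 ≤ τ) (hT : 2 ≤ T)
    (hH : loopConst G₁ μ lam cγ * τ ^ 2 * Real.log T ^ 2 ≤ H) : 0 < H := by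
  have := loopConst_pos hG hμ hlam hc
  have hlog := log_gt_d4 hT
  have : (0 : ℝ) < Real.log T := by linarith
  exact Nat.cast_pos.1 (lt_of_lt_of_le (by positivity) hH)

theorem critic_step_le (hG : 0 < G₁) (hμ : 0 < μ) (hlam : 0 < lam) (hc : 0 < cγ)
    (hτ : 1 ≤ τ) (hT : 2 ≤ T)
    (hH : loopConst G₁ μ lam cγ * τ ^ 2 * Real.log T ^ 2 ≤ H) :
    2 * Real.log T / (lam * H) ≤ lam / (24 * cγ ^ 2 * τ * Real.log T) := by
  obtain ⟨-, -, hle, -⟩ := summands_le_loopConst hG hμ hlam hc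
  have hlow := mul_le_of_loop_ge (loopConst_pos hG hμ hlam hc).le hle hτ hH
  have hlog := log_gt_d4 hT
  have : 0 < Real.log T := by linarith
  have : (0 : ℝ) < H := Nat.cast_pos.2 (loop_pos hG hμ hlam hc hτ hT hH)
  rw [div_mul_eq_mul_div, div_le_iff₀' (by positivity)] at hlow
  rw [div_le_div_iff₀ (by positivity) (by positivity)]
  linarith

theorem actor_step_le (hG : 0 < G₁) (hμ : 0 < μ) (hlam : 0 < lam) (hc : 0 < cγ)
    (hτ : 1 ≤ τ) (hT : 2 ≤ T)
    (hH : loopConst G₁ μ lam cγ * τ ^ 2 * Real.log T ^ 2 ≤ H) :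
    2 * Real.log T / (μ * H) ≤
      μ / (4 * (6 * G₁ ^ 4 * τ * Real.log T + 2 * G₁ ^ 2 * τ ^ 2 * Real.log T)) := by
  obtain ⟨-, -, -, hle⟩ := summands_le_loopConst hG hμ hlam hc
  have hlow : 8 * (6 * G₁ ^ 4 + 2 * G₁ ^ 2) / μ ^ 2 * (τ ^ 2 * Real.log T ^ 2) ≤ H := by
    rw [← mul_assoc]
    exact le_trans (by gcongr) hH
  have hlog := log_gt_d4 hT
  have : 0 < Real.log T := by linarith
  have : (0 : ℝ) < H := Nat.cast_pos.2 (loop_pos hG hμ hlam hc hτ hT hH)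
  have hτ' : (τ : ℝ) ≤ τ ^ 2 := le_self_pow₀ (Nat.one_le_cast.2 hτ) two_ne_zero
  have hτ2 := mul_le_mul_of_nonneg_left hτ' (show 0 ≤ 48 * G₁ ^ 4 * Real.log T ^ 2 by positivity)
  rw [div_mul_eq_mul_div, div_le_iff₀' (by positivity)] at hlow
  rw [div_le_div_iff₀ (by positivity) (by positivity)]
  linarith

theorem tuned_horizonParams (hG : 0 < G₁) (hμ : 0 < μ) (hlam : 0 < lam) (hc : 0 < cγ)
    (hτ : 1 ≤ τ) (hT : 2 ≤ T) (hHT : H ≤ T)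
    (hH : loopConst G₁ μ lam cγ * τ ^ 2 * Real.log T ^ 2 ≤ H) :
    Tuned G₁ μ lam (horizonParams μ lam cγ δ T H) τ := by
  obtain ⟨hcritic_le, hactor_le, -, -⟩ := summands_le_loopConst hG hμ hlam hc
  have hH0 := loop_pos hG hμ hlam hc hτ hT hH
  have : (0 : ℝ) < H := Nat.cast_pos.2 hH0
  have hlog : 0 ≤ Real.log T := Real.log_natCast_nonneg T
  have hdouble : Real.log T ≤ 2 * Real.log T := by linarith
  have hcritic : 2 * Real.log T / (lam * H) * (lam / 2) * H = Real.log T := by field_simp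
  have hactor : 2 * Real.log T / (μ * H) * μ * H = 2 * Real.log T := by field_simp
  exact
    { critic_step := stepSmall_of_loop_ge hτ hT hH0 hHT (add_pos hc three_pos) (half_pos hlam)
        (by unfold horizonParams; positivity) (hcritic.trans_le hdouble) hcritic_le hH
      critic_len := hcritic.ge
      actor_step := stepSmall_of_loop_ge hτ hT hH0 hHT (pow_pos hG 2) hμ
        (by unfold horizonParams; positivity) hactor.le hactor_le hH
      actor_len := hdouble.trans hactor.ge }

end LoopConst

end Tuning

section Regret

variable {S A : Type*} {d m : ℕ}

/-- The average over the first `K` epochs of the expectation of `f` at the state of the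
algorithm. -/
def epochAvg (M : CMDP S A) (π : E d → Policy S A) (φ : Sig → S → E m) (p : Params) (θ₀ : E d)
    (K : ℕ) (f : AlgState S d → ℝ) : ℝ :=
  (1 / (K : ℝ)) * ∑ k ∈ Finset.range K, ev (algLaw M π φ p θ₀ k) f

variable [Fintype S] [DecidableEq S] [Fintype A] {M : CMDP S A} {π : E d → Policy S A}
  {φ : Sig → S → E m} {G₁ G₂ μ lam : ℝ} {p : Params} {τ : ℕ} {πs : Policy S A} {εbias : ℝ}

theorem Setup.epochAvg_lagrangian (h : Setup M π φ p G₁ G₂ μ lam τ) (θ₀ : E d) (K : ℕ) (l : ℝ) :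
    epochAvg M π φ p θ₀ K (fun x => M.J .r πs - M.J .r (π x.θ) - l * M.J .c (π x.θ)) =
      epochAvg M π φ p θ₀ K (fun x => M.J .r πs - M.J .r (π x.θ)) +
        l * epochAvg M π φ p θ₀ K (fun x => -M.J .c (π x.θ)) := by
  simp only [epochAvg, sub_eq_add_neg _ (l * _), ← mul_neg]
  simp only [(h.finSupp_algLaw θ₀ _).ev_add, (h.finSupp_algLaw θ₀ _).ev_mul]
  rw [Finset.sum_add_distrib, ← Finset.mul_sum]
  ring

theorem Setup.epochAvg_nonneg (h : Setup M π φ p G₁ G₂ μ lam τ) (θ₀ : E d) (K : ℕ)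
    {f : AlgState S d → ℝ} (hf : ∀ x, 0 ≤ f x) : 0 ≤ epochAvg M π φ p θ₀ K f :=
  mul_nonneg (by positivity)
    (Finset.sum_nonneg fun k _ => (h.finSupp_algLaw θ₀ k).ev_nonneg hf)

theorem Setup.epochAvg_lagrangian_le (h : Setup M π φ p G₁ G₂ μ lam τ) (hG₂ : 0 ≤ G₂)
    (hα : p.α = 1 / √p.Tmax) (hβ : p.β = 1 / √p.Tmax) (hδ : 0 < p.δ)
    (hb : BiasBound M π πs p.δ εbias) (hJc : 0 ≤ M.J .c πs) (θ₀ : E d) {K : ℕ} (hK : 0 < K)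
    {l₀ : ℝ} (hl₀ : l₀ ∈ Set.Icc 0 (2 / p.δ)) :
    epochAvg M π φ p θ₀ K (fun x => M.J .r πs - M.J .r (π x.θ) - l₀ * M.J .c (π x.θ)) ≤
      (M.klFrom πs (π θ₀) + 2 / p.δ ^ 2) / (p.α * K) + epochErr G₁ G₂ μ lam p.cγ p.δ τ *
        (√εbias + √(epsApp M π φ p.cγ) + 1 / √p.Tmax) := by
  have hregret := h.lagrangian_regret hα hβ hδ hb hJc hG₂ θ₀ hl₀ K
  have : (0 : ℝ) < p.Tmax := Nat.cast_pos.2 (Nat.pos_of_ne_zero h.critic_step.T_ne)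
  have : (0 : ℝ) < K := Nat.cast_pos.2 hK
  have hα0 : 0 < p.α := by rw [hα]; positivity
  have hl₀sq : l₀ ^ 2 / 2 ≤ 2 / p.δ ^ 2 :=
    calc l₀ ^ 2 / 2 ≤ (2 / p.δ) ^ 2 / 2 := by gcongr; exacts [hl₀.1, hl₀.2]
      _ = 2 / p.δ ^ 2 := by ring
  rw [epochAvg]
  generalize epochErr G₁ G₂ μ lam p.cγ p.δ τ * _ = R at hregret ⊢
  generalize ∑ k ∈ Finset.range K, ev (algLaw M π φ p θ₀ k) (fun x => _ : _ → ℝ) = Y at hregret ⊢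
  calc 1 / (K : ℝ) * Y = p.α * Y / (p.α * K) := by field_simp
    _ ≤ (M.klFrom πs (π θ₀) + 2 / p.δ ^ 2 + K * (p.α * R)) / (p.α * K) :=
      div_le_div_of_nonneg_right (by linarith) (by positivity)
    _ = (M.klFrom πs (π θ₀) + 2 / p.δ ^ 2) / (p.α * K) + R := by field_simp

theorem gap_le_and_violation_le_of_lagrangian_le {gap viol l δ B : ℝ} (hδ : 0 < δ) (hδ1 : δ ≤ 1)
    (hl0 : 0 ≤ l) (hl1 : l ≤ 1 / δ) (hdual : 0 ≤ gap + l * viol)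
    (hB : ∀ l₀ ∈ Set.Icc 0 (2 / δ), gap + l₀ * viol ≤ B) : gap ≤ B ∧ viol ≤ B := by
  have htwo : 2 / δ = 1 / δ + 1 / δ := by ring
  have hinv : 1 ≤ 1 / δ := one_le_one_div hδ hδ1
  have hB0 : 0 ≤ B := hdual.trans (hB l ⟨hl0, by linarith⟩)
  have hend := hB (2 / δ) ⟨by positivity, le_rfl⟩
  refine ⟨by linarith [hB 0 ⟨le_rfl, by positivity⟩], ?_⟩
  rcases le_total viol 0 with hneg | hpos
  · exact hneg.trans hB0
  · calc viol ≤ (2 / δ - l) * viol := le_mul_of_one_le_left hpos (by linarith)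
      _ ≤ B := by linarith

theorem Setup.epochAvg_gap_le_and_violation_le (h : Setup M π φ p G₁ G₂ μ lam τ) (hG₂ : 0 ≤ G₂)
    (hα : p.α = 1 / √p.Tmax) (hβ : p.β = 1 / √p.Tmax) (hδ : 0 < p.δ) (hδ1 : p.δ ≤ 1)
    (hb : BiasBound M π πs p.δ εbias) (hopt : M.IsOptimal πs) (hsl : Slater M π p.δ) (θ₀ : E d)
    {K : ℕ} (hK : 0 < K) {B : ℝ}
    (hB : (M.klFrom πs (π θ₀) + 2 / p.δ ^ 2) / (p.α * K) + epochErr G₁ G₂ μ lam p.cγ p.δ τ *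
      (√εbias + √(epsApp M π φ p.cγ) + 1 / √p.Tmax) ≤ B) :
    epochAvg M π φ p θ₀ K (fun x => M.J .r πs - M.J .r (π x.θ)) ≤ B ∧
      epochAvg M π φ p θ₀ K (fun x => -M.J .c (π x.θ)) ≤ B := by
  obtain ⟨θb, hθb⟩ := hsl
  obtain ⟨l, hl0, hl1, hl⟩ := h.ergodic.exists_multiplier hδ hopt hθb
  refine gap_le_and_violation_le_of_lagrangian_le hδ hδ1 hl0 hl1 ?_ fun l₀ hl₀ => ?_
  · rw [← h.epochAvg_lagrangian]
    exact h.epochAvg_nonneg θ₀ K fun x => by linarith [hl (π x.θ)]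
  · rw [← h.epochAvg_lagrangian]
    exact (h.epochAvg_lagrangian_le hG₂ hα hβ hδ hb hopt.1 θ₀ hK hl₀).trans hB

end Regret

section Rate

variable {T H : ℕ}

theorem one_le_of_pos_of_le_mul_sq {c ℓ : ℝ} {τ : ℕ} (hH : 0 < H) (hle : H ≤ c * τ ^ 2 * ℓ) :
    1 ≤ τ := by
  by_contra! hτ
  obtain rfl : τ = 0 := by lia
  have : (H : ℝ) ≤ 0 := by simpa using hle
  have : (0 : ℝ) < H := Nat.cast_pos.2 hH
  linarith

theorem one_div_sqrt_mul_div_le (hH : 0 < H) (hHT : H ≤ T) :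
    1 / (1 / √(T : ℝ) * (T / H : ℕ)) ≤ 2 * H * (1 / √(T : ℝ)) := by
  have hT0 : (0 : ℝ) < T := Nat.cast_pos.2 (by lia)
  have hK : 0 < T / H := Nat.div_pos hHT hH
  have : (0 : ℝ) < (T / H : ℕ) := Nat.cast_pos.2 hK
  have hTHK : (T : ℝ) ≤ 2 * (H * (T / H : ℕ)) := by
    have hlt : T < H * (T / H + 1) := Nat.lt_mul_div_succ T hH
    have hle : H * (T / H + 1) ≤ 2 * (H * (T / H)) := by nlinarith
    exact_mod_cast hlt.le.trans hle
  rw [div_le_iff₀ (by positivity)]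
  calc 1 ≤ 2 * (H * (T / H : ℕ)) / (T : ℝ) := (one_le_div hT0).2 hTHK
    _ = 2 * (H * (T / H : ℕ)) / (√(T : ℝ) * √(T : ℝ)) := by rw [Real.mul_self_sqrt hT0.le]
    _ = 2 * H * (1 / √(T : ℝ)) * (1 / √(T : ℝ) * (T / H : ℕ)) := by ring

theorem horizonParams_α (μ lam cγ δ : ℝ) (T H : ℕ) :
    (horizonParams μ lam cγ δ T H).α = 1 / √(T : ℝ) := by
  change (T : ℝ) ^ (-(1 / 2) : ℝ) = _
  rw [Real.rpow_neg T.cast_nonneg, Real.sqrt_eq_rpow, one_div, one_div]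

/-- The constant `C` of the theorem. The factor `1 / (log 2) ^ q` turns the error terms, which carry
no logarithm, into multiples of `(log T) ^ q`. -/
def rateConst (q : ℕ) (G₁ G₂ μ lam cγ δ c₁ D : ℝ) (τ : ℕ) : ℝ :=
  epochErr G₁ G₂ μ lam cγ δ τ / Real.log 2 ^ q + 2 * |c₁| * τ ^ 2 * (|D| + 2 / δ ^ 2) + 1

variable {q : ℕ} {G₁ G₂ μ lam cγ δ c₁ D : ℝ} {τ : ℕ}

theorem horizonParams_step_le (hG : 0 < G₁) (hμ : 0 < μ) (hlam : 0 < lam) (hc : 0 < cγ)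
    {ℓ : ℝ} (hT : 2 ≤ T)
    (hH : loopConst G₁ μ lam cγ * τ ^ 2 * Real.log T ^ 2 ≤ H) (hH₁ : H ≤ c₁ * τ ^ 2 * ℓ) :
    (horizonParams μ lam cγ δ T H).γξ ≤ lam / (24 * cγ ^ 2 * τ * Real.log T) ∧
    (horizonParams μ lam cγ δ T H).γω ≤
      μ / (4 * (6 * G₁ ^ 4 * τ * Real.log T + 2 * G₁ ^ 2 * τ ^ 2 * Real.log T)) := by
  rcases Nat.eq_zero_or_pos H with rfl | hH0
  · have : 0 ≤ Real.log T := Real.log_natCast_nonneg T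
    simp only [horizonParams, Nat.cast_zero, mul_zero, div_zero]
    constructor <;> positivity
  · have hτ := one_le_of_pos_of_le_mul_sq hH0 hH₁
    exact ⟨critic_step_le hG hμ hlam hc hτ hT hH, actor_step_le hG hμ hlam hc hτ hT hH⟩

theorem rateConst_pos (hG : 0 < G₁) (hμ : 0 < μ) (hlam : 0 < lam) (hc : 0 < cγ)
    (hG₂ : 0 ≤ G₂) (hδ : 0 < δ) : 0 < rateConst q G₁ G₂ μ lam cγ δ c₁ D τ := by
  have := epochErr_nonneg hG hG₂ hμ hlam hc hδ τ
  have := Real.log_pos one_lt_two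
  unfold rateConst
  positivity

theorem regret_le_rateConst_mul (hG : 0 < G₁) (hμ : 0 < μ) (hlam : 0 < lam) (hc : 0 < cγ)
    (hG₂ : 0 ≤ G₂) (hδ : 0 < δ) {kl X : ℝ} (hkl : kl ≤ D) (hT : 2 ≤ T) (hH : 0 < H) (hHT : H ≤ T)
    (hH₁ : H ≤ c₁ * τ ^ 2 * Real.log T ^ q) (hX : 1 / √(T : ℝ) ≤ X) :
    (kl + 2 / δ ^ 2) / (1 / √(T : ℝ) * (T / H : ℕ)) + epochErr G₁ G₂ μ lam cγ δ τ * X ≤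
      rateConst q G₁ G₂ μ lam cγ δ c₁ D τ * Real.log T ^ q * X := by
  have hX0 : 0 ≤ X := le_trans (by positivity) hX
  have hlog0 : 0 ≤ Real.log T := Real.log_natCast_nonneg T
  have hE := epochErr_nonneg hG hG₂ hμ hlam hc hδ τ
  have hH₁' : (H : ℝ) ≤ |c₁| * τ ^ 2 * Real.log T ^ q :=
    hH₁.trans (by gcongr; exact le_abs_self c₁)
  have hinit : (kl + 2 / δ ^ 2) / (1 / √(T : ℝ) * (T / H : ℕ)) ≤
      2 * |c₁| * τ ^ 2 * (|D| + 2 / δ ^ 2) * Real.log T ^ q * X :=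
    calc _ = (kl + 2 / δ ^ 2) * (1 / (1 / √(T : ℝ) * (T / H : ℕ))) := div_eq_mul_one_div _ _
      _ ≤ (|D| + 2 / δ ^ 2) * (2 * (|c₁| * τ ^ 2 * Real.log T ^ q) * X) := by
        refine mul_le_mul (by linarith [le_abs_self D]) ?_ (by positivity) (by positivity)
        exact (one_div_sqrt_mul_div_le hH hHT).trans (by gcongr)
      _ = _ := by ring
  have hlog2 : 0 < Real.log 2 := Real.log_pos one_lt_two
  have hpow : 1 ≤ Real.log T ^ q / Real.log 2 ^ q :=
    (one_le_div (by positivity)).2 (pow_le_pow_left₀ hlog2.le (log_two_le_log hT) q)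
  have herr := le_mul_of_one_le_right (mul_nonneg hE hX0) hpow
  calc _ ≤ 2 * |c₁| * τ ^ 2 * (|D| + 2 / δ ^ 2) * Real.log T ^ q * X +
        epochErr G₁ G₂ μ lam cγ δ τ * X * (Real.log T ^ q / Real.log 2 ^ q) +
        Real.log T ^ q * X := by linarith [mul_nonneg (pow_nonneg hlog0 q) hX0]
    _ = _ := by unfold rateConst; ring

end Rate

end PDNAC

end

theorem mainTheorem1 (q : ℕ) :
    ∃ p : ℕ, ∀ G₁ G₂ μ lam cγ δ : ℝ,
      0 < G₁ → 0 < G₂ → 0 < μ → 0 < lam → lam + Real.sqrt (1 / lam ^ 2 - 1) ≤ cγ →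
      0 < δ → δ < 1 →
    ∃ c₀ : ℝ, 0 < c₀ ∧ ∀ (c₁ D : ℝ) (τ : ℕ), ∃ C : ℝ, 0 < C ∧
    ∀ (S A : Type) [Fintype S] [DecidableEq S] [Fintype A] (d m : ℕ)
      (M : CMDP S A) (π : E d → Policy S A) (φ : Sig → S → E m)
      (πs : Policy S A) (θ₀ : E d) (εbias : ℝ) (T H : ℕ),
      Slater M π δ →
      M.Ergodic →
      (∀ g s, ‖φ g s‖ ≤ 1) →
      CriticErrFinite M π φ cγ →
      CriticPosDef M π φ lam →
      M.IsOptimal πs →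
      BiasBound M π πs δ εbias →
      ScoreBounds π G₁ G₂ →
      FisherNonDeg M π μ →
      tauMix M π = τ →
      M.klFrom πs (π θ₀) ≤ D →
      2 ≤ T →
      c₀ * τ ^ 2 * Real.log T ^ 2 ≤ H →
      H ≤ c₁ * τ ^ 2 * Real.log T ^ q →
      (horizonParams μ lam cγ δ T H).γξ ≤ lam / (24 * cγ ^ 2 * τ * Real.log T) ∧
      (horizonParams μ lam cγ δ T H).γω ≤
        μ / (4 * (6 * G₁ ^ 4 * τ * Real.log T + 2 * G₁ ^ 2 * τ ^ 2 * Real.log T)) ∧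
      (1 / ((T / H : ℕ) : ℝ)) * ∑ k ∈ Finset.range (T / H),
          expect (algLaw M π φ (horizonParams μ lam cγ δ T H) θ₀ k)
            (fun x => M.J .r πs - M.J .r (π x.θ))
        ≤ C * Real.log T ^ p * (√εbias + √(epsApp M π φ cγ) + 1 / √(T : ℝ)) ∧
      (1 / ((T / H : ℕ) : ℝ)) * ∑ k ∈ Finset.range (T / H),
          expect (algLaw M π φ (horizonParams μ lam cγ δ T H) θ₀ k)
            (fun x => -M.J .c (π x.θ))
        ≤ C * Real.log T ^ p * (√εbias + √(epsApp M π φ cγ) + 1 / √(T : ℝ)) := by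
  refine ⟨q, fun G₁ G₂ μ lam cγ δ hG₁ hG₂ hμ hlam hcγ hδ hδ1 => ?_⟩
  have hc : 0 < cγ := by linarith [Real.sqrt_nonneg (1 / lam ^ 2 - 1)]
  have hC (c₁ D τ) := rateConst_pos (q := q) (c₁ := c₁) (D := D) (τ := τ) hG₁ hμ hlam hc hG₂.le hδ
  refine ⟨loopConst G₁ μ lam cγ, loopConst_pos hG₁ hμ hlam hc, fun c₁ D τ => ⟨_, hC c₁ D τ, ?_⟩⟩
  intro S A _ _ _ d m M π φ πs θ₀ εbias T H hsl herg hfeat herr hpd hopt hb hS hF hmix hkl hT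
    hH₀ hH₁
  obtain ⟨hγξ, hγω⟩ := horizonParams_step_le (δ := δ) hG₁ hμ hlam hc hT hH₀ hH₁
  refine ⟨hγξ, hγω, ?_⟩
  rcases Nat.eq_zero_or_pos (T / H) with hK | hK
  · have := hC c₁ D τ
    have := Real.log_natCast_nonneg T
    rw [hK, Nat.cast_zero, div_zero, zero_mul, zero_mul]
    constructor <;> positivity
  obtain ⟨hH, hHT⟩ := Nat.div_pos_iff.1 hK
  have hτ := one_le_of_pos_of_le_mul_sq hH hH₁
  have hset : Setup M π φ (horizonParams μ lam cγ δ T H) G₁ G₂ μ lam τ :=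
    { norm_feat_le := hfeat, lam_pos := hlam, cγ_ge := hcγ, posDef := hpd, score := hS
      fisher := hF, G₁_pos := hG₁, μ_pos := hμ, ergodic := herg, errFin := herr, one_le := hτ
      mix := mixTime_le_of_tauMix hmix hτ
      toTuned := tuned_horizonParams hG₁ hμ hlam hc hτ hT hHT hH₀ }
  have hα := horizonParams_α μ lam cγ δ T H
  refine hset.epochAvg_gap_le_and_violation_le hG₂.le hα hα hδ hδ1.le hb hopt hsl θ₀ hK ?_
  rw [hα]
  exact regret_le_rateConst_mul hG₁ hμ hlam hc hG₂.le hδ hkl hT hH hHT hH₁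
    (le_add_of_nonneg_left (by positivity))
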